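/- Let $k$ be a field and let $\Sigma$ be a simplicial complex on the vertex set $V=\{v_1,\dots,v_n\}$: a set of subsets of $V$ (the faces) containing $\varnothing$ and every $\{v_i\}$ and closed under passing to subsets. The dimension of a face is its number of elements minus one, and $\dim\Sigma$ is the maximal dimension of a face. For a face $\sigma$ the link is $\operatorname{lk}\sigma=\{\tau\in\Sigma \mid \sigma\cap\tau=\varnothing,\ \sigma\cup\tau\in\Sigma\}$. Let $\tilde H_i$ and $\tilde H^i$ ($i\in\mathbb Z$) denote reduced simplicial homology and cohomology, i.e. the homology of the augmented (co)chain complex, in which the empty face has degree $-1$. Let $R=k[X_1,\dots,X_n]$, let $k[\Sigma]=R/I_\Sigma$ be the face ring, where $I_\Sigma$ is generated by the monomials $\prod_{v_i\in s}X_i$ with $s\subseteq V$, $s\notin\Sigma$, and regard $k=R/(X_1,\dots,X_n)$ as an $R$-module. Suppose that $\Sigma$ is pure of dimension $d$ (all maximal faces have dimension $d=\dim\Sigma$) and that \[ \tilde H_i(\operatorname{lk}\sigma,k)=0\qquad\text{for every non-empty face } \sigma\in\Sigma \text{ and every } i<\dim(\operatorname{lk}\sigma). \] Then for every $i>n-d-1$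 there is an isomorphism of $R$-modules (the $X_l$ acting by zero on the right-hand side) \[ \operatorname{Tor}_i^R(k[\Sigma],k)\;\cong\;\bigoplus_{j=0}^{n}\tilde H^{\,j-i-1}\bigl(\Sigma,\textstyle\bigwedge^j k^n\bigr). \] Moreover, the following are equivalent: (a) $\tilde H_i(\Sigma,k)=0$ for all $i<d$; (b) $\operatorname{Tor}_i^R(k[\Sigma],k)=0$ for all $i>n-d-1$; (c) $k[\Sigma]$ is a Cohen–Macaulay ring. -/

import Mathlib

universe u

/-- A finite simplicial complex with vertices taken from `V`: a finite set of finite subsets of `V`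
(the faces), closed under passing to subsets, with the empty face included. Not every element of
`V` has to be a vertex, so that links are complexes over the same `V`. -/
structure FaceComplex (V : Type) where
  faces : Finset (Finset V)
  empty_mem : ∅ ∈ faces
  down_closed : ∀ ⦃σ τ : Finset V⦄, σ ∈ faces → τ ⊆ σ → τ ∈ faces

namespace FaceComplex

/-- The dimension: the maximal cardinality of a face, minus one (`-1` for the complex `{∅}`). -/
def dim {V : Type} (K : FaceComplex V) : ℤ := ((K.faces.sup Finset.card : ℕ) : ℤ) - 1

/-- All maximal faces have the same dimension. -/
def IsPure {V : Type} (K : FaceComplex V) : Prop :=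
  ∀ σ τ : Finset V, Maximal (· ∈ K.faces) σ → Maximal (· ∈ K.faces) τ → σ.card = τ.card

/-- The link of a face `σ`: the faces `τ` disjoint from `σ` such that `σ ∪ τ` is a face. -/
def link {V : Type} [DecidableEq V] (K : FaceComplex V) (σ : Finset V) (hσ : σ ∈ K.faces) :
    FaceComplex V where
  faces := K.faces.filter fun τ => Disjoint σ τ ∧ σ ∪ τ ∈ K.faces
  empty_mem := by simp [K.empty_mem, hσ]
  down_closed := by
    intro τ ρ hτ hρ
    rw [Finset.mem_filter] at hτ ⊢
    exact ⟨K.down_closed hτ.1 hρ, hτ.2.1.mono_right hρ,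
      K.down_closed hτ.2.2 (Finset.union_subset_union_right hρ)⟩

/-- The faces of dimension `i`, i.e. with `i + 1` elements. -/
def facesOfDim {V : Type} (K : FaceComplex V) (i : ℤ) : Finset (Finset V) :=
  K.faces.filter fun σ => (σ.card : ℤ) = i + 1

/-- The coefficient of `τ` in `∂σ`: it is `(-1) ^ j` if `τ` is obtained from
`σ = {v₀ < ⋯ < vᵢ}` by omitting `vⱼ`, and `0` if `τ` is not of this form. -/
def incidence {V : Type} [LinearOrder V] (σ τ : Finset V) : ℤ :=
  ∑ v ∈ σ, if σ.erase v = τ then (-1) ^ (σ.filter (· < v)).card else 0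

section Homology

variable {V : Type} [LinearOrder V] (K : FaceComplex V) (k : Type u) [Field k]
  (G : Type u) [AddCommGroup G] [Module k G]

/-- The component from degree `i` to degree `j` of the boundary of the augmented chain complex with
coefficients in `G`; it vanishes unless `j = i - 1`. A chain of degree `i` is a function from the
`i`-dimensional faces to `G`. -/
def boundary (i j : ℤ) : (K.facesOfDim i → G) →ₗ[k] (K.facesOfDim j → G) :=
  LinearMap.pi fun τ => ∑ σ : K.facesOfDim i, incidence σ.1 τ.1 • LinearMap.proj σ

/-- The component from degree `i` to degree `j` of the differential of the augmented cochain
complex with coefficients in `G`, dual to the boundary: `(δφ)(σ) = φ(∂σ)`; it vanishes unless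
`j = i + 1`. -/
def coboundary (i j : ℤ) : (K.facesOfDim i → G) →ₗ[k] (K.facesOfDim j → G) :=
  LinearMap.pi fun σ => ∑ τ : K.facesOfDim i, incidence σ.1 τ.1 • LinearMap.proj τ

/-- The reduced simplicial homology of `K` in degree `i` with coefficients in `G`. -/
def ReducedHomology (i : ℤ) : Type u :=
  LinearMap.ker (K.boundary k G i (i - 1)) ⧸
    (LinearMap.range (K.boundary k G (i + 1) i)).submoduleOf
      (LinearMap.ker (K.boundary k G i (i - 1)))

/-- The reduced simplicial cohomology of `K` in degree `i` with coefficients in `G`. -/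
def ReducedCohomology (i : ℤ) : Type u :=
  LinearMap.ker (K.coboundary k G i (i + 1)) ⧸
    (LinearMap.range (K.coboundary k G (i - 1) i)).submoduleOf
      (LinearMap.ker (K.coboundary k G i (i + 1)))

instance (i : ℤ) : AddCommGroup (K.ReducedHomology k G i) :=
  inferInstanceAs (AddCommGroup (_ ⧸ _))

instance (i : ℤ) : Module k (K.ReducedHomology k G i) :=
  inferInstanceAs (Module k (_ ⧸ _))

instance (i : ℤ) : AddCommGroup (K.ReducedCohomology k G i) :=
  inferInstanceAs (AddCommGroup (_ ⧸ _))

instance (i : ℤ) : Module k (K.ReducedCohomology k G i) :=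
  inferInstanceAs (Module k (_ ⧸ _))

end Homology

section FaceRing

variable {n : ℕ} (K : FaceComplex (Fin n)) (k : Type u) [Field k]

/-- The ideal of `k[X₁, …, Xₙ]` generated by the squarefree monomials whose support is not a
face. -/
noncomputable def faceIdeal : Ideal (MvPolynomial (Fin n) k) :=
  Ideal.span {p | ∃ s : Finset (Fin n), s ∉ K.faces ∧ p = ∏ v ∈ s, MvPolynomial.X v}

/-- The face ring (Stanley–Reisner ring) `k[K]`. -/
abbrev FaceRing : Type u := MvPolynomial (Fin n) k ⧸ K.faceIdeal k

/-- `Tor_i^R(k[K], k)`, where `R = k[X₁, …, Xₙ]` and `k = R / (X₁, …, Xₙ)`. -/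
noncomputable def torFaceRing (i : ℕ) : ModuleCat.{u} (MvPolynomial (Fin n) k) :=
  ((CategoryTheory.Tor (ModuleCat.{u} (MvPolynomial (Fin n) k)) i).obj
    (ModuleCat.of (MvPolynomial (Fin n) k) (K.FaceRing k))).obj
    (ModuleCat.of (MvPolynomial (Fin n) k)
      (MvPolynomial (Fin n) k ⧸
        Ideal.span (Set.range (MvPolynomial.X : Fin n → MvPolynomial (Fin n) k))))

end FaceRing

end FaceComplex

/-- The depth of a local ring: the supremum of the lengths of the regular sequences in its maximal
ideal. -/
noncomputable def localDepth (A : Type u) [CommRing A] [IsLocalRing A] : ℕ∞ :=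
  ⨆ (rs : List A) (_ : RingTheory.Sequence.IsRegular A rs ∧
    ∀ r ∈ rs, r ∈ IsLocalRing.maximalIdeal A), (rs.length : ℕ∞)

/-- A Cohen–Macaulay ring: it is Noetherian, and its localizations at the maximal ideals have depth
equal to their Krull dimension. -/
def IsCohenMacaulayRing (A : Type u) [CommRing A] : Prop :=
  IsNoetherianRing A ∧ ∀ (P : Ideal A) [P.IsMaximal],
    (localDepth (Localization.AtPrime P) : WithBot ℕ∞) = ringKrullDim (Localization.AtPrime P)

/-! The Koszul complex of the variables resolves `k` over `R` (`exactAt_mvPolynomial`), so Tor is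
the Koszul homology of the face ring (`torIso`). Dividing by `X l` the monomials divisible by `X l ^
2` preserves the face ideal and gives homotopies that push every cycle into squarefree multidegrees
(`exists_eq_theta_add_diff`, `exists_theta_cobd_eq`). In multidegree `U` the Koszul generator `x^F
e_{U \ F}` corresponds to the face `F ⊆ U`, and the differential becomes the simplicial coboundary
(`diff_theta`). This is Hochster's formula: `Tor_i` is the sum over `U` of the reduced cohomology of
`Σ|_U` in degree `|U| - i - 1`.

The restriction `Σ|_U` arises from `Σ` by deleting the vertices outside `U`. Deleting one vertex
gives a long exact sequence whose third term is the cohomology of its link, so restriction is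
bijective on cohomology where links are acyclic, and each deletion shortens the acyclic range of the
links by one (`LinksAcyclic.delSet_singleton`). In degree `|U| - i - 1` the bound needed is `n - i <
d + 1`, the same for all `U`. So for `i > n - d - 1` every `Σ|_U` may be replaced by `Σ`, and the
sets `U` with `j` elements index a basis of the `j`-th exterior power (`ker_toKoszul`,
`toKoszul_surjective`).

For the equivalences, homology and cohomology over a field vanish together by a rank count. If `Σ`
is acyclic below the top, so are the restrictions in the relevant degrees, which kills Tor;
conversely the multidegree `U = V` recovers `Σ`. If the face ring is Cohen–Macaulay, a regular
sequence of length `d + 1` in the localization at the origin kills the Koszul homology above `n - d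
- 1`, and this descends to the face ring (`ExactAt.of_localization`). For the converse, the
variables outside a maximal ideal `P` form a face `F`, and the localization at `P` is one of `k[lk
F][X_v : v ∈ F]`. Koszul vanishing for `lk F` gives `d + 1 - |F|` regular elements, and the
Nullstellensatz adds `|F|` monic polynomials, one per variable (`le_localDepth_of_isWeaklyRegular`).
The dimension is at most `d + 1`, so depth and dimension agree. -/

set_option linter.unusedSectionVars false

namespace Koszul

open Finset

/-! ### Signs of the exterior algebra -/

section Sign

variable {ι : Type*} [LinearOrder ι]

/-- The sign of inserting `l` into the ordered set `T`. -/
def sgn (l : ι) (T : Finset ι) : ℤ := (-1) ^ (T.filter (· < l)).card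

lemma sgn_mul_self (l : ι) (T : Finset ι) : sgn l T * sgn l T = 1 := by
  rw [sgn, ← pow_add, ← two_mul]; simp

lemma sgn_smul_sgn_smul {M : Type*} [AddCommGroup M] (l : ι) (T : Finset ι) (y : M) :
    sgn l T • sgn l T • y = y := by
  rw [smul_smul, sgn_mul_self, one_smul]

lemma sgn_insert {m : ι} {T : Finset ι} (l : ι) (hm : m ∉ T) :
    sgn l (insert m T) = if m < l then -sgn l T else sgn l T := by
  unfold sgn
  rw [filter_insert]
  split_ifs with h
  · rw [card_insert_of_notMem (by simp [hm]), pow_succ]; simp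
  · rfl

lemma sgn_insert_self (l : ι) (T : Finset ι) : sgn l (insert l T) = sgn l T := by
  unfold sgn
  rw [filter_insert, if_neg (lt_irrefl l)]

/-- Only the larger of `l` and `m` counts the other as a predecessor, so exactly one of the two
signs flips. This is the cancellation behind `diff_diff` and `cobd_cobd`. -/
lemma sgn_swap {l m : ι} {T : Finset ι} (hlm : l ≠ m) (hl : l ∉ T) (hm : m ∉ T) :
    sgn l T * sgn m (insert l T) = -(sgn m T * sgn l (insert m T)) := by
  rw [sgn_insert _ hl, sgn_insert _ hm]
  rcases lt_or_gt_of_ne hlm with h | h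
  · rw [if_pos h, if_neg h.not_gt]; ring
  · rw [if_neg h.not_gt, if_pos h]; ring

lemma sgn_insert_mul_sgn_insert {l m : ι} {T : Finset ι} (hlm : l ≠ m) (hl : l ∉ T) (hm : m ∉ T) :
    sgn l (insert m T) * sgn m (insert l T) = -(sgn l T * sgn m T) := by
  rw [sgn_insert _ hl, sgn_insert _ hm]
  rcases lt_or_gt_of_ne hlm with h | h
  · rw [if_pos h, if_neg h.not_gt]; ring
  · rw [if_neg h.not_gt, if_pos h]; ring

end Sign

/-! ### The Koszul complex and its contracting homotopies -/

variable {ι : Type*} [LinearOrder ι] [Fintype ι]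
  {S : Type*} [CommRing S] {M : Type*} [AddCommGroup M] [Module S M]

/-- The Koszul differential for the sequence `x`, on all degrees at once: a chain of degree `i`
assigns elements of `M` to the subsets of `ι` with `i` elements. -/
def diff (x : ι → S) : (Finset ι → M) →ₗ[S] (Finset ι → M) :=
  LinearMap.pi fun T => ∑ l ∈ Tᶜ, sgn l T • x l • LinearMap.proj (insert l T)

lemma diff_apply (x : ι → S) (φ : Finset ι → M) (T : Finset ι) :
    diff x φ T = ∑ l ∈ Tᶜ, sgn l T • x l • φ (insert l T) := by
  simp [diff]

lemma diff_diff (x : ι → S) (φ : Finset ι → M) : diff x (diff x φ) = 0 := by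
  funext T
  simp only [diff_apply, smul_sum, Pi.zero_apply]
  rw [sum_sigma']
  refine sum_involution (fun p _ => ⟨p.2, p.1⟩) ?_ ?_ ?_ ?_
  · rintro ⟨l, m⟩ h
    simp only [mem_sigma, mem_compl, mem_insert, not_or] at h
    obtain ⟨hl, hml, hm⟩ := h
    simp only [smul_comm (x _) (sgn _ _), smul_smul (sgn _ _) (sgn _ _)]
    rw [sgn_swap (Ne.symm hml) hl hm, Finset.insert_comm l m, smul_comm (x l) (x m), neg_smul,
      neg_add_cancel]
  · rintro ⟨l, m⟩ h _ heq
    simp only [mem_sigma, mem_compl, mem_insert, not_or] at h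
    simp only [Sigma.mk.injEq, heq_eq_eq] at heq
    exact h.2.1 heq.1
  · rintro ⟨l, m⟩ h
    simp only [mem_sigma, mem_compl, mem_insert, not_or] at h ⊢
    exact ⟨h.2.2, Ne.symm h.2.1, h.1⟩
  · rintro ⟨l, m⟩ _
    rfl

/-- This locality is what allows functions on all subsets to stand in for homogeneous chains: values
in the other degrees are never seen. -/
lemma diff_congr (x : ι → S) {φ ψ : Finset ι → M} {T : Finset ι}
    (h : ∀ W : Finset ι, W.card = T.card + 1 → φ W = ψ W) : diff x φ T = diff x ψ T := by
  rw [diff_apply, diff_apply]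
  refine sum_congr rfl fun l hl => ?_
  rw [h _ (card_insert_of_notMem (mem_compl.mp hl))]

lemma map_diff {S' M' : Type*} [CommRing S'] [AddCommGroup M'] [Module S' M'] (f : M →+ M')
    (x : ι → S) (x' : ι → S') (hf : ∀ l y, f (x l • y) = x' l • f y) (φ : Finset ι → M)
    (T : Finset ι) : f (diff x φ T) = diff x' (fun W => f (φ W)) T := by
  simp [diff_apply, map_sum, map_zsmul, hf]

/-- Exterior multiplication by the basis vector indexed by `l`, twisted by `q`. -/
def wedge (l : ι) (q : M →+ M) (φ : Finset ι → M) : Finset ι → M := fun T =>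
  if l ∈ T then sgn l (T.erase l) • q (φ (T.erase l)) else 0

/-- `wedge` vanishes on sets without `l`, so of the whole differential only the summand that inserts
`l` survives. -/
lemma diff_wedge_of_notMem {x : ι → S} {l : ι} {q : M →+ M} (φ : Finset ι → M)
    {T : Finset ι} (hl : l ∉ T) :
    diff x (wedge l q φ) T + wedge l q (diff x φ) T = x l • q (φ T) := by
  rw [wedge, if_neg hl, add_zero, diff_apply,
    sum_eq_single_of_mem l (mem_compl.mpr hl)]
  · rw [wedge, if_pos (mem_insert_self l T), erase_insert hl, smul_comm (x l),
      sgn_smul_sgn_smul]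
  · intro m _ hml
    rw [wedge, if_neg (by simp [hl, hml.symm])]
    simp

/-- The summands that insert some `m ≠ l` occur in both terms with opposite signs, because `q`
commutes with `x m`. What remains has `q` and `x l` in the opposite order to the case `l ∉ T`; the
two orders matter when `q` is only a partial division by `x l`. -/
lemma diff_wedge_of_mem {x : ι → S} {l : ι} {q : M →+ M}
    (hq : ∀ m, m ≠ l → ∀ y, q (x m • y) = x m • q y) (φ : Finset ι → M)
    {T : Finset ι} (hl : l ∈ T) :
    diff x (wedge l q φ) T + wedge l q (diff x φ) T = q (x l • φ T) := by
  obtain ⟨T, hlT, rfl⟩ : ∃ T', l ∉ T' ∧ insert l T' = T :=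
    ⟨T.erase l, notMem_erase l T, insert_erase hl⟩
  rw [wedge, if_pos hl, erase_insert hlT, diff_apply, diff_apply]
  have hc : Tᶜ = insert l (insert l T)ᶜ := by
    ext m; by_cases hm : m = l <;> simp [hm, hlT]
  rw [hc, sum_insert (by simp), map_add, smul_add, map_zsmul, sgn_smul_sgn_smul, map_sum, smul_sum,
    add_left_comm, ← sum_add_distrib, sum_eq_zero, add_zero]
  intro m hm
  simp only [mem_compl, mem_insert, not_or] at hm
  rw [wedge, if_pos (by simp), map_zsmul, hq m hm.1, Finset.insert_comm m l T,
    erase_insert (by simp [hlT, Ne.symm hm.1]), smul_comm (x m) (sgn l _), smul_smul, smul_smul,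
    ← add_smul, sgn_insert_mul_sgn_insert hm.1 hm.2 hlT, mul_comm (sgn l T), neg_add_cancel, zero_smul]

/-- The Koszul complex of `x` on `M` is exact in degree `i`. -/
def ExactAt (x : ι → S) (M : Type*) [AddCommGroup M] [Module S M] (i : ℕ) : Prop :=
  ∀ φ : Finset ι → M, (∀ T : Finset ι, T.card + 1 = i → diff x φ T = 0) →
    ∃ ψ : Finset ι → M, ∀ T : Finset ι, T.card = i → diff x ψ T = φ T

/-- The Koszul homology is annihilated by the elements of the sequence, and hence by the ideal
which they generate. -/
lemma exists_diff_eq_smul {x : ι → S} {i : ℕ} {φ : Finset ι → M}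
    (hφ : ∀ T : Finset ι, T.card + 1 = i → diff x φ T = 0) {a : S}
    (ha : a ∈ Ideal.span (Set.range x)) :
    ∃ ψ : Finset ι → M, ∀ T : Finset ι, T.card = i → diff x ψ T = a • φ T := by
  induction ha using Submodule.span_induction with
  | mem a h =>
    obtain ⟨l, rfl⟩ := h
    -- With `q = id` the homotopy formula reads `dh + hd = x l`, and `h d φ` vanishes since `φ` is a
    -- cycle.
    refine ⟨wedge l (AddMonoidHom.id M) φ, fun T hT => ?_⟩
    have hz : wedge l (AddMonoidHom.id M) (diff x φ) T = 0 := by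
      unfold wedge
      split_ifs with h
      · rw [hφ _ (by rw [card_erase_add_one h, hT])]; simp
      · rfl
    by_cases hl : l ∈ T
    · simpa [hz] using diff_wedge_of_mem (x := x) (q := AddMonoidHom.id M) (by simp) φ hl
    · simpa [hz] using diff_wedge_of_notMem (x := x) (q := AddMonoidHom.id M) φ hl
  | zero => exact ⟨0, by simp⟩
  | add a b _ _ h₁ h₂ =>
    obtain ⟨ψ₁, h₁⟩ := h₁
    obtain ⟨ψ₂, h₂⟩ := h₂
    exact ⟨ψ₁ + ψ₂, fun T hT => by rw [map_add, Pi.add_apply, h₁ T hT, h₂ T hT, add_smul]⟩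
  | smul r a _ h =>
    obtain ⟨ψ, h⟩ := h
    exact ⟨r • ψ, fun T hT => by rw [map_smul, Pi.smul_apply, h T hT, smul_assoc]⟩

end Koszul

/-! ### Koszul homology and regular sequences -/

namespace Koszul

open Finset RingTheory.Sequence

variable {ι : Type*} [LinearOrder ι] [Fintype ι] {S : Type*} [CommRing S]

section Quotient

variable {M : Type*} [AddCommGroup M] [Module S M]

lemma exists_lift_quotSMulTop {ι : Type*} (a : S) (φ : ι → QuotSMulTop a M) :
    ∃ ψ : ι → M, ∀ T, Submodule.Quotient.mk (ψ T) = φ T :=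
  ⟨fun T => (φ T).out, fun T => Quotient.out_eq (φ T)⟩

lemma mk_quotSMulTop_eq_iff (a : S) (y z : M) :
    (Submodule.Quotient.mk y : QuotSMulTop a M) = Submodule.Quotient.mk z ↔
      ∃ w, y - z = a • w := by
  rw [Submodule.Quotient.eq, Submodule.mem_smul_pointwise_iff_exists]
  simp [eq_comm]

lemma mk_diff (x : ι → S) (a : S) (φ : Finset ι → M) (T : Finset ι) :
    (Submodule.Quotient.mk (diff x φ T) : QuotSMulTop a M) =
      diff x (fun W => (Submodule.Quotient.mk (φ W) : QuotSMulTop a M)) T :=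
  map_diff (AddMonoidHomClass.toAddMonoidHom (F := M →ₗ[S] QuotSMulTop a M)
    (Submodule.mkQ _)) x x (fun _ _ => rfl) φ T

/-- As `a` acts by zero on Koszul homology, the long exact sequence of multiplication by `a` makes
the connecting map from degree `i + 1` of `M / aM` to degree `i` of `M` surjective. Explicitly: `aφ
= dψ`, then `ψ = dv + aw` by exactness modulo `a`, and cancelling `a` gives `φ = dw`. -/
lemma ExactAt.of_quotSMulTop {x : ι → S} {a : S} (ha : a ∈ Ideal.span (Set.range x))
    (hreg : IsSMulRegular M a) {i : ℕ} (h : ExactAt x (QuotSMulTop a M) (i + 1)) :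
    ExactAt x M i := by
  intro φ hφ
  obtain ⟨ψ, hψ⟩ := exists_diff_eq_smul hφ ha
  obtain ⟨u, hu⟩ := h (fun W => Submodule.Quotient.mk (ψ W)) (fun T hT => by
    rw [← mk_diff, hψ T (by simpa using hT), ← Submodule.Quotient.mk_zero, mk_quotSMulTop_eq_iff]
    exact ⟨φ T, by simp⟩)
  obtain ⟨v, hv⟩ := exists_lift_quotSMulTop a u
  obtain rfl : (fun T => Submodule.Quotient.mk (v T)) = u := funext hv
  have key : ∀ T : Finset ι, ∃ w, T.card = i + 1 → ψ T - diff x v T = a • w := by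
    intro T
    by_cases hT : T.card = i + 1
    · have := hu T hT
      rw [← mk_diff, eq_comm, mk_quotSMulTop_eq_iff] at this
      exact this.imp fun w hw _ => hw
    · exact ⟨0, fun h => (hT h).elim⟩
  choose w hw using key
  refine ⟨w, fun T hT => hreg ?_⟩
  change a • diff x w T = a • φ T
  rw [← hψ T hT, ← Pi.smul_apply, ← map_smul]
  have : diff x ψ T = diff x (diff x v + a • w) T :=
    diff_congr x fun W hW => by
      rw [Pi.add_apply, Pi.smul_apply, ← hw W (by omega)]; abel
  rw [this, map_add, diff_diff, zero_add]

/-- In the long exact sequence of multiplication by `a`, the homology of `M / aM` in degree `i + 1`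
sits between that of `M` in degrees `i + 1` and `i`. -/
lemma ExactAt.quotSMulTop {x : ι → S} {a : S} (hreg : IsSMulRegular M a) {i : ℕ}
    (h : ExactAt x M i) (h' : ExactAt x M (i + 1)) : ExactAt x (QuotSMulTop a M) (i + 1) := by
  intro φ hφ
  obtain ⟨z, hz⟩ := exists_lift_quotSMulTop a φ
  obtain rfl : (fun T => Submodule.Quotient.mk (z T)) = φ := funext hz
  have key : ∀ T : Finset ι, ∃ w, T.card = i → diff x z T = a • w := by
    intro T
    by_cases hT : T.card = i
    · have := hφ T (by omega)
      rw [← mk_diff, ← Submodule.Quotient.mk_zero, mk_quotSMulTop_eq_iff] at this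
      simpa [hT] using this
    · exact ⟨0, fun h => (hT h).elim⟩
  choose z' hz' using key
  -- Here `dz = az'`, so `a dz' = ddz = 0`, and regularity of `a` makes `z'` a cycle.
  obtain ⟨w, hw⟩ := h z' fun T hT => hreg <| by
    change a • diff x z' T = a • 0
    rw [← Pi.smul_apply, ← map_smul, smul_zero, ← Pi.zero_apply (M := fun _ => M) T,
      ← diff_diff x z]
    exact diff_congr x fun W hW => by rw [Pi.smul_apply, hz' W (by omega)]
  obtain ⟨v, hv⟩ := h' (z - a • w) fun T hT => by
    rw [map_sub, map_smul, Pi.sub_apply, Pi.smul_apply, hw T (by omega), hz' T (by omega),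
      sub_self]
  refine ⟨fun T => Submodule.Quotient.mk (v T), fun T hT => ?_⟩
  rw [← mk_diff, hv T hT, mk_quotSMulTop_eq_iff]
  exact ⟨-w T, by simp⟩

end Quotient

/-- A regular sequence in the ideal generated by `x` forces the top Koszul homology to vanish. -/
lemma exactAt_of_isWeaklyRegular {x : ι → S} {rs : List S}
    (hrs : ∀ r ∈ rs, r ∈ Ideal.span (Set.range x)) (M : Type*) [AddCommGroup M] [Module S M]
    (hreg : IsWeaklyRegular M rs) {i : ℕ} (hi : Fintype.card ι < i + rs.length) :
    ExactAt x M i := by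
  induction rs generalizing M i with
  | nil =>
    refine fun φ _ => ⟨0, fun T hT => ?_⟩
    have := T.card_le_univ
    simp at hi
    omega
  | cons r rs ih =>
    rw [isWeaklyRegular_cons_iff] at hreg
    refine ExactAt.of_quotSMulTop (hrs r (by simp)) hreg.1
      (ih (fun s hs => hrs s (by simp [hs])) _ hreg.2 ?_)
    simp only [List.length_cons] at hi
    omega

/-- If no nonzero element of `M` is annihilated by `x`, the ideal generated by `x` contains an
`M`-regular element. -/
lemma exists_isSMulRegular {ι : Type*} [IsNoetherianRing S] {x : ι → S} (M : Type*) [AddCommGroup M]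
    [Module S M] [Module.Finite S M] (h : ∀ y : M, (∀ l, x l • y = 0) → y = 0) :
    ∃ a ∈ Ideal.span (Set.range x), IsSMulRegular M a := by
  -- Prime avoidance: an ideal of zero divisors on `M` would lie in a single associated prime, the
  -- annihilator of some `y`, and `y` would then be killed by `x`.
  have hnot : ¬ ((Ideal.span (Set.range x) : Set S) ⊆
      ⋃ p ∈ associatedPrimes S M, ((id p : Ideal S) : Set S)) := by
    intro hsub
    rw [Ideal.subset_union_prime_finite (associatedPrimes.finite S M) (f := id) ⊥ ⊥
      (fun p hp _ _ => IsAssociatedPrime.isPrime hp)] at hsub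
    obtain ⟨p, hp, hle⟩ := hsub
    obtain ⟨hprime, y, hy⟩ := isAssociatedPrime_iff.mp hp
    refine hprime.ne_top ?_
    have hy0 : y = 0 := h y fun l => by
      have : x l ∈ p := hle (Ideal.subset_span ⟨l, rfl⟩)
      rw [hy] at this
      simpa using this
    rw [hy, hy0, Ideal.eq_top_iff_one]
    simp
  obtain ⟨a, ha, hna⟩ := Set.not_subset.mp hnot
  refine ⟨a, ha, ?_⟩
  simp only [id] at hna
  rw [biUnion_associatedPrimes_eq_zero_divisors] at hna
  rw [isSMulRegular_iff_right_eq_zero_of_smul]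
  intro y hy
  by_contra hne
  exact hna ⟨y, hne, hy⟩

/-- Vanishing of the top Koszul homology provides a regular sequence in the ideal generated by
`x`. -/
lemma exists_isWeaklyRegular [IsNoetherianRing S] {x : ι → S} {r : ℕ} (hr : r ≤ Fintype.card ι)
    (M : Type*) [AddCommGroup M] [Module S M] [Module.Finite S M]
    (h : ∀ i, Fintype.card ι < i + r → ExactAt x M i) :
    ∃ rs : List S, rs.length = r ∧ (∀ a ∈ rs, a ∈ Ideal.span (Set.range x)) ∧
      IsWeaklyRegular M rs := by
  induction r generalizing M with
  | zero => exact ⟨[], by simp⟩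
  | succ r ih =>
    obtain ⟨a, ha, hreg⟩ := exists_isSMulRegular (x := x) M fun y hy => by
      -- In the top degree there is one subset, `univ`, and no boundaries; the cycles are the
      -- elements killed by all `x l`. Exactness there says that such a `y` is zero.
      obtain ⟨ψ, hψ⟩ := h (Fintype.card ι) (by omega) (fun T => y) fun T hT => by
        rw [diff_apply]
        exact sum_eq_zero fun l _ => by rw [hy, smul_zero]
      rw [← hψ univ (by simp), diff_apply, compl_univ, sum_empty]
    obtain ⟨rs, hlen, hmem, hrs⟩ := ih (by omega) (QuotSMulTop a M) fun i hi => by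
      obtain ⟨i, rfl⟩ : ∃ j, i = j + 1 := ⟨i - 1, by omega⟩
      exact ExactAt.quotSMulTop hreg (h i (by omega)) (h (i + 1) (by omega))
    exact ⟨a :: rs, by simp [hlen], by simpa [ha] using hmem, IsWeaklyRegular.cons hreg hrs⟩

end Koszul

/-! ### Simplicial cochains, deletions and links -/

namespace Koszul

open Finset

variable {V : Type*} [LinearOrder V] {A : Type*} [AddCommGroup A]

/-- The simplicial coboundary on all degrees at once: a cochain of degree `m - 1` assigns elements
of `A` to the subsets of `V` with `m` elements. -/
def cobd : (Finset V → A) →+ (Finset V → A) where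
  toFun ψ F := ∑ l ∈ F, sgn l F • ψ (F.erase l)
  map_zero' := by funext F; simp
  map_add' ψ χ := by funext F; simp [sum_add_distrib]

lemma cobd_apply (ψ : Finset V → A) (F : Finset V) :
    cobd ψ F = ∑ l ∈ F, sgn l F • ψ (F.erase l) := rfl

lemma cobd_congr {ψ χ : Finset V → A} {F : Finset V} (h : ∀ l ∈ F, ψ (F.erase l) = χ (F.erase l)) :
    cobd ψ F = cobd χ F :=
  sum_congr rfl fun l hl => by rw [h l hl]

lemma cobd_cobd (ψ : Finset V → A) : cobd (cobd ψ) = 0 := by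
  funext F
  simp only [cobd_apply, smul_sum, Pi.zero_apply]
  rw [sum_sigma']
  refine sum_involution (fun p _ => ⟨p.2, p.1⟩) ?_ ?_ ?_ ?_
  · rintro ⟨l, m⟩ h
    simp only [mem_sigma, mem_erase] at h
    obtain ⟨hl, hml, hm⟩ := h
    obtain ⟨T, hlT, hmT, rfl⟩ : ∃ T, l ∉ T ∧ m ∉ T ∧ insert l (insert m T) = F :=
      ⟨(F.erase l).erase m, by simp, by simp, by
        rw [insert_erase (mem_erase.mpr ⟨hml, hm⟩), insert_erase hl]⟩
    have h1 : (insert l (insert m T)).erase l = insert m T := erase_insert (by simp [hlT, hml.symm])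
    have h2 : (insert l (insert m T)).erase m = insert l T := by
      rw [Finset.insert_comm, erase_insert (by simp [hmT, hml])]
    simp only [h1, h2, erase_insert hmT, erase_insert hlT, sgn_insert_self, smul_smul]
    rw [Finset.insert_comm l m T, sgn_insert_self, mul_comm, sgn_swap hml hmT hlT, neg_smul,
      mul_comm, neg_add_cancel]
  · rintro ⟨l, m⟩ h _ heq
    simp only [mem_sigma, mem_erase] at h
    simp only [Sigma.mk.injEq, heq_eq_eq] at heq
    exact h.2.1 heq.1
  · rintro ⟨l, m⟩ h
    simp only [mem_sigma, mem_erase] at h ⊢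
    exact ⟨h.2.2, Ne.symm h.2.1, h.1⟩
  · rintro ⟨l, m⟩ _
    rfl

/-- Contraction of a cochain with the vertex `v`. -/
def contr (v : V) (ψ : Finset V → A) : Finset V → A := fun F => sgn v F • ψ (insert v F)

/-- The cochain on the faces containing `v` which is determined by a cochain on the link of `v`. -/
def lift (v : V) (η : Finset V → A) : Finset V → A := fun F =>
  if v ∈ F then sgn v F • η (F.erase v) else 0

lemma contr_lift {v : V} {F : Finset V} (hv : v ∉ F) (η : Finset V → A) :
    contr v (lift v η) F = η F := by
  rw [contr, lift, if_pos (mem_insert_self v F), erase_insert hv, sgn_insert_self,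
    sgn_smul_sgn_smul]

/-- This splits the coboundary along `v`: a cochain is its part on the deletion together with its
contraction on the link, and the coboundary is that of a mapping cone of the restriction from
deletion to link. -/
lemma sgn_smul_cobd_insert {v : V} {F : Finset V} (hv : v ∉ F) (ψ : Finset V → A) :
    sgn v F • cobd ψ (insert v F) = ψ F - cobd (contr v ψ) F := by
  rw [cobd_apply, sum_insert hv, erase_insert hv, smul_add, sgn_insert_self, sgn_smul_sgn_smul,
    sub_eq_add_neg, cobd_apply, smul_sum, ← sum_neg_distrib]
  congr 1
  refine sum_congr rfl fun l hl => ?_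
  obtain ⟨T, hlT, rfl⟩ : ∃ T, l ∉ T ∧ insert l T = F := ⟨F.erase l, by simp, insert_erase hl⟩
  simp only [mem_insert, not_or] at hv
  rw [contr, erase_insert hlT, Finset.insert_comm v l, erase_insert (by simp [hlT, Ne.symm hv.1]),
    sgn_insert_self, sgn_insert_self, smul_smul, smul_smul, mul_comm,
    sgn_insert_mul_sgn_insert (Ne.symm hv.1) hlT hv.2, neg_smul]

lemma cobd_lift_of_notMem {v : V} {F : Finset V} (hv : v ∉ F) (η : Finset V → A) :
    cobd (lift v η) F = 0 :=
  sum_eq_zero fun l _ => by rw [lift, if_neg (fun h => hv (mem_of_mem_erase h)), smul_zero]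

/-- The link of `G` in a family of sets. -/
def linkSet (X : Set (Finset V)) (G : Finset V) : Set (Finset V) := {F | Disjoint F G ∧ F ∪ G ∈ X}

/-- The members of a family of sets that avoid `D`. -/
def delSet (X : Set (Finset V)) (D : Finset V) : Set (Finset V) := {F | F ∈ X ∧ Disjoint F D}

variable (A) in
/-- The reduced cohomology of `X` with coefficients in `A` vanishes in degree `m - 1`. -/
def Acyclic (X : Set (Finset V)) (m : ℕ) : Prop :=
  ∀ ψ : Finset V → A, (∀ F ∈ X, F.card = m + 1 → cobd ψ F = 0) →
    ∃ χ : Finset V → A, ∀ F ∈ X, F.card = m → cobd χ F = ψ F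

variable (A) in
/-- Restriction from `X` to `Y` is injective on reduced cohomology in degree `m - 1`. -/
def ResInjective (X Y : Set (Finset V)) (m : ℕ) : Prop :=
  ∀ ψ : Finset V → A, (∀ F ∈ X, F.card = m + 1 → cobd ψ F = 0) →
    (∃ χ : Finset V → A, ∀ F ∈ Y, F.card = m → cobd χ F = ψ F) →
    ∃ χ : Finset V → A, ∀ F ∈ X, F.card = m → cobd χ F = ψ F

variable (A) in
/-- Every cocycle of degree `m - 1` on `Y` extends to a cocycle on `X`. -/
def ResSurjective (X Y : Set (Finset V)) (m : ℕ) : Prop :=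
  ∀ ψ : Finset V → A, (∀ F ∈ Y, F.card = m + 1 → cobd ψ F = 0) →
    ∃ ψ' : Finset V → A, (∀ F ∈ X, F.card = m + 1 → cobd ψ' F = 0) ∧
      ∀ F ∈ Y, F.card = m → ψ' F = ψ F

variable {X : Set (Finset V)}

lemma mem_linkSet_singleton {v : V} {F : Finset V} :
    F ∈ linkSet X {v} ↔ v ∉ F ∧ insert v F ∈ X := by
  rw [linkSet, Set.mem_ofPred_eq, disjoint_singleton_right, union_comm, singleton_union]

lemma mem_delSet_singleton {v : V} {F : Finset V} : F ∈ delSet X {v} ↔ F ∈ X ∧ v ∉ F := by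
  rw [delSet, Set.mem_ofPred_eq, disjoint_singleton_right]

/-- The obstruction to extending a cocycle `ψ` over the faces containing `v` is the class of its
restriction to the link of `v`. If that restriction is the coboundary of `η`, the values of `η` are
the missing values on the faces through `v`. -/
lemma resSurjective_delSet (hX : IsLowerSet X) {v : V} {m : ℕ}
    (h : Acyclic A (linkSet X {v}) m) : ResSurjective A X (delSet X {v}) m := by
  intro ψ hψ
  obtain ⟨η, hη⟩ := h ψ fun F hF hc => by
    rw [mem_linkSet_singleton] at hF
    exact hψ F (mem_delSet_singleton.mpr ⟨hX (subset_insert v F) hF.2, hF.1⟩) hc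
  let ψ₀ : Finset V → A := fun F => if v ∈ F then 0 else ψ F
  refine ⟨ψ₀ + lift v η, fun F hF hc => ?_, fun F hF _ => ?_⟩
  · by_cases hv : v ∈ F
    · obtain ⟨T, hvT, rfl⟩ : ∃ T, v ∉ T ∧ insert v T = F := ⟨F.erase v, by simp, insert_erase hv⟩
      have key := sgn_smul_cobd_insert hvT (ψ₀ + lift v η)
      have h1 : cobd (contr v (ψ₀ + lift v η)) T = cobd η T := by
        refine cobd_congr fun l _ => ?_
        have hvl : v ∉ T.erase l := fun h => hvT (mem_of_mem_erase h)
        rw [← contr_lift hvl η]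
        simp [contr, ψ₀]
      have h2 : (ψ₀ + lift v η) T = ψ T := by simp [ψ₀, lift, hvT]
      rw [card_insert_of_notMem hvT] at hc
      rw [h1, h2, hη T (mem_linkSet_singleton.mpr ⟨hvT, hF⟩) (by omega), sub_self] at key
      rw [← sgn_smul_sgn_smul v T (cobd _ _), key, smul_zero]
    · rw [map_add, Pi.add_apply, cobd_lift_of_notMem hv, add_zero,
        ← hψ F (mem_delSet_singleton.mpr ⟨hF, hv⟩) hc]
      exact cobd_congr fun l _ => if_neg fun h => hv (mem_of_mem_erase h)
  · have hv := (mem_delSet_singleton.mp hF).2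
    simp [ψ₀, lift, hv]

/-- If `ψ` equals `cobd χ` on the deletion, the difference is supported on faces through `v`, and
its contraction is a cocycle on the link, one degree lower. A primitive `η` of it corrects `χ`. -/
lemma resInjective_delSet (hX : IsLowerSet X) {v : V} {m : ℕ}
    (h : ∀ j, j + 1 = m → Acyclic A (linkSet X {v}) j) : ResInjective A X (delSet X {v}) m := by
  rintro ψ hψ ⟨χ, hχ⟩
  obtain rfl | ⟨j, rfl⟩ : m = 0 ∨ ∃ j, m = j + 1 := by cases m <;> simp
  -- In degree `-1` only the empty face matters, and it avoids `v`; no link is needed.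
  · refine ⟨χ, fun F hF hc => hχ F (mem_delSet_singleton.mpr ⟨hF, ?_⟩) hc⟩
    rw [card_eq_zero.mp hc]; exact notMem_empty v
  obtain ⟨η, hη⟩ := h j rfl (contr v (ψ - cobd χ)) fun F hF hc => by
    obtain ⟨hv, hF⟩ := mem_linkSet_singleton.mp hF
    have key := sgn_smul_cobd_insert hv (ψ - cobd χ)
    rw [map_sub, cobd_cobd, sub_zero, hψ _ hF (by rw [card_insert_of_notMem hv, hc]), smul_zero,
      Pi.sub_apply, hχ F (mem_delSet_singleton.mpr ⟨hX (subset_insert v F) hF, hv⟩) hc, sub_self,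
      zero_sub, eq_comm, neg_eq_zero] at key
    exact key
  refine ⟨χ - lift v η, fun F hF hc => ?_⟩
  by_cases hv : v ∈ F
  · obtain ⟨T, hvT, rfl⟩ : ∃ T, v ∉ T ∧ insert v T = F := ⟨F.erase v, by simp, insert_erase hv⟩
    rw [card_insert_of_notMem hvT, Nat.add_right_cancel_iff] at hc
    have key := sgn_smul_cobd_insert hvT (lift v η)
    have h1 : cobd (contr v (lift v η)) T = cobd η T :=
      cobd_congr fun l _ => contr_lift (fun h => hvT (mem_of_mem_erase h)) η
    rw [h1, hη T (mem_linkSet_singleton.mpr ⟨hvT, hF⟩) hc, lift, if_neg hvT, zero_sub, contr,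
      ← smul_neg] at key
    have := congrArg (sgn v T • ·) key
    simp only [sgn_smul_sgn_smul] at this
    change cobd (lift v η) (insert v T) = _ at this
    rw [map_sub, Pi.sub_apply, this, Pi.sub_apply]
    abel
  · rw [map_sub, Pi.sub_apply, cobd_lift_of_notMem hv, sub_zero,
      hχ F (mem_delSet_singleton.mpr ⟨hF, hv⟩) hc]

lemma Acyclic.of_resSurjective {Y : Set (Finset V)} {m : ℕ} (h : Acyclic A X m) (hYX : Y ⊆ X)
    (hr : ResSurjective A X Y m) : Acyclic A Y m := by
  intro ψ hψ
  obtain ⟨ψ', h1, h2⟩ := hr ψ hψ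
  obtain ⟨χ, hχ⟩ := h ψ' h1
  exact ⟨χ, fun F hF hc => (hχ F (hYX hF) hc).trans (h2 F hF hc)⟩

lemma isLowerSet_delSet (hX : IsLowerSet X) (D : Finset V) : IsLowerSet (delSet X D) :=
  fun _ _ hle h => ⟨hX hle h.1, h.2.mono_left hle⟩

lemma isLowerSet_linkSet (hX : IsLowerSet X) (G : Finset V) : IsLowerSet (linkSet X G) :=
  fun _ _ hle h => ⟨h.1.mono_left hle, hX (union_subset_union_left hle) h.2⟩

lemma linkSet_linkSet (G H : Finset V) (hGH : Disjoint H G) :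
    linkSet (linkSet X G) H = linkSet X (H ∪ G) := by
  ext F
  simp only [linkSet, Set.mem_ofPred_eq, disjoint_union_left, disjoint_union_right, union_assoc]
  tauto

lemma linkSet_delSet {G D : Finset V} (hGD : Disjoint G D) :
    linkSet (delSet X D) G = delSet (linkSet X G) D := by
  ext F
  simp only [linkSet, delSet, Set.mem_ofPred_eq, disjoint_union_left]
  tauto

lemma linkSet_delSet_of_not_disjoint {G D : Finset V} (hGD : ¬ Disjoint G D) :
    linkSet (delSet X D) G = ∅ := by
  ext F
  simp only [linkSet, delSet, Set.mem_ofPred_eq, disjoint_union_left, Set.mem_empty_iff_false]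
  tauto

lemma delSet_insert (v : V) (D : Finset V) : delSet X (insert v D) = delSet (delSet X D) {v} := by
  ext F
  simp only [delSet, Set.mem_ofPred_eq, disjoint_insert_right, disjoint_singleton_right]
  tauto

lemma acyclic_empty (m : ℕ) : Acyclic A (∅ : Set (Finset V)) m := fun _ _ => ⟨0, by simp⟩

variable (A) in
/-- The links of the non-empty faces are acyclic as far as this is possible for a complex all of
whose facets have `c` elements. -/
def LinksAcyclic (X : Set (Finset V)) (c : ℕ) : Prop :=
  ∀ (G : Finset V) (m : ℕ), G.Nonempty → m + G.card < c → Acyclic A (linkSet X G) m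

/-- The link of `G` in the deletion is the deletion of `v` from the link of `G`, and the obstruction
to restricting acyclicity lies in the link of `G ∪ {v}`. That link is acyclic in a range shorter by
one, which is the loss from `c` to `c - 1`. -/
lemma LinksAcyclic.delSet_singleton (hX : IsLowerSet X) {c : ℕ} (h : LinksAcyclic A X c) (v : V) :
    LinksAcyclic A (delSet X {v}) (c - 1) := by
  intro G m hG hm
  by_cases hv : v ∈ G
  · rw [linkSet_delSet_of_not_disjoint (by simpa using hv)]
    exact acyclic_empty m
  · rw [linkSet_delSet (by simpa using hv)]
    refine (h G m hG (by omega)).of_resSurjective (fun F hF => hF.1)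
      (resSurjective_delSet (isLowerSet_linkSet hX G) ?_)
    rw [linkSet_linkSet G {v} (by simpa using hv)]
    exact h _ m (by simp) (by rw [singleton_union, card_insert_of_notMem hv]; omega)

lemma LinksAcyclic.delSet (hX : IsLowerSet X) {c : ℕ} (h : LinksAcyclic A X c) (D : Finset V) :
    LinksAcyclic A (delSet X D) (c - D.card) := by
  induction D using Finset.induction_on with
  | empty => simpa [Koszul.delSet] using h
  | insert v D hv ih =>
    rw [delSet_insert, card_insert_of_notMem hv, ← Nat.sub_sub]
    exact ih.delSet_singleton (isLowerSet_delSet hX D) v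

/-- The vertices of `D` are deleted one at a time; the bound on `m + D.card` keeps the link met at
each deletion within its acyclic range. -/
lemma LinksAcyclic.resSurjective (hX : IsLowerSet X) {c : ℕ} (h : LinksAcyclic A X c)
    (D : Finset V) {m : ℕ} (hm : m + D.card < c) : ResSurjective A X (Koszul.delSet X D) m := by
  induction D using Finset.induction_on with
  | empty =>
    refine fun ψ hψ => ⟨ψ, fun F hF hc => hψ F ⟨hF, by simp⟩ hc, fun F hF hc => rfl⟩
  | insert v D hv ih =>
    rw [card_insert_of_notMem hv] at hm
    rw [delSet_insert]
    intro ψ hψ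
    obtain ⟨ψ', h1, h2⟩ := resSurjective_delSet (isLowerSet_delSet hX D)
      (h.delSet hX D {v} m (by simp) (by rw [card_singleton]; omega)) ψ hψ
    obtain ⟨ψ'', h3, h4⟩ := ih (by omega) ψ' h1
    exact ⟨ψ'', h3, fun F hF hc => (h4 F hF.1 hc).trans (h2 F hF hc)⟩

lemma LinksAcyclic.resInjective (hX : IsLowerSet X) {c : ℕ} (h : LinksAcyclic A X c)
    (D : Finset V) {m : ℕ} (hm : m + D.card < c) : ResInjective A X (Koszul.delSet X D) m := by
  induction D using Finset.induction_on with
  | empty =>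
    rintro ψ - ⟨χ, hχ⟩
    exact ⟨χ, fun F hF hc => hχ F ⟨hF, by simp⟩ hc⟩
  | insert v D hv ih =>
    rw [card_insert_of_notMem hv] at hm
    rw [delSet_insert]
    intro ψ hψ hr
    exact ih (by omega) ψ hψ (resInjective_delSet (isLowerSet_delSet hX D)
      (fun j hj => h.delSet hX D {v} j (by simp) (by rw [card_singleton]; omega)) ψ
      (fun F hF hc => hψ F hF.1 hc) hr)

end Koszul

/-! ### Moving Koszul cycles and boundaries by homotopies -/

namespace Koszul

open Finset

section Reduction

variable {ι : Type*} [LinearOrder ι] [Fintype ι] {S : Type*} [CommRing S] {M : Type*}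
  [AddCommGroup M] [Module S M] {x : ι → S} {q : ι → M →+ M}
  {N : Finset ι → Finset ι → AddSubgroup M}

/-- The chain homotopies defined by the maps `q l`, one after the other, move every cycle into the
subgroups `N univ T`. -/
lemma exists_eq_add_diff (hq : ∀ l m, m ≠ l → ∀ y, q l (x m • y) = x m • q l y)
    (hN : ∀ T y, y ∈ N ∅ T)
    (h₁ : ∀ L T l, l ∉ T → ∀ y ∈ N L T, y - x l • q l y ∈ N (insert l L) T)
    (h₂ : ∀ L T l, l ∈ T → ∀ y ∈ N L T, y - q l (x l • y) ∈ N (insert l L) T) {i : ℕ}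
    {φ : Finset ι → M} (hφ : ∀ T : Finset ι, T.card + 1 = i → diff x φ T = 0) (L : Finset ι) :
    ∃ φ' ψ : Finset ι → M, (∀ T, φ' T ∈ N L T) ∧
      ∀ T : Finset ι, T.card = i → φ T = φ' T + diff x ψ T := by
  induction L using Finset.induction_on with
  | empty => exact ⟨φ, 0, fun T => hN T _, by simp⟩
  | insert l L _ ih =>
    obtain ⟨φ', ψ, hmem, heq⟩ := ih
    refine ⟨fun T => φ' T - if l ∈ T then q l (x l • φ' T) else x l • q l (φ' T),
      ψ + wedge l (q l) φ', fun T => ?_, fun T hT => ?_⟩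
    · dsimp only
      split_ifs with h
      · exact h₂ L T l h _ (hmem T)
      · exact h₁ L T l h _ (hmem T)
    -- The modified chain `φ'` differs from `φ` by a boundary, so it is still a cycle and the `hd`
    -- half of the homotopy formula vanishes.
    · have hcyc : wedge l (q l) (diff x φ') T = 0 := by
        unfold wedge
        split_ifs with h
        · have hc : (T.erase l).card + 1 = i := by rw [card_erase_add_one h, hT]
          have : diff x φ' (T.erase l) = 0 := by
            rw [← hφ _ hc, ← sub_zero (diff x φ' _),
              ← Pi.zero_apply (M := fun _ => M) (T.erase l)]
            rw [show (0 : Finset ι → M) (T.erase l) = -diff x (diff x ψ) (T.erase l) by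
              rw [diff_diff]; simp, sub_neg_eq_add, ← Pi.add_apply, ← map_add]
            exact diff_congr x fun W hW => (heq W (by omega)).symm
          rw [this]; simp
        · rfl
      rw [heq T hT, map_add, Pi.add_apply]
      by_cases h : l ∈ T
      · have := diff_wedge_of_mem (hq l) φ' h
        rw [hcyc, add_zero] at this
        dsimp only
        rw [if_pos h, this]; abel
      · have := diff_wedge_of_notMem (x := x) (q := q l) φ' h
        rw [hcyc, add_zero] at this
        dsimp only
        rw [if_neg h, this]; abel

/-- A boundary which is not affected by the homotopies bounds a chain with values in the subgroups
`N univ T`. -/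
lemma exists_diff_eq (hq : ∀ l m, m ≠ l → ∀ y, q l (x m • y) = x m • q l y)
    (hN : ∀ T y, y ∈ N ∅ T)
    (h₁ : ∀ L T l, l ∉ T → ∀ y ∈ N L T, y - x l • q l y ∈ N (insert l L) T)
    (h₂ : ∀ L T l, l ∈ T → ∀ y ∈ N L T, y - q l (x l • y) ∈ N (insert l L) T) {i : ℕ}
    {φ w : Finset ι → M} (hw : ∀ T : Finset ι, T.card = i → diff x w T = φ T)
    (hφ₁ : ∀ T l, l ∉ T → x l • q l (φ T) = 0) (hφ₂ : ∀ T l, l ∈ T → q l (x l • φ T) = 0)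
    (L : Finset ι) :
    ∃ w' : Finset ι → M, (∀ T, w' T ∈ N L T) ∧ ∀ T : Finset ι, T.card = i → diff x w' T = φ T := by
  induction L using Finset.induction_on with
  | empty => exact ⟨w, fun T => hN T _, hw⟩
  | insert l L _ ih =>
    obtain ⟨w', hmem, heq⟩ := ih
    have hform : ∀ T, (w' - (diff x (wedge l (q l) w') + wedge l (q l) (diff x w'))) T =
        w' T - if l ∈ T then q l (x l • w' T) else x l • q l (w' T) := by
      intro T
      rw [Pi.sub_apply, Pi.add_apply]
      split_ifs with h
      · rw [diff_wedge_of_mem (hq l) w' h]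
      · rw [diff_wedge_of_notMem w' h]
    refine ⟨w' - (diff x (wedge l (q l) w') + wedge l (q l) (diff x w')), fun T => ?_,
      fun T hT => ?_⟩
    · rw [hform]
      split_ifs with h
      · exact h₂ L T l h _ (hmem T)
      · exact h₁ L T l h _ (hmem T)
    -- The homotopy annihilates the given boundary by `hφ₁` and `hφ₂`, and `h d d w'` is zero, so
    -- replacing `w'` by `w' - (dh + hd) w'` leaves its boundary unchanged.
    · have hzero : diff x (wedge l (q l) (diff x w')) T = 0 := by
        have hd : wedge l (q l) (diff x (diff x w')) T = 0 := by
          rw [diff_diff]; simp [wedge]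
        by_cases h : l ∈ T
        · have := diff_wedge_of_mem (hq l) (diff x w') h
          rwa [hd, add_zero, heq T hT, hφ₂ T l h] at this
        · have := diff_wedge_of_notMem (x := x) (q := q l) (diff x w') h
          rwa [hd, add_zero, heq T hT, hφ₁ T l h] at this
      rw [map_sub, map_add, diff_diff, zero_add, Pi.sub_apply, hzero, sub_zero, heq T hT]

end Reduction

/-! ### Division of monomials by a variable -/

section Monomials

variable {k : Type u} [Field k] {n : ℕ}

open MvPolynomial

/-- Division by `X l` of the monomials in which the exponent of `X l` is at least `r`; the other
monomials are sent to zero. -/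
noncomputable def divVar (r : ℕ) (l : Fin n) :
    MvPolynomial (Fin n) k →ₗ[k] MvPolynomial (Fin n) k :=
  (basisMonomials (Fin n) k).constr k fun a =>
    if r ≤ a l then monomial (a - Finsupp.single l 1) 1 else 0

lemma divVar_monomial (r : ℕ) (l : Fin n) (a : Fin n →₀ ℕ) :
    divVar r l (monomial a (1 : k)) =
      if r ≤ a l then monomial (a - Finsupp.single l 1) 1 else 0 := by
  have := (basisMonomials (Fin n) k).constr_basis k (fun a =>
    if r ≤ a l then monomial (a - Finsupp.single l 1) (1 : k) else 0) a
  rwa [coe_basisMonomials] at this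

/-- Two additive maps commuting with scalars agree if they agree on monomials. -/
lemma linearMap_ext_monomial {W : Type*} [AddCommGroup W] [Module k W]
    {f g : MvPolynomial (Fin n) k →ₗ[k] W} (h : ∀ a, f (monomial a 1) = g (monomial a 1)) :
    f = g :=
  (basisMonomials (Fin n) k).ext fun a => by simpa using h a

lemma divVar_X_mul {r : ℕ} (hr : 1 ≤ r) {l m : Fin n} (hml : m ≠ l) (p : MvPolynomial (Fin n) k) :
    divVar r l (X m * p) = X m * divVar r l p := by
  suffices h : divVar r l ∘ₗ LinearMap.mulLeft k (X m) =
      LinearMap.mulLeft k (X m : MvPolynomial (Fin n) k) ∘ₗ divVar r l from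
    LinearMap.congr_fun h p
  refine linearMap_ext_monomial fun a => ?_
  simp only [LinearMap.comp_apply, LinearMap.mulLeft_apply]
  rw [X, monomial_mul, one_mul, divVar_monomial, divVar_monomial]
  have : (Finsupp.single m 1 + a : Fin n →₀ ℕ) l = a l := by simp [hml]
  rw [this]
  split_ifs with h
  · rw [monomial_mul, one_mul, add_tsub_assoc_of_le]
    rw [Finsupp.single_le_iff]
    exact hr.trans h
  · rw [mul_zero]

lemma X_mul_divVar_monomial {r : ℕ} (hr : 1 ≤ r) (l : Fin n) (a : Fin n →₀ ℕ) :
    X l * divVar r l (monomial a (1 : k)) = if r ≤ a l then monomial a 1 else 0 := by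
  rw [divVar_monomial]
  split_ifs with h
  · rw [X, monomial_mul, one_mul, add_tsub_cancel_of_le]
    rw [Finsupp.single_le_iff]
    exact hr.trans h
  · rw [mul_zero]

lemma divVar_X_mul_monomial (r : ℕ) (l : Fin n) (a : Fin n →₀ ℕ) :
    divVar r l (X l * monomial a (1 : k)) = if r ≤ a l + 1 then monomial a 1 else 0 := by
  rw [X, monomial_mul, one_mul, divVar_monomial, add_tsub_cancel_left]
  simp [add_comm]

/-- The exponent of the squarefree monomial with support `F`. -/
noncomputable def expo (F : Finset (Fin n)) : Fin n →₀ ℕ := Finsupp.indicator F fun _ _ => 1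

lemma expo_apply (F : Finset (Fin n)) (v : Fin n) : expo F v = if v ∈ F then 1 else 0 := by
  simp [expo, Finsupp.indicator_apply]

lemma support_expo (F : Finset (Fin n)) : (expo F).support = F := by
  ext v; simp [expo_apply]

lemma expo_insert {F : Finset (Fin n)} {l : Fin n} (hl : l ∉ F) :
    expo (insert l F) = Finsupp.single l 1 + expo F := by
  ext v
  rw [Finsupp.add_apply, expo_apply, expo_apply, Finsupp.single_apply]
  by_cases h : v = l
  · simp [h, hl]
  · simp [h, Ne.symm h]

lemma prod_X_eq_monomial (F : Finset (Fin n)) :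
    ∏ v ∈ F, X v = monomial (expo F) (1 : k) := by
  have := prod_X_pow (R := k) (fun _ : Fin n => 1) F
  simpa [expo] using this

lemma expo_le_iff (F : Finset (Fin n)) (a : Fin n →₀ ℕ) : expo F ≤ a ↔ F ⊆ a.support := by
  rw [Finsupp.le_def]
  refine ⟨fun h v hv => ?_, fun h v => ?_⟩
  · have := h v
    rw [expo_apply, if_pos hv] at this
    rw [Finsupp.mem_support_iff]; omega
  · rw [expo_apply]
    split_ifs with hv
    · have := h hv
      rw [Finsupp.mem_support_iff] at this; omega
    · exact Nat.zero_le _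

end Monomials

end Koszul

namespace FaceComplex

open MvPolynomial Koszul

variable {n : ℕ} (K : FaceComplex (Fin n)) (k : Type u) [Field k]

lemma mem_faceIdeal_iff (p : MvPolynomial (Fin n) k) :
    p ∈ K.faceIdeal k ↔ ∀ a ∈ p.support, a.support ∉ K.faces := by
  have h : K.faceIdeal k = Ideal.span ((fun a => monomial a (1 : k)) ''
      (expo '' {s : Finset (Fin n) | s ∉ K.faces})) := by
    rw [faceIdeal, Set.image_image]
    congr 1
    ext p
    simp [prod_X_eq_monomial, eq_comm]
  rw [h, mem_ideal_span_monomial_image]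
  refine forall₂_congr fun a _ => ⟨?_, fun h => ⟨_, ⟨_, h, rfl⟩, (expo_le_iff _ _).mpr subset_rfl⟩⟩
  rintro ⟨_, ⟨s, hs, rfl⟩, hle⟩ ha
  exact hs (K.down_closed ha ((expo_le_iff _ _).mp hle))

end FaceComplex

/-! ### The squarefree part of the Koszul complex of the face ring -/

namespace FaceComplex

open MvPolynomial Koszul Finset

variable {n : ℕ} (K : FaceComplex (Fin n)) (k : Type u) [Field k]

/-- The class of a monomial in the face ring. -/
noncomputable def mono (a : Fin n →₀ ℕ) : K.FaceRing k := Ideal.Quotient.mk _ (monomial a 1)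

lemma mono_eq_zero {a : Fin n →₀ ℕ} (ha : a.support ∉ K.faces) : K.mono k a = 0 := by
  rw [mono, Ideal.Quotient.eq_zero_iff_mem, mem_faceIdeal_iff]
  intro b hb
  rw [mem_support_iff, coeff_monomial, ne_eq, ite_eq_right_iff, not_forall] at hb
  rwa [← hb.choose]

/-- The threshold two leaves at least one factor `X l` after the division, so supports do not
change. This is why the division descends to the face ring. -/
lemma coeff_divVar_two {l : Fin n} {p : MvPolynomial (Fin n) k} {b : Fin n →₀ ℕ}
    (hb : coeff b (divVar 2 l p) ≠ 0) : ∃ a ∈ p.support, a.support = b.support := by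
  rw [p.as_sum, map_sum, coeff_sum] at hb
  obtain ⟨a, ha, hne⟩ := exists_ne_zero_of_sum_ne_zero hb
  refine ⟨a, ha, ?_⟩
  have hmon : monomial a (coeff a p) = coeff a p • monomial a (1 : k) := by
    rw [smul_monomial, smul_eq_mul, mul_one]
  rw [hmon, map_smul, divVar_monomial, coeff_smul] at hne
  split_ifs at hne with h
  · rw [coeff_monomial] at hne
    split_ifs at hne with hab
    · subst hab
      ext v
      simp only [Finsupp.mem_support_iff, Finsupp.tsub_apply, Finsupp.single_apply]
      split_ifs with hv
      · subst hv; omega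
      · simp
    · simp at hne
  · simp at hne

lemma divVar_two_mem (l : Fin n) {p : MvPolynomial (Fin n) k} (hp : p ∈ K.faceIdeal k) :
    divVar 2 l p ∈ K.faceIdeal k := by
  rw [mem_faceIdeal_iff] at hp ⊢
  intro b hb
  obtain ⟨a, ha, hab⟩ := coeff_divVar_two k (mem_support_iff.mp hb)
  exact hab ▸ hp a ha

/-- Division by a variable, on the monomials divisible by its square. -/
noncomputable def divFace (l : Fin n) : K.FaceRing k →ₗ[k] K.FaceRing k :=
  (Submodule.Quotient.restrictScalarsEquiv k (K.faceIdeal k)).toLinearMap ∘ₗ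
    Submodule.mapQ ((K.faceIdeal k).restrictScalars k) ((K.faceIdeal k).restrictScalars k)
      (divVar 2 l) (fun _ hp => K.divVar_two_mem k l hp) ∘ₗ
    (Submodule.Quotient.restrictScalarsEquiv k (K.faceIdeal k)).symm.toLinearMap

lemma divFace_mk (l : Fin n) (p : MvPolynomial (Fin n) k) :
    K.divFace k l (Ideal.Quotient.mk _ p) = Ideal.Quotient.mk _ (divVar 2 l p) := rfl

lemma divFace_smul {l m : Fin n} (hml : m ≠ l) (y : K.FaceRing k) :
    K.divFace k l ((X m : MvPolynomial (Fin n) k) • y) =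
      (X m : MvPolynomial (Fin n) k) • K.divFace k l y := by
  obtain ⟨p, rfl⟩ := Ideal.Quotient.mk_surjective y
  change K.divFace k l (Ideal.Quotient.mk _ (X m * p)) = Ideal.Quotient.mk _ (X m * divVar 2 l p)
  rw [divFace_mk, divVar_X_mul one_le_two hml]

lemma X_smul_divFace_mono (l : Fin n) (a : Fin n →₀ ℕ) :
    (X l : MvPolynomial (Fin n) k) • K.divFace k l (K.mono k a) =
      if 2 ≤ a l then K.mono k a else 0 := by
  change Ideal.Quotient.mk _ (X l * divVar 2 l (monomial a 1)) = _
  rw [X_mul_divVar_monomial one_le_two]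
  split_ifs
  · rfl
  · exact map_zero _

lemma divFace_X_smul_mono (l : Fin n) (a : Fin n →₀ ℕ) :
    K.divFace k l ((X l : MvPolynomial (Fin n) k) • K.mono k a) =
      if 2 ≤ a l + 1 then K.mono k a else 0 := by
  have : (X l : MvPolynomial (Fin n) k) • K.mono k a =
    Ideal.Quotient.mk _ (X l * monomial a 1) := rfl
  rw [this, divFace_mk, divVar_X_mul_monomial]
  split_ifs
  · rfl
  · exact map_zero _

/-- The span of the monomials whose exponent `a` satisfies `a l ≤ 1` for `l ∈ L`, and `a l = 0` if
moreover `l ∈ T`. -/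
noncomputable def boundedSpan (L T : Finset (Fin n)) : Submodule k (K.FaceRing k) :=
  Submodule.span k (K.mono k '' {a | ∀ l ∈ L, a l + (if l ∈ T then 1 else 0) ≤ 1})

lemma mem_boundedSpan_empty (T : Finset (Fin n)) (y : K.FaceRing k) :
    y ∈ K.boundedSpan k ∅ T := by
  obtain ⟨p, rfl⟩ := Ideal.Quotient.mk_surjective y
  induction p using MvPolynomial.induction_on' with
  | monomial a c =>
    have : Ideal.Quotient.mk (K.faceIdeal k) (monomial a c) = c • K.mono k a := by
      change _ = Ideal.Quotient.mk (K.faceIdeal k) (c • monomial a 1)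
      rw [smul_monomial, smul_eq_mul, mul_one]
    rw [this]
    exact Submodule.smul_mem _ _ (Submodule.subset_span ⟨a, by simp, rfl⟩)
  | add p q hp hq => rw [map_add]; exact add_mem hp hq

lemma map_boundedSpan_le {L L' T : Finset (Fin n)} (f : K.FaceRing k →ₗ[k] K.FaceRing k)
    (hf : ∀ a : Fin n →₀ ℕ, (∀ l ∈ L, a l + (if l ∈ T then 1 else 0) ≤ 1) →
      f (K.mono k a) ∈ K.boundedSpan k L' T) {y : K.FaceRing k} (hy : y ∈ K.boundedSpan k L T) :
    f y ∈ K.boundedSpan k L' T := by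
  have : K.boundedSpan k L T ≤ (K.boundedSpan k L' T).comap f := by
    rw [boundedSpan, Submodule.span_le]
    rintro _ ⟨a, ha, rfl⟩
    exact hf a ha
  exact this hy

/-- Multiplication by a variable as a linear map over the ground field. -/
noncomputable def mulVar (l : Fin n) : K.FaceRing k →ₗ[k] K.FaceRing k :=
  (Module.toModuleEnd k (K.FaceRing k) (X l : MvPolynomial (Fin n) k))

lemma mulVar_apply (l : Fin n) (y : K.FaceRing k) :
    K.mulVar k l y = (X l : MvPolynomial (Fin n) k) • y := rfl

/-- The monomials with exponent at least two in `X l` are cancelled. For `l ∉ T` those that remain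
have multidegree at most one in direction `l`. -/
lemma sub_smul_divFace_mem {L T : Finset (Fin n)} {l : Fin n} (hl : l ∉ T) {y : K.FaceRing k}
    (hy : y ∈ K.boundedSpan k L T) :
    y - (X l : MvPolynomial (Fin n) k) • K.divFace k l y ∈ K.boundedSpan k (insert l L) T := by
  refine K.map_boundedSpan_le k (LinearMap.id - K.mulVar k l ∘ₗ K.divFace k l) (fun a ha => ?_) hy
  simp only [LinearMap.sub_apply, LinearMap.id_apply, LinearMap.comp_apply, mulVar_apply]
  rw [X_smul_divFace_mono]
  split_ifs with h
  · rw [sub_self]; exact zero_mem _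
  · rw [sub_zero]
    refine Submodule.subset_span ⟨a, fun m hm => ?_, rfl⟩
    rcases mem_insert.mp hm with rfl | hm
    · rw [if_neg hl]; omega
    · exact ha m hm

/-- Since `l ∈ T` already contributes one to the multidegree, every monomial divisible by `X l` must
go. Multiplying by `X l` before dividing lowers the threshold on the exponent from two to one. -/
lemma sub_divFace_smul_mem {L T : Finset (Fin n)} {l : Fin n} (hl : l ∈ T) {y : K.FaceRing k}
    (hy : y ∈ K.boundedSpan k L T) :
    y - K.divFace k l ((X l : MvPolynomial (Fin n) k) • y) ∈ K.boundedSpan k (insert l L) T := by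
  refine K.map_boundedSpan_le k (LinearMap.id - K.divFace k l ∘ₗ K.mulVar k l) (fun a ha => ?_) hy
  simp only [LinearMap.sub_apply, LinearMap.id_apply, LinearMap.comp_apply, mulVar_apply]
  rw [divFace_X_smul_mono]
  split_ifs with h
  · rw [sub_self]; exact zero_mem _
  · rw [sub_zero]
    refine Submodule.subset_span ⟨a, fun m hm => ?_, rfl⟩
    rcases mem_insert.mp hm with rfl | hm
    · rw [if_pos hl]; omega
    · exact ha m hm

/-- The sign relating the Koszul differential and the coboundary in multidegree `U`. -/
def eps (F U : Finset (Fin n)) : ℤ := ∏ f ∈ F, sgn f U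

lemma eps_mul_self (F U : Finset (Fin n)) : eps F U * eps F U = 1 := by
  rw [eps, ← prod_mul_distrib]
  exact prod_eq_one fun f _ => sgn_mul_self f U

lemma sgn_union {l : Fin n} {G T : Finset (Fin n)} (h : Disjoint G T) :
    sgn l (G ∪ T) = sgn l G * sgn l T := by
  rw [sgn, sgn, sgn, ← pow_add, filter_union, card_union_of_disjoint]
  exact disjoint_filter_filter h

/-- The squarefree part of the Koszul complex of the face ring: a family of cochains, indexed by
the squarefree multidegrees `U`, gives a Koszul chain. -/
noncomputable def theta (ψ : Finset (Fin n) → Finset (Fin n) → k) (W : Finset (Fin n)) :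
    K.FaceRing k :=
  ∑ F ∈ Wᶜ.powerset, (eps F (F ∪ W) • ψ (F ∪ W) F) • K.mono k (expo F)

lemma theta_congr {ψ χ : Finset (Fin n) → Finset (Fin n) → k} {W : Finset (Fin n)}
    (h : ∀ F ∈ K.faces, Disjoint F W → ψ (F ∪ W) F = χ (F ∪ W) F) :
    K.theta k ψ W = K.theta k χ W := by
  refine sum_congr rfl fun F hF => ?_
  by_cases hK : F ∈ K.faces
  · rw [h F hK (by rwa [mem_powerset, subset_compl_iff_disjoint_right] at hF)]
  · rw [mono_eq_zero _ _ (by rwa [support_expo]), smul_zero, smul_zero]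

/-- Multiplying `x^F e_W` by `X l` while removing `l` from `W` keeps `U = F ∪ W` fixed and enlarges
`F` by `l`; read on coefficients this is the coboundary on subsets of `U`. The factor `eps` turns
the Koszul signs into the simplicial ones. -/
lemma diff_theta (ψ : Finset (Fin n) → Finset (Fin n) → k) (T : Finset (Fin n)) :
    diff (X : Fin n → MvPolynomial (Fin n) k) (K.theta k ψ) T =
      K.theta k (fun U => cobd (ψ U)) T := by
  simp only [diff_apply, theta, cobd_apply, smul_sum, sum_smul]
  rw [sum_sigma', sum_sigma']
  refine sum_bij' (fun p _ => ⟨insert p.1 p.2, p.1⟩) (fun p _ => ⟨p.2, p.1.erase p.2⟩) ?_ ?_ ?_ ?_ ?_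
  · rintro ⟨l, F⟩ h
    simp only [mem_sigma, mem_compl, mem_powerset] at h ⊢
    refine ⟨insert_subset_iff.mpr ⟨mem_compl.mpr h.1, h.2.trans ?_⟩, mem_insert_self _ _⟩
    exact compl_subset_compl.mpr (subset_insert _ _)
  · rintro ⟨G, l⟩ h
    simp only [mem_sigma, mem_powerset] at h ⊢
    refine ⟨h.1 h.2, fun v hv => ?_⟩
    have := mem_compl.mp (h.1 (mem_of_mem_erase hv))
    simp [this, ne_of_mem_erase hv]
  · rintro ⟨l, F⟩ h
    simp only [mem_sigma, mem_powerset] at h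
    have : l ∉ F := fun hl => by simpa using h.2 hl
    simp [erase_insert this]
  · rintro ⟨G, l⟩ h
    simp only [mem_sigma, mem_powerset] at h
    simp [insert_erase h.2]
  · rintro ⟨l, F⟩ h
    simp only [mem_sigma, mem_powerset, mem_compl] at h
    have hl : l ∉ F := fun hl => by simpa using h.2 hl
    have hFT : Disjoint F T := by
      rw [← subset_compl_iff_disjoint_right]
      exact h.2.trans (compl_subset_compl.mpr (subset_insert _ _))
    have hGT : Disjoint (insert l F) T := disjoint_insert_left.mpr ⟨h.1, hFT⟩
    have hU : F ∪ insert l T = insert l F ∪ T := by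
      rw [union_insert, insert_union]
    have hX : (X l : MvPolynomial (Fin n) k) • K.mono k (expo F) = K.mono k (expo (insert l F)) := by
      change Ideal.Quotient.mk _ (X l * monomial (expo F) 1) = _
      rw [X, monomial_mul, one_mul, expo_insert hl]
      rfl
    -- The extra factor of `eps` is `sgn l` of the whole multidegree, which splits into its values
    -- on `insert l F` and on `T`; the former cancels the sign of the coboundary.
    have hs : sgn l T * eps F (insert l F ∪ T) =
        eps (insert l F) (insert l F ∪ T) * sgn l (insert l F) := by
      rw [eps, eps, prod_insert hl, sgn_union (l := l) hGT]
      linear_combination (-(sgn l T * ∏ x ∈ F, sgn x (insert l F ∪ T))) *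
        sgn_mul_self l (insert l F)
    dsimp only
    rw [hU, erase_insert hl, smul_comm (X l : MvPolynomial (Fin n) k), hX, smul_smul, ← hs,
      ← smul_smul, smul_assoc, smul_assoc, smul_assoc]

lemma eq_theta {φ : Finset (Fin n) → K.FaceRing k} (h : ∀ T, φ T ∈ K.boundedSpan k univ T) :
    ∃ ψ : Finset (Fin n) → Finset (Fin n) → k, φ = K.theta k ψ := by
  have key : ∀ T, ∃ c : Finset (Fin n) → k,
      φ T = ∑ F ∈ Tᶜ.powerset, c F • K.mono k (expo F) := by
    intro T
    have := h T
    refine Submodule.span_induction (p := fun y _ => ∃ c : Finset (Fin n) → k,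
      y = ∑ F ∈ Tᶜ.powerset, c F • K.mono k (expo F)) ?_ ⟨0, by simp⟩ ?_ ?_ this
    · rintro _ ⟨a, ha, rfl⟩
      have hF : a = expo a.support := by
        ext v
        have := ha v (mem_univ v)
        rw [expo_apply]
        split_ifs with hv
        · rw [Finsupp.mem_support_iff] at hv; omega
        · simpa using hv
      refine ⟨fun F => if F = a.support then 1 else 0, ?_⟩
      rw [sum_eq_single_of_mem a.support]
      · dsimp only
        rw [if_pos rfl, one_smul, ← hF]
      · rw [mem_powerset]
        intro v hv
        rw [mem_compl]
        intro hvT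
        have := ha v (mem_univ v)
        rw [if_pos hvT] at this
        rw [Finsupp.mem_support_iff] at hv
        omega
      · intro F _ hF
        dsimp only
        rw [if_neg hF, zero_smul]
    · rintro _ _ _ _ ⟨c, rfl⟩ ⟨c', rfl⟩
      exact ⟨c + c', by simp [add_smul, sum_add_distrib]⟩
    · rintro r _ _ ⟨c, rfl⟩
      exact ⟨r • c, by simp [smul_sum, mul_smul]⟩
  choose c hc using key
  -- The coefficient of `x^F` at `T` belongs to multidegree `F ∪ T`, from which `T` is recovered as
  -- a difference; `eps` is its own inverse.
  refine ⟨fun U F => eps F U • c (U \ F) F, funext fun T => ?_⟩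
  rw [hc, theta]
  refine sum_congr rfl fun F hF => ?_
  rw [mem_powerset, subset_compl_iff_disjoint_right] at hF
  rw [smul_smul, eps_mul_self, one_smul, union_sdiff_cancel_left hF]

lemma theta_mem (ψ : Finset (Fin n) → Finset (Fin n) → k) (T : Finset (Fin n)) :
    K.theta k ψ T ∈ K.boundedSpan k univ T := by
  refine sum_mem fun F hF => Submodule.smul_mem _ _ (Submodule.subset_span ⟨_, fun l _ => ?_, rfl⟩)
  rw [expo_apply]
  split_ifs with h1 h2
  · exact absurd h2 (mem_compl.mp (mem_powerset.mp hF h1))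
  all_goals simp

lemma smul_divFace_eq_zero {T : Finset (Fin n)} {y : K.FaceRing k}
    (hy : y ∈ K.boundedSpan k univ T) {l : Fin n} :
    (X l : MvPolynomial (Fin n) k) • K.divFace k l y = 0 := by
  have : K.boundedSpan k univ T ≤ LinearMap.ker (K.mulVar k l ∘ₗ K.divFace k l) := by
    rw [boundedSpan, Submodule.span_le]
    rintro _ ⟨a, ha, rfl⟩
    have := ha l (mem_univ l)
    rw [SetLike.mem_coe, LinearMap.mem_ker, LinearMap.comp_apply, mulVar_apply, X_smul_divFace_mono,
      if_neg (by omega)]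
  exact this hy

lemma divFace_smul_eq_zero {T : Finset (Fin n)} {y : K.FaceRing k}
    (hy : y ∈ K.boundedSpan k univ T) {l : Fin n} (hl : l ∈ T) :
    K.divFace k l ((X l : MvPolynomial (Fin n) k) • y) = 0 := by
  have : K.boundedSpan k univ T ≤ LinearMap.ker (K.divFace k l ∘ₗ K.mulVar k l) := by
    rw [boundedSpan, Submodule.span_le]
    rintro _ ⟨a, ha, rfl⟩
    have := ha l (mem_univ l)
    rw [if_pos hl] at this
    rw [SetLike.mem_coe, LinearMap.mem_ker, LinearMap.comp_apply, mulVar_apply, divFace_X_smul_mono,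
      if_neg (by omega)]
  exact this hy

/-- The monomials supported on faces remain linearly independent in the face ring, so their
coefficients can be read off. -/
lemma eq_zero_of_theta_eq_zero {ψ : Finset (Fin n) → Finset (Fin n) → k} {T : Finset (Fin n)}
    (h : K.theta k ψ T = 0) {F : Finset (Fin n)} (hF : F ∈ K.faces) (hFT : Disjoint F T) :
    ψ (F ∪ T) F = 0 := by
  have h1 : K.theta k ψ T = Ideal.Quotient.mk (K.faceIdeal k)
      (∑ F ∈ Tᶜ.powerset, (eps F (F ∪ T) • ψ (F ∪ T) F) • monomial (expo F) (1 : k)) := by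
    rw [map_sum]; rfl
  rw [h1, Ideal.Quotient.eq_zero_iff_mem, mem_faceIdeal_iff] at h
  have h2 := h (expo F)
  rw [support_expo, mem_support_iff, coeff_sum, sum_eq_single_of_mem F] at h2
  · rw [coeff_smul, coeff_monomial, if_pos rfl, smul_eq_mul, mul_one] at h2
    by_contra hne
    refine h2 (fun h0 => hne ?_) hF
    rw [← one_smul ℤ (ψ (F ∪ T) F), ← eps_mul_self F (F ∪ T), mul_smul, h0, smul_zero]
  · rwa [mem_powerset, subset_compl_iff_disjoint_right]
  · intro G _ hG
    rw [coeff_smul, coeff_monomial, if_neg, smul_zero]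
    intro heq
    apply hG
    rw [← support_expo G, heq, support_expo]

/-- Every Koszul cycle of the face ring is homologous to a squarefree one. -/
lemma exists_eq_theta_add_diff {i : ℕ} {φ : Finset (Fin n) → K.FaceRing k}
    (hφ : ∀ T : Finset (Fin n), T.card + 1 = i →
      diff (X : Fin n → MvPolynomial (Fin n) k) φ T = 0) :
    ∃ (ψ : Finset (Fin n) → Finset (Fin n) → k) (w : Finset (Fin n) → K.FaceRing k),
      ∀ T : Finset (Fin n), T.card = i →
        φ T = K.theta k ψ T + diff (X : Fin n → MvPolynomial (Fin n) k) w T := by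
  obtain ⟨φ', w, hmem, heq⟩ := exists_eq_add_diff
    (x := (X : Fin n → MvPolynomial (Fin n) k))
    (q := fun l => (K.divFace k l).toAddMonoidHom)
    (N := fun L T => (K.boundedSpan k L T).toAddSubgroup)
    (fun l m hml y => K.divFace_smul k hml y) (K.mem_boundedSpan_empty k)
    (fun L T l hl y hy => K.sub_smul_divFace_mem k hl hy)
    (fun L T l hl y hy => K.sub_divFace_smul_mem k hl hy) hφ univ
  obtain ⟨ψ, rfl⟩ := K.eq_theta k hmem
  exact ⟨ψ, w, heq⟩

/-- A squarefree Koszul boundary of the face ring bounds a squarefree chain. -/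
lemma exists_theta_cobd_eq {i : ℕ} {ψ : Finset (Fin n) → Finset (Fin n) → k}
    {w : Finset (Fin n) → K.FaceRing k}
    (hw : ∀ T : Finset (Fin n), T.card = i →
      diff (X : Fin n → MvPolynomial (Fin n) k) w T = K.theta k ψ T) :
    ∃ χ : Finset (Fin n) → Finset (Fin n) → k,
      ∀ T : Finset (Fin n), T.card = i → K.theta k (fun U => cobd (χ U)) T = K.theta k ψ T := by
  obtain ⟨w', hmem, heq⟩ := exists_diff_eq
    (x := (X : Fin n → MvPolynomial (Fin n) k))
    (q := fun l => (K.divFace k l).toAddMonoidHom)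
    (N := fun L T => (K.boundedSpan k L T).toAddSubgroup)
    (fun l m hml y => K.divFace_smul k hml y) (K.mem_boundedSpan_empty k)
    (fun L T l hl y hy => K.sub_smul_divFace_mem k hl hy)
    (fun L T l hl y hy => K.sub_divFace_smul_mem k hl hy) hw
    (fun T l _ => K.smul_divFace_eq_zero k (K.theta_mem k ψ T))
    (fun T l hl => K.divFace_smul_eq_zero k (K.theta_mem k ψ T) hl) univ
  obtain ⟨χ, rfl⟩ := K.eq_theta k hmem
  exact ⟨χ, fun T hT => by rw [← diff_theta, heq T hT]⟩

end FaceComplex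

/-! ### Hochster's formula and Reisner's criterion for Koszul homology -/

namespace FaceComplex

open MvPolynomial Koszul Finset

section Exactness

variable {n : ℕ} (K : FaceComplex (Fin n)) (k : Type u) [Field k]

/-- The faces of a complex as a set. -/
def faceSet {V : Type} (K : FaceComplex V) : Set (Finset V) := {F | F ∈ K.faces}

lemma isLowerSet_faceSet {V : Type} (K : FaceComplex V) : IsLowerSet K.faceSet :=
  fun _ _ hle h => K.down_closed h hle

lemma mem_delSet_compl {U F : Finset (Fin n)} :
    F ∈ delSet K.faceSet Uᶜ ↔ F ∈ K.faces ∧ F ⊆ U := by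
  rw [delSet, Set.mem_ofPred_eq, ← subset_compl_iff_disjoint_right, compl_compl]
  rfl

lemma theta_add (ψ χ : Finset (Fin n) → Finset (Fin n) → k) :
    K.theta k (ψ + χ) = K.theta k ψ + K.theta k χ := by
  funext T
  simp [theta, ← sum_add_distrib, add_smul]

/-- A squarefree chain is a cycle if and only if its components are cocycles on the restrictions of
the complex. -/
lemma diff_theta_eq_zero_iff {i : ℕ} {ψ : Finset (Fin n) → Finset (Fin n) → k} :
    (∀ T : Finset (Fin n), T.card + 1 = i →
      diff (X : Fin n → MvPolynomial (Fin n) k) (K.theta k ψ) T = 0) ↔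
    ∀ (U : Finset (Fin n)) (m : ℕ), m + i = U.card → ∀ F ∈ delSet K.faceSet Uᶜ,
      F.card = m + 1 → cobd (ψ U) F = 0 := by
  constructor
  · intro h U m hm F hF hc
    rw [mem_delSet_compl] at hF
    have hcard := card_sdiff_add_card_eq_card hF.2
    have := h (U \ F) (by omega)
    rw [diff_theta] at this
    have := K.eq_zero_of_theta_eq_zero k this hF.1 disjoint_sdiff
    rwa [union_sdiff_of_subset hF.2] at this
  · intro h T hT
    rw [diff_theta]
    trans K.theta k (0 : Finset (Fin n) → Finset (Fin n) → k) T
    · refine K.theta_congr k fun F hF hFT => ?_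
      -- The coboundary at the empty face is an empty sum, a case not covered by the cocycle
      -- condition, which concerns sets with `m + 1` elements.
      by_cases hF0 : F.card = 0
      · rw [card_eq_zero.mp hF0]; rfl
      · exact h (F ∪ T) (F.card - 1) (by rw [card_union_of_disjoint hFT]; omega) F
          ((K.mem_delSet_compl).mpr ⟨hF, subset_union_left⟩) (by omega)
    · simp [theta]

lemma theta_cobd_eq_iff {i : ℕ} {ψ χ : Finset (Fin n) → Finset (Fin n) → k} :
    (∀ T : Finset (Fin n), T.card = i →
      K.theta k (fun U => cobd (χ U)) T = K.theta k ψ T) ↔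
    ∀ (U : Finset (Fin n)) (m : ℕ), m + i = U.card → ∀ F ∈ delSet K.faceSet Uᶜ,
      F.card = m → cobd (χ U) F = ψ U F := by
  constructor
  · intro h U m hm F hF hc
    rw [mem_delSet_compl] at hF
    have hcard := card_sdiff_add_card_eq_card hF.2
    have h0 : K.theta k ((fun U => cobd (χ U)) + -ψ) (U \ F) = 0 := by
      have hneg : K.theta k (-ψ) = -K.theta k ψ := by
        funext T; simp [theta]
      rw [theta_add, hneg, Pi.add_apply, h _ (by omega), Pi.neg_apply, add_neg_cancel]
    have := K.eq_zero_of_theta_eq_zero k h0 hF.1 disjoint_sdiff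
    rw [union_sdiff_of_subset hF.2] at this
    exact eq_of_sub_eq_zero ((sub_eq_add_neg _ _).trans this)
  · intro h T hT
    refine K.theta_congr k fun F hF hFT => ?_
    exact h (F ∪ T) F.card (by rw [card_union_of_disjoint hFT, hT]) F
      ((K.mem_delSet_compl).mpr ⟨hF, subset_union_left⟩) rfl

/-- A cycle may be taken squarefree up to a boundary; its component in multidegree `U` is then a
cocycle on the restriction to `U`, and the primitives for the various `U` are chosen independently.
-/
lemma exactAt_of_acyclic {i : ℕ}
    (h : ∀ (U : Finset (Fin n)) (m : ℕ), m + i = U.card → Acyclic k (delSet K.faceSet Uᶜ) m) :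
    ExactAt (X : Fin n → MvPolynomial (Fin n) k) (K.FaceRing k) i := by
  intro φ hφ
  obtain ⟨ψ, w, hw⟩ := K.exists_eq_theta_add_diff k hφ
  have hcyc : ∀ T : Finset (Fin n), T.card + 1 = i →
      diff (X : Fin n → MvPolynomial (Fin n) k) (K.theta k ψ) T = 0 := by
    intro T hT
    have h1 : diff (X : Fin n → MvPolynomial (Fin n) k) φ T = diff X (K.theta k ψ + diff X w) T :=
      diff_congr _ fun W hW => hw W (by omega)
    rw [hφ T hT, map_add, diff_diff, add_zero] at h1
    exact h1.symm
  rw [diff_theta_eq_zero_iff] at hcyc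
  have key : ∀ U : Finset (Fin n), ∃ χ : Finset (Fin n) → k, ∀ m : ℕ, m + i = U.card →
      ∀ F ∈ delSet K.faceSet Uᶜ, F.card = m → cobd χ F = ψ U F := by
    intro U
    by_cases hU : i ≤ U.card
    · obtain ⟨χ, hχ⟩ := h U (U.card - i) (by omega) (ψ U) (hcyc U _ (by omega))
      refine ⟨χ, fun m hm => ?_⟩
      rwa [show m = U.card - i by omega]
    · exact ⟨0, fun m hm => by omega⟩
  choose χ hχ using key
  refine ⟨K.theta k χ + w, fun T hT => ?_⟩
  rw [map_add, Pi.add_apply, diff_theta, (K.theta_cobd_eq_iff k).mpr hχ T hT, hw T hT]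

/-- Reisner's criterion, in terms of Koszul homology. -/
lemma exactAt_of_linksAcyclic {c : ℕ} (h : LinksAcyclic k K.faceSet c)
    (h0 : ∀ m < c, Acyclic k K.faceSet m) {i : ℕ} (hi : n < i + c) :
    ExactAt (X : Fin n → MvPolynomial (Fin n) k) (K.FaceRing k) i := by
  refine K.exactAt_of_acyclic k fun U m hm => ?_
  -- From `m + i = U.card` it follows that `m + Uᶜ.card = n - i`, so the single bound `n < i + c`
  -- serves all multidegrees.
  have hU := card_add_card_compl U
  rw [Fintype.card_fin] at hU
  exact (h0 m (by omega)).of_resSurjective (fun F hF => hF.1)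
    (h.resSurjective K.isLowerSet_faceSet Uᶜ (by omega))

/-- Only the multidegree `univ` is used, where the restriction is the whole complex; a cocycle is
placed there and zero elsewhere. -/
lemma acyclic_of_exactAt {i m : ℕ} (hm : m + i = n)
    (h : ExactAt (X : Fin n → MvPolynomial (Fin n) k) (K.FaceRing k) i) :
    Acyclic k K.faceSet m := by
  intro ψ hψ
  obtain ⟨w, hw⟩ := h (K.theta k fun U => if U = univ then ψ else 0)
    ((K.diff_theta_eq_zero_iff k).mpr fun U j hj F hF hc => by
      split_ifs with hU
      · rw [hU, card_univ, Fintype.card_fin] at hj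
        exact hψ F hF.1 (by omega)
      · rw [map_zero]; rfl)
  obtain ⟨χ, hχ⟩ := K.exists_theta_cobd_eq k hw
  rw [theta_cobd_eq_iff] at hχ
  refine ⟨χ univ, fun F hF hc => ?_⟩
  simpa using hχ univ m (by simpa using hm) F ((K.mem_delSet_compl).mpr ⟨hF, subset_univ F⟩) hc

end Exactness

/-! ### Reduced homology and cohomology over a field -/

section Comparison

variable {V : Type} [LinearOrder V] (K : FaceComplex V) (k : Type u) [Field k]
  (G : Type u) [AddCommGroup G] [Module k G]

lemma subsingleton_homology_iff {A B C : Type*} [AddCommGroup A] [AddCommGroup B] [AddCommGroup C]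
    [Module k A] [Module k B] [Module k C] (f : A →ₗ[k] B) (g : B →ₗ[k] C) :
    Subsingleton (LinearMap.ker g ⧸ (LinearMap.range f).submoduleOf (LinearMap.ker g)) ↔
      LinearMap.ker g ≤ LinearMap.range f := by
  rw [Submodule.Quotient.subsingleton_iff, Submodule.submoduleOf_eq_top]

lemma mem_facesOfDim {i : ℤ} {F : Finset V} :
    F ∈ K.facesOfDim i ↔ F ∈ K.faces ∧ (F.card : ℤ) = i + 1 := by
  rw [facesOfDim, mem_filter]

lemma sum_incidence_smul {i j : ℤ} (hij : j = i + 1) (ψ : Finset V → G) (σ : K.facesOfDim j) :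
    ∑ τ : K.facesOfDim i, incidence σ.1 τ.1 • ψ τ.1 = cobd ψ σ.1 := by
  have hσ := K.mem_facesOfDim.mp σ.2
  simp only [incidence, sum_smul, cobd_apply]
  rw [sum_comm]
  refine sum_congr rfl fun v hv => ?_
  have hmem : σ.1.erase v ∈ K.facesOfDim i := by
    rw [mem_facesOfDim]
    refine ⟨K.down_closed hσ.1 (erase_subset _ _), ?_⟩
    have := card_erase_add_one hv
    omega
  rw [Fintype.sum_eq_single ⟨σ.1.erase v, hmem⟩]
  · simp [sgn]
  · intro τ hτ
    rw [if_neg, zero_smul]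
    intro h
    exact hτ (Subtype.ext h.symm)

lemma coboundary_apply {i j : ℤ} (hij : j = i + 1) (ψ : Finset V → G) (σ : K.facesOfDim j) :
    K.coboundary k G i j (fun τ => ψ τ.1) σ = cobd ψ σ.1 := by
  rw [← K.sum_incidence_smul G hij ψ σ]
  simp [coboundary]

/-- Extension of a cochain by zero. -/
def extend {i : ℤ} (c : K.facesOfDim i → G) (F : Finset V) : G :=
  if h : F ∈ K.facesOfDim i then c ⟨F, h⟩ else 0

lemma extend_coe {i : ℤ} (c : K.facesOfDim i → G) : (fun τ => K.extend G c τ.1) = c := by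
  funext τ
  rw [extend, dif_pos τ.2]

lemma coboundary_eq_cobd {i j : ℤ} (hij : j = i + 1) (c : K.facesOfDim i → G)
    (σ : K.facesOfDim j) : K.coboundary k G i j c σ = cobd (K.extend G c) σ.1 := by
  rw [← K.coboundary_apply k G hij, extend_coe]

lemma coboundary_comp_coboundary {i j l : ℤ} (hij : j = i + 1) (hjl : l = j + 1) :
    K.coboundary k G j l ∘ₗ K.coboundary k G i j = 0 := by
  refine LinearMap.ext fun c => funext fun σ => ?_
  rw [LinearMap.comp_apply]
  have : K.coboundary k G i j c = fun τ => cobd (K.extend G c) τ.1 :=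
    funext fun τ => K.coboundary_eq_cobd k G hij c τ
  rw [this, K.coboundary_apply k G hjl, cobd_cobd]
  rfl

lemma acyclic_iff_ker_le {i : ℤ} {m : ℕ} (hi : i = m - 1) :
    Acyclic G K.faceSet m ↔ LinearMap.ker (K.coboundary k G i (i + 1)) ≤
      LinearMap.range (K.coboundary k G (i - 1) i) := by
  constructor
  · intro h c hc
    obtain ⟨χ, hχ⟩ := h (K.extend G c) fun F hF hcard => by
      have hF' : F ∈ K.facesOfDim (i + 1) := K.mem_facesOfDim.mpr ⟨hF, by omega⟩
      have := congrFun (LinearMap.mem_ker.mp hc) ⟨F, hF'⟩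
      rwa [K.coboundary_eq_cobd k G rfl] at this
    refine ⟨fun τ => χ τ.1, funext fun σ => ?_⟩
    have hσ := K.mem_facesOfDim.mp σ.2
    rw [K.coboundary_apply k G (by omega), hχ _ hσ.1 (by omega)]
    exact congrFun (K.extend_coe G c) σ
  · intro h ψ hψ
    obtain ⟨c, hc⟩ := h (x := fun σ : K.facesOfDim i => ψ σ.1) (by
      rw [LinearMap.mem_ker]
      funext σ
      have hσ := K.mem_facesOfDim.mp σ.2
      rw [K.coboundary_apply k G rfl, hψ _ hσ.1 (by omega)]
      rfl)
    refine ⟨K.extend G c, fun F hF hcard => ?_⟩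
    have hF' : F ∈ K.facesOfDim i := K.mem_facesOfDim.mpr ⟨hF, by omega⟩
    rw [← K.coboundary_eq_cobd k G (by omega) c ⟨F, hF'⟩, hc]

/-- The matrix of the boundary. -/
def boundaryMatrix (i j : ℤ) : Matrix (K.facesOfDim j) (K.facesOfDim i) k :=
  Matrix.of fun τ σ => ((incidence σ.1 τ.1 : ℤ) : k)

lemma boundary_eq_mulVecLin (i j : ℤ) :
    K.boundary k k i j = (K.boundaryMatrix k i j).mulVecLin := by
  refine LinearMap.ext fun c => funext fun τ => ?_
  simp [boundary, boundaryMatrix, Matrix.mulVec, dotProduct]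

lemma coboundary_eq_mulVecLin (i j : ℤ) :
    K.coboundary k k i j = (K.boundaryMatrix k j i).transpose.mulVecLin := by
  refine LinearMap.ext fun c => funext fun τ => ?_
  simp [coboundary, boundaryMatrix, Matrix.vecMul, dotProduct, mul_comm]

/-- Exactness of two composable matrices is a condition on their ranks. -/
lemma ker_le_range_iff_rank {l m n : Type*} [Fintype l] [Fintype m] [Fintype n]
    (B : Matrix m n k) (C : Matrix l m k) (h : C * B = 0) :
    LinearMap.ker C.mulVecLin ≤ LinearMap.range B.mulVecLin ↔
      B.rank + C.rank = Fintype.card m := by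
  have hle : LinearMap.range B.mulVecLin ≤ LinearMap.ker C.mulVecLin := by
    rw [LinearMap.range_le_ker_iff, ← Matrix.mulVecLin_mul, h, Matrix.mulVecLin_zero]
  have hrk := LinearMap.finrank_range_add_finrank_ker C.mulVecLin
  rw [Module.finrank_fintype_fun_eq_card] at hrk
  rw [Matrix.rank, Matrix.rank]
  constructor
  · intro h'
    rw [le_antisymm hle h']; omega
  · intro h'
    exact (Submodule.eq_of_le_of_finrank_eq hle (by omega)).ge

/-- Boundary and coboundary are transposed matrices, and exactness at the middle term says that the
two ranks add up to its dimension, a condition invariant under transposition. -/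
lemma subsingleton_reducedHomology_iff {i : ℤ} {m : ℕ} (hi : i = m - 1) :
    Subsingleton (K.ReducedHomology k k i) ↔ Acyclic k K.faceSet m := by
  rw [K.acyclic_iff_ker_le k k hi]
  refine (subsingleton_homology_iff k _ _).trans ?_
  have h0 : (K.boundaryMatrix k (i + 1) i).transpose * (K.boundaryMatrix k i (i - 1)).transpose
      = 0 := by
    have := K.coboundary_comp_coboundary k k (i := i - 1) (j := i) (l := i + 1) (by omega) rfl
    rw [coboundary_eq_mulVecLin, coboundary_eq_mulVecLin, ← Matrix.mulVecLin_mul] at this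
    exact Matrix.toLin'.injective (by rw [Matrix.toLin'_apply', this, map_zero])
  rw [boundary_eq_mulVecLin, boundary_eq_mulVecLin, coboundary_eq_mulVecLin,
    coboundary_eq_mulVecLin, ker_le_range_iff_rank k _ _ h0, ker_le_range_iff_rank,
    Matrix.rank_transpose, Matrix.rank_transpose, add_comm]
  rw [← Matrix.transpose_mul] at h0
  exact Matrix.transpose_eq_zero.mp h0

lemma subsingleton_reducedHomology_of_lt {i : ℤ} (hi : i < -1) :
    Subsingleton (K.ReducedHomology k k i) := by
  have : IsEmpty (K.facesOfDim i) := ⟨fun σ => by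
    have := (K.mem_facesOfDim.mp σ.2).2
    omega⟩
  exact (subsingleton_homology_iff k _ _).mpr fun c _ => by
    rw [Subsingleton.elim c 0]; exact zero_mem _

end Comparison

/-! ### Links in a pure complex -/

section Links

variable {V : Type} [LinearOrder V] (K : FaceComplex V) (k : Type u) [Field k]

lemma faceSet_link {σ : Finset V} (hσ : σ ∈ K.faces) :
    (K.link σ hσ).faceSet = linkSet K.faceSet σ := by
  ext F
  change F ∈ K.faces.filter _ ↔ Disjoint F σ ∧ F ∪ σ ∈ K.faces
  rw [mem_filter, disjoint_comm, union_comm σ F]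
  exact ⟨fun h => h.2, fun h => ⟨K.down_closed h.2 subset_union_left, h⟩⟩

/-- In a pure complex every face lies in a face of maximal cardinality. -/
lemma IsPure.exists_superset {K : FaceComplex V} (h : K.IsPure) {σ : Finset V}
    (hσ : σ ∈ K.faces) : ∃ τ ∈ K.faces, σ ⊆ τ ∧ τ.card = K.faces.sup card := by
  obtain ⟨τ, hle, hτ⟩ := K.faces.finite_toSet.exists_le_maximal hσ
  obtain ⟨ρ, hρ, hcard⟩ := exists_mem_eq_sup K.faces ⟨_, hσ⟩ card
  refine ⟨τ, hτ.prop, hle, ?_⟩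
  rw [hcard]
  refine h τ ρ hτ ⟨hρ, fun F hF hle' => ?_⟩
  rw [← Finset.eq_of_subset_of_card_le hle' (hcard ▸ le_sup (f := card) hF)]

/-- By purity `σ` lies in a face of maximal cardinality, whose remainder outside `σ` is a face of
the link. Without this inequality the hypothesis on links would cover a shorter range of degrees. -/
lemma le_dim_link {K : FaceComplex V} (h : K.IsPure) {σ : Finset V} (hσ : σ ∈ K.faces) :
    K.dim - σ.card ≤ (K.link σ hσ).dim := by
  obtain ⟨τ, hτ, hle, hcard⟩ := h.exists_superset hσ
  have hmem : τ \ σ ∈ (K.link σ hσ).faces := by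
    change τ \ σ ∈ K.faces.filter _
    rw [mem_filter]
    exact ⟨K.down_closed hτ sdiff_subset, disjoint_sdiff, by rwa [union_sdiff_of_subset hle]⟩
  have h1 := le_sup (f := card) hmem
  have h2 := card_sdiff_add_card_eq_card hle
  rw [dim, dim]
  omega

lemma linksAcyclic_of_reducedHomology (hpure : K.IsPure)
    (hlink : ∀ (σ : Finset V) (hσ : σ ∈ K.faces), σ.Nonempty →
      ∀ i : ℤ, i < (K.link σ hσ).dim → Subsingleton ((K.link σ hσ).ReducedHomology k k i)) :
    LinksAcyclic k K.faceSet (K.faces.sup card) := by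
  intro G m hG hm
  by_cases hGK : G ∈ K.faces
  · rw [← K.faceSet_link hGK, ← subsingleton_reducedHomology_iff (i := m - 1) _ _ rfl]
    refine hlink G hGK hG _ (lt_of_lt_of_le ?_ (le_dim_link hpure hGK))
    rw [dim]
    omega
  · have : linkSet K.faceSet G = ∅ :=
      Set.eq_empty_of_forall_notMem fun F hF => hGK (K.down_closed hF.2 subset_union_right)
    rw [this]
    exact acyclic_empty m

end Links

end FaceComplex

/-! ### The Koszul resolution -/

namespace Koszul

open Finset

section Resolution

open MvPolynomial

variable (k : Type u) [Field k] {n : ℕ}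

/-- The Koszul complex of the variables on the polynomial ring is exact in positive degrees. -/
lemma exactAt_mvPolynomial {i : ℕ} (hi : i ≠ 0) :
    ExactAt (X : Fin n → MvPolynomial (Fin n) k) (MvPolynomial (Fin n) k) i := by
  intro φ hφ
  -- In the polynomial ring every multiple of `X l` may be divided, so the threshold is one and only
  -- multidegree zero survives all homotopies. For non-empty `T` nothing is left.
  let N : Finset (Fin n) → Finset (Fin n) → Submodule k (MvPolynomial (Fin n) k) := fun L T =>
    Submodule.span k ((fun a => monomial a 1) '' {a | ∀ l ∈ L, a l = 0 ∧ l ∉ T})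
  have hmap : ∀ (L T : Finset (Fin n)) (l : Fin n)
      (f : MvPolynomial (Fin n) k →ₗ[k] MvPolynomial (Fin n) k),
      (∀ a : Fin n →₀ ℕ, f (monomial a 1) = 0 ∨ (a l = 0 ∧ l ∉ T) ∧ f (monomial a 1) = monomial a 1)
      → ∀ y ∈ N L T, f y ∈ N (insert l L) T := by
    intro L T l f hf y hy
    have : N L T ≤ (N (insert l L) T).comap f := by
      rw [Submodule.span_le]
      rintro _ ⟨a, ha, rfl⟩
      rcases hf a with h | ⟨h1, h2⟩
      · rw [SetLike.mem_coe, Submodule.mem_comap, h]; exact zero_mem _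
      · rw [SetLike.mem_coe, Submodule.mem_comap, h2]
        refine Submodule.subset_span ⟨a, fun m hm => ?_, rfl⟩
        rcases mem_insert.mp hm with rfl | hm
        · exact h1
        · exact ha m hm
    exact this hy
  obtain ⟨φ', w, hmem, heq⟩ := exists_eq_add_diff
    (x := (X : Fin n → MvPolynomial (Fin n) k))
    (q := fun l => (divVar 1 l).toAddMonoidHom)
    (N := fun L T => (N L T).toAddSubgroup)
    (fun l m hml y => divVar_X_mul le_rfl hml y)
    (fun T y => by
      change y ∈ Submodule.span k _
      have : ((fun a => monomial a (1 : k)) '' {a : Fin n →₀ ℕ | ∀ l ∈ (∅ : Finset (Fin n)),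
          a l = 0 ∧ l ∉ T}) = Set.range (basisMonomials (Fin n) k) := by
        ext; simp
      rw [this, Module.Basis.span_eq]
      trivial)
    (fun L T l hl y hy => by
      refine hmap L T l (LinearMap.id - LinearMap.mulLeft k (X l) ∘ₗ divVar 1 l) (fun a => ?_) y hy
      simp only [LinearMap.sub_apply, LinearMap.id_apply, LinearMap.comp_apply,
        LinearMap.mulLeft_apply, X_mul_divVar_monomial le_rfl]
      by_cases h : 1 ≤ a l
      · left; rw [if_pos h, sub_self]
      · right; rw [if_neg h, sub_zero]; exact ⟨⟨by omega, hl⟩, rfl⟩)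
    (fun L T l hl y hy => by
      refine hmap L T l (LinearMap.id - divVar 1 l ∘ₗ LinearMap.mulLeft k (X l)) (fun a => ?_) y hy
      simp only [LinearMap.sub_apply, LinearMap.id_apply, LinearMap.comp_apply,
        LinearMap.mulLeft_apply, divVar_X_mul_monomial]
      left
      rw [if_pos (by omega), sub_self]) hφ univ
  refine ⟨w, fun T hT => ?_⟩
  have hT' : T.Nonempty := card_ne_zero.mp (hT ▸ hi)
  obtain ⟨t, ht⟩ := hT'
  have h0 : φ' T = 0 := by
    have := hmem T
    change φ' T ∈ Submodule.span k _ at this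
    have hempty : ((fun a => monomial a (1 : k)) '' {a : Fin n →₀ ℕ | ∀ l ∈ univ,
        a l = 0 ∧ l ∉ T}) = ∅ := by
      rw [Set.image_eq_empty]
      exact Set.eq_empty_of_forall_notMem fun a ha => (ha t (mem_univ t)).2 ht
    rw [hempty, Submodule.span_empty] at this
    exact this
  rw [heq T hT, h0, zero_add]

end Resolution

section Graded

variable {ι : Type} [LinearOrder ι] [Fintype ι] {S : Type u} [CommRing S]

/-- The Koszul chains of degree `i`. -/
abbrev Chains (ι : Type) (M : Type u) (i : ℕ) : Type u := {T : Finset ι // T.card = i} → M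

variable (S) in
/-- Extension of a homogeneous Koszul chain by zero. -/
def extendChain (M : Type u) [AddCommGroup M] [Module S M] (i : ℕ) :
    Chains ι M i →ₗ[S] (Finset ι → M) where
  toFun φ T := if h : T.card = i then φ ⟨T, h⟩ else 0
  map_add' φ ψ := by funext T; by_cases h : T.card = i <;> simp [h]
  map_smul' r φ := by funext T; by_cases h : T.card = i <;> simp [h]

lemma extendChain_apply {M : Type u} [AddCommGroup M] [Module S M] {i : ℕ} (φ : Chains ι M i)
    {T : Finset ι} (h : T.card = i) : extendChain S M i φ T = φ ⟨T, h⟩ := dif_pos h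

/-- The component of the Koszul differential from degree `i + 1` to degree `i`. -/
def gdiff (x : ι → S) (M : Type u) [AddCommGroup M] [Module S M] (i : ℕ) :
    Chains ι M (i + 1) →ₗ[S] Chains ι M i :=
  LinearMap.funLeft S M Subtype.val ∘ₗ diff x ∘ₗ extendChain S M (i + 1)

variable (x : ι → S) {M : Type u} [AddCommGroup M] [Module S M]

lemma gdiff_apply {i : ℕ} (φ : Chains ι M (i + 1)) (T : {T : Finset ι // T.card = i}) :
    gdiff x M i φ T = diff x (extendChain S M (i + 1) φ) T.1 := rfl

lemma gdiff_coe {i : ℕ} (φ : Finset ι → M) (T : {T : Finset ι // T.card = i}) :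
    gdiff x M i (fun W => φ W.1) T = diff x φ T.1 :=
  diff_congr x fun W hW => extendChain_apply _ (by rw [hW, T.2])

lemma gdiff_gdiff (i : ℕ) (φ : Chains ι M (i + 2)) : gdiff x M i (gdiff x M (i + 1) φ) = 0 := by
  funext T
  have : gdiff x M (i + 1) φ = fun W => diff x (extendChain S M (i + 2) φ) W.1 := rfl
  rw [this, gdiff_coe, diff_diff]
  rfl

lemma gdiff_comp_gdiff (i : ℕ) : gdiff x M i ∘ₗ gdiff x M (i + 1) = 0 :=
  LinearMap.ext (gdiff_gdiff x i)

lemma exactAt_succ_iff {i : ℕ} : ExactAt x M (i + 1) ↔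
    LinearMap.ker (gdiff x M i) ≤ LinearMap.range (gdiff x M (i + 1)) := by
  constructor
  · intro h φ hφ
    obtain ⟨ψ, hψ⟩ := h (extendChain S M (i + 1) φ) fun T hT =>
      congrFun (LinearMap.mem_ker.mp hφ) ⟨T, by omega⟩
    refine ⟨fun W => ψ W.1, funext fun T => ?_⟩
    rw [gdiff_coe, hψ _ T.2]
    exact extendChain_apply φ T.2
  · intro h φ hφ
    obtain ⟨ψ, hψ⟩ := h (x := fun W => φ W.1) (by
      rw [LinearMap.mem_ker]
      funext T
      rw [gdiff_coe]
      exact hφ T.1 (by rw [T.2]))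
    exact ⟨extendChain S M (i + 2) ψ, fun T hT => congrFun hψ ⟨T, hT⟩⟩

open CategoryTheory

/-- The Koszul complex of `x` as a chain complex of free modules. -/
noncomputable def complex : ChainComplex (ModuleCat.{u} S) ℕ :=
  ChainComplex.of (fun i => ModuleCat.of S (Chains ι S i)) (fun i => ModuleCat.ofHom (gdiff x S i))
    fun i => by rw [← ModuleCat.ofHom_comp, gdiff_comp_gdiff]; rfl

lemma complex_d (i : ℕ) : (complex x).d (i + 1) i = ModuleCat.ofHom (gdiff x S i) :=
  ChainComplex.of_d (fun i => ModuleCat.of S (Chains ι S i))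
    (fun i => ModuleCat.ofHom (gdiff x S i)) i

/-- The augmentation of the Koszul complex. -/
def augmentation : Chains ι S 0 →ₗ[S] S ⧸ Ideal.span (Set.range x) :=
  Submodule.mkQ _ ∘ₗ LinearMap.proj ⟨∅, card_empty⟩

lemma diff_empty (ψ : Finset ι → S) : diff x ψ ∅ = ∑ l, ψ {l} * x l := by
  simp [diff_apply, sgn, mul_comm]

lemma range_gdiff_zero : LinearMap.range (gdiff x S 0) = LinearMap.ker (augmentation x) := by
  ext φ
  rw [LinearMap.mem_ker, augmentation, LinearMap.comp_apply, Submodule.mkQ_apply,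
    Submodule.Quotient.mk_eq_zero, LinearMap.proj_apply, Ideal.mem_span_range_iff_exists_fun]
  constructor
  · rintro ⟨ψ, rfl⟩
    exact ⟨fun l => extendChain S S 1 ψ {l}, (diff_empty x _).symm⟩
  · rintro ⟨c, hc⟩
    -- A chain of degree one lives on singletons, where this sum is the single coefficient `c l`.
    refine ⟨fun W => ∑ l ∈ W.1, c l, funext fun T => ?_⟩
    obtain ⟨T, hT⟩ := T
    obtain rfl := card_eq_zero.mp hT
    rw [gdiff_coe x (fun W => ∑ l ∈ W, c l), diff_empty, ← hc]
    simp

lemma augmentation_surjective : Function.Surjective (augmentation x) := by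
  intro y
  obtain ⟨s, rfl⟩ := Submodule.mkQ_surjective _ y
  exact ⟨fun _ => s, rfl⟩

end Graded

end Koszul

/-! ### Tor as Koszul homology -/

namespace Koszul

open Finset CategoryTheory

variable {ι : Type} [LinearOrder ι] [Fintype ι] {S : Type u} [CommRing S] (x : ι → S)

/-- The augmentation as a map of complexes. -/
noncomputable def toSingle : complex x ⟶ (ChainComplex.single₀ (ModuleCat.{u} S)).obj
    (ModuleCat.of S (S ⧸ Ideal.span (Set.range x))) :=
  ((complex x).toSingle₀Equiv _).symm ⟨ModuleCat.ofHom (augmentation x), by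
    rw [complex_d]
    ext φ
    have : gdiff x S 0 φ ∈ LinearMap.ker (augmentation x) := range_gdiff_zero x ▸ ⟨φ, rfl⟩
    exact this⟩

lemma toSingle_f_zero : (toSingle x).f 0 = ModuleCat.ofHom (augmentation x) := by
  exact ChainComplex.toSingle₀Equiv_symm_apply_f_zero _ _

lemma exactAt_complex {i : ℕ} (h : ExactAt x S (i + 1)) : (complex x).ExactAt (i + 1) := by
  rw [HomologicalComplex.exactAt_iff' _ (i + 2) (i + 1) i (by simp) (by simp),
    ShortComplex.moduleCat_exact_iff_ker_sub_range]
  change LinearMap.ker ((complex x).d (i + 1) i).hom ≤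
    LinearMap.range ((complex x).d (i + 2) (i + 1)).hom
  rw [complex_d, complex_d]
  exact (exactAt_succ_iff x).mp h

lemma quasiIso_toSingle (h : ∀ i, ExactAt x S (i + 1)) : QuasiIso (toSingle x) where
  quasiIsoAt i := by
    cases i with
    | zero =>
      -- In degree zero a quasi-isomorphism to the quotient means that the augmented complex is
      -- right exact.
      rw [ChainComplex.quasiIsoAt₀_iff, ShortComplex.quasiIso_iff_of_zeros' _ rfl rfl rfl]
      constructor
      · rw [ShortComplex.moduleCat_exact_iff_ker_sub_range]
        change LinearMap.ker ((toSingle x).f 0).hom ≤ LinearMap.range ((complex x).d 1 0).hom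
        rw [toSingle_f_zero, complex_d]
        exact (range_gdiff_zero x).ge
      · change Epi ((toSingle x).f 0)
        rw [toSingle_f_zero]
        exact (ModuleCat.epi_iff_surjective (ModuleCat.ofHom (augmentation x))).mpr
          (augmentation_surjective x)
    | succ i =>
      rw [quasiIsoAt_iff_exactAt' (hL := ChainComplex.exactAt_succ_single_obj ..)]
      exact exactAt_complex x (h i)

/-- The Koszul resolution of `S / (x)`. -/
noncomputable def resolution (h : ∀ i, ExactAt x S (i + 1)) :
    ProjectiveResolution (ModuleCat.of S (S ⧸ Ideal.span (Set.range x))) where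
  complex := complex x
  projective i := by
    exact ModuleCat.projective_of_free (Pi.basisFun S {T : Finset ι // T.card = i})
  π := toSingle x
  quasiIso := quasiIso_toSingle x h

variable (M : Type u) [AddCommGroup M] [Module S M]

/-- The Koszul homology of `M` in positive degree. -/
abbrev Homology (i : ℕ) : Type u :=
  LinearMap.ker (gdiff x M i) ⧸
    (LinearMap.range (gdiff x M (i + 1))).submoduleOf (LinearMap.ker (gdiff x M i))

/-- The part of the Koszul complex of `M` around degree `i + 1`. -/
noncomputable def shortComplex (i : ℕ) : ShortComplex (ModuleCat.{u} S) :=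
  ShortComplex.mk (ModuleCat.ofHom (gdiff x M (i + 1))) (ModuleCat.ofHom (gdiff x M i)) (by
    rw [← ModuleCat.ofHom_comp, gdiff_comp_gdiff]; rfl)

lemma piScalarRight_lTensor (i : ℕ) (t : TensorProduct S M (Chains ι S (i + 1))) :
    TensorProduct.piScalarRight S S M _ ((gdiff x S i).lTensor M t) =
      gdiff x M i (TensorProduct.piScalarRight S S M _ t) := by
  suffices h : (TensorProduct.piScalarRight S S M _).toLinearMap ∘ₗ (gdiff x S i).lTensor M =
      gdiff x M i ∘ₗ (TensorProduct.piScalarRight S S M _).toLinearMap from LinearMap.congr_fun h t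
  refine TensorProduct.ext' fun m φ => funext fun T => ?_
  simp only [LinearMap.comp_apply, LinearMap.lTensor_tmul, LinearEquiv.coe_coe,
    TensorProduct.piScalarRight_apply, TensorProduct.piScalarRightHom_tmul, gdiff_apply]
  rw [diff_apply, diff_apply, sum_smul]
  refine sum_congr rfl fun l hl => ?_
  have hc : (insert l T.1).card = i + 1 := by
    rw [card_insert_of_notMem (mem_compl.mp hl), T.2]
  rw [extendChain_apply _ hc, extendChain_apply _ hc, smul_assoc, smul_assoc]

/-- The tensor product of `M` with the Koszul complex of `S` is the Koszul complex of `M`. -/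
noncomputable def scIso (i : ℕ) :
    ((((MonoidalCategory.tensoringLeft (ModuleCat.{u} S)).obj
      (ModuleCat.of S M)).mapHomologicalComplex _).obj (complex x)).sc' (i + 2) (i + 1) i ≅
      shortComplex x M i :=
  ShortComplex.isoMk
    (TensorProduct.piScalarRight S S M {T : Finset ι // T.card = i + 2}).toModuleIso
    (TensorProduct.piScalarRight S S M {T : Finset ι // T.card = i + 1}).toModuleIso
    (TensorProduct.piScalarRight S S M {T : Finset ι // T.card = i}).toModuleIso
    (by
      change _ = MonoidalCategory.whiskerLeft (ModuleCat.of S M) ((complex x).d (i + 2) (i + 1)) ≫ _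
      rw [complex_d]
      refine ModuleCat.hom_ext (LinearMap.ext fun t => ?_)
      exact (piScalarRight_lTensor x M (i + 1) t).symm)
    (by
      change _ = MonoidalCategory.whiskerLeft (ModuleCat.of S M) ((complex x).d (i + 1) i) ≫ _
      rw [complex_d]
      refine ModuleCat.hom_ext (LinearMap.ext fun t => ?_)
      exact (piScalarRight_lTensor x M i t).symm)

/-- `Tor` of `M` and `S / (x)` is Koszul homology. -/
noncomputable def torIso (h : ∀ i, ExactAt x S (i + 1)) (i : ℕ) :
    ((Tor (ModuleCat.{u} S) (i + 1)).obj (ModuleCat.of S M)).obj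
      (ModuleCat.of S (S ⧸ Ideal.span (Set.range x))) ≅ ModuleCat.of S (Homology x M i) :=
  (resolution x h).isoLeftDerivedObj
    ((MonoidalCategory.tensoringLeft (ModuleCat.{u} S)).obj (ModuleCat.of S M)) (i + 1) ≪≫
  HomologicalComplex.homologyIsoSc' _ (i + 2) (i + 1) i (by simp) (by simp) ≪≫
  ShortComplex.homologyMapIso (scIso x M i) ≪≫
  (shortComplex x M i).moduleCatHomologyIso ≪≫
  (Submodule.quotEquivOfEq _ _ (by
    ext φ
    change _ ↔ φ.1 ∈ LinearMap.range (gdiff x M (i + 1))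
    constructor
    · rintro ⟨ψ, rfl⟩
      exact ⟨ψ, rfl⟩
    · rintro ⟨ψ, hψ⟩
      exact ⟨ψ, Subtype.ext hψ⟩)).toModuleIso

end Koszul

lemma Koszul.map_cobd {V A B : Type*} [LinearOrder V] [AddCommGroup A] [AddCommGroup B]
    (f : A →+ B) (ψ : Finset V → A) (F : Finset V) :
    f (cobd ψ F) = cobd (fun G => f (ψ G)) F := by
  simp [cobd_apply, map_sum, map_zsmul]

/-! ### Cochains with values in exterior powers -/

namespace FaceComplex

open MvPolynomial Koszul Finset

variable {n : ℕ} (K : FaceComplex (Fin n)) (k : Type u) [Field k]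

variable (n) in
/-- The basis of the exterior power given by the subsets of `{1, …, n}`. -/
noncomputable def extBasis (j : ℕ) :
    Module.Basis (Set.powersetCard (Fin n) j) k (⋀[k]^j (Fin n → k)) :=
  (Pi.basisFun k (Fin n)).exteriorPower j

open Classical in
/-- The coordinate at a basis vector of the exterior power. -/
noncomputable def extCoord (j : ℕ) (U : Finset (Fin n)) : (⋀[k]^j (Fin n → k)) →ₗ[k] k :=
  if h : U ∈ Set.powersetCard (Fin n) j then (extBasis n k j).coord ⟨U, h⟩ else 0

/-- The element of the exterior power with given coordinates. -/
noncomputable def ofCoords (j : ℕ) (f : Finset (Fin n) → k) : ⋀[k]^j (Fin n → k) :=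
  (extBasis n k j).repr.symm (Finsupp.equivFunOnFinite.symm fun U => f U.1)

lemma extCoord_ofCoords {j : ℕ} {U : Finset (Fin n)} (hU : U.card = j) (f : Finset (Fin n) → k) :
    extCoord k j U (ofCoords k j f) = f U := by
  rw [extCoord, dif_pos (Set.powersetCard.mem_iff.mpr hU), ofCoords, Module.Basis.coord_apply, LinearEquiv.apply_symm_apply]
  rfl

lemma ext_extCoord {j : ℕ} {y z : ⋀[k]^j (Fin n → k)}
    (h : ∀ U : Finset (Fin n), U.card = j → extCoord k j U y = extCoord k j U z) : y = z := by
  refine (extBasis n k j).ext_elem fun ⟨U, hU⟩ => ?_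
  have := h U hU
  rwa [extCoord, dif_pos hU] at this

/-- The families of cochains with values in the exterior powers which occur in degree `i`. -/
abbrev ExtCochains (i : ℕ) : Type u :=
  ∀ j : Fin (n + 1), K.facesOfDim ((j : ℤ) - i - 1) → ⋀[k]^(j : ℕ) (Fin n → k)

/-- The cardinality of a set of vertices as an index. -/
def cardFin (U : Finset (Fin n)) : Fin (n + 1) :=
  ⟨U.card, Nat.lt_succ_of_le (by simpa using U.card_le_univ)⟩

lemma coe_cardFin (U : Finset (Fin n)) : (cardFin U : ℕ) = U.card := rfl

/-- The components of a family of cochains. -/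
noncomputable def component {i : ℕ} (c : K.ExtCochains k i) (U F : Finset (Fin n)) : k :=
  extCoord k (cardFin U) U (K.extend _ (c (cardFin U)) F)

lemma cobd_component {i : ℕ} (c : K.ExtCochains k i) {U F : Finset (Fin n)} {m : ℕ}
    (hm : m + i = U.card) (hF : F ∈ K.faces) (hc : F.card = m + 1) :
    cobd (K.component k c U) F = extCoord k (cardFin U) U
      (K.coboundary k _ _ (((cardFin U : ℕ) : ℤ) - i - 1 + 1) (c (cardFin U))
        ⟨F, K.mem_facesOfDim.mpr ⟨hF, by rw [coe_cardFin]; omega⟩⟩) := by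
  rw [coboundary_eq_cobd _ _ _ rfl]
  exact (map_cobd (extCoord k (cardFin U) U).toAddMonoidHom _ F).symm

/-- The Koszul chain given by a family of cochains with values in the exterior powers. -/
noncomputable def thetaExt (i : ℕ) : K.ExtCochains k i →ₗ[k] Chains (Fin n) (K.FaceRing k) i where
  toFun c W := K.theta k (K.component k c) W.1
  map_add' c c' := by
    have : K.component k (c + c') = K.component k c + K.component k c' := by
      funext U F
      simp only [component, extend, Pi.add_apply, ← map_add]
      congr 1
      by_cases h : F ∈ K.facesOfDim (((cardFin U : ℕ) : ℤ) - i - 1) <;> simp [h]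
    rw [this, theta_add]
    rfl
  map_smul' r c := by
    funext W
    have : ∀ U F, K.component k (r • c) U F = r * K.component k c U F := by
      intro U F
      simp only [component, extend, Pi.smul_apply, ← smul_eq_mul, ← map_smul]
      congr 1
      by_cases h : F ∈ K.facesOfDim (((cardFin U : ℕ) : ℤ) - i - 1) <;> simp [h]
    simp only [theta, this, RingHom.id_apply, Pi.smul_apply, smul_sum, smul_smul, mul_smul_comm]

/-- The families of cocycles. -/
abbrev ExtCocycles (i : ℕ) : Type u :=
  ∀ j : Fin (n + 1), LinearMap.ker (K.coboundary k (⋀[k]^(j : ℕ) (Fin n → k))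
    ((j : ℤ) - i - 1) ((j : ℤ) - i - 1 + 1))

/-- The inclusion of cocycles into cochains. -/
def cocyclesIncl (i : ℕ) : K.ExtCocycles k i →ₗ[k] K.ExtCochains k i :=
  LinearMap.pi fun j => (Submodule.subtype _) ∘ₗ LinearMap.proj j

lemma cobd_component_eq_zero {i : ℕ} (c : K.ExtCocycles k i) {U F : Finset (Fin n)} {m : ℕ}
    (hm : m + i = U.card) (hF : F ∈ K.faces) (hc : F.card = m + 1) :
    cobd (K.component k (K.cocyclesIncl k i c) U) F = 0 := by
  rw [K.cobd_component k _ hm hF hc]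
  have := (c (cardFin U)).2
  rw [LinearMap.mem_ker] at this
  change extCoord k _ U (K.coboundary k _ _ _ (c (cardFin U)).1 _) = 0
  rw [this]
  exact map_zero _

lemma gdiff_thetaExt {i : ℕ} (c : K.ExtCocycles k (i + 1)) :
    gdiff (X : Fin n → MvPolynomial (Fin n) k) (K.FaceRing k) i
      (K.thetaExt k (i + 1) (K.cocyclesIncl k (i + 1) c)) = 0 := by
  funext T
  refine (gdiff_coe _ (K.theta k (K.component k (K.cocyclesIncl k (i + 1) c))) T).trans ?_
  refine (K.diff_theta_eq_zero_iff k (i := i + 1)).mpr (fun U m hm F hF hc => ?_) T.1 (by rw [T.2])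
  exact K.cobd_component_eq_zero k c hm hF.1 hc

/-- The map from families of cocycles to Koszul homology. -/
noncomputable def toKoszul (i : ℕ) : K.ExtCocycles k (i + 1) →ₗ[k]
    Homology (X : Fin n → MvPolynomial (Fin n) k) (K.FaceRing k) i :=
  ((Submodule.mkQ _).restrictScalars k) ∘ₗ
    ((K.thetaExt k (i + 1) ∘ₗ K.cocyclesIncl k (i + 1)).codRestrict
      ((LinearMap.ker (gdiff (X : Fin n → MvPolynomial (Fin n) k) (K.FaceRing k) i)).restrictScalars
        k) (K.gdiff_thetaExt k))

/-- The families of coboundaries. -/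
def extCoboundaries (i : ℕ) : Submodule k (K.ExtCocycles k i) :=
  Submodule.pi Set.univ fun j => (LinearMap.range (K.coboundary k (⋀[k]^(j : ℕ) (Fin n → k))
    ((j : ℤ) - i - 1 - 1) ((j : ℤ) - i - 1))).submoduleOf (LinearMap.ker (K.coboundary k
      (⋀[k]^(j : ℕ) (Fin n → k)) ((j : ℤ) - i - 1) ((j : ℤ) - i - 1 + 1)))

lemma toKoszul_eq_zero_iff {i : ℕ} (c : K.ExtCocycles k (i + 1)) :
    K.toKoszul k i c = 0 ↔ ∃ w : Finset (Fin n) → K.FaceRing k, ∀ T : Finset (Fin n),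
      T.card = i + 1 → diff (X : Fin n → MvPolynomial (Fin n) k) w T =
        K.theta k (K.component k (K.cocyclesIncl k (i + 1) c)) T := by
  have h1 : K.toKoszul k i c = 0 ↔ K.thetaExt k (i + 1) (K.cocyclesIncl k (i + 1) c) ∈
      LinearMap.range (gdiff (X : Fin n → MvPolynomial (Fin n) k) (K.FaceRing k) (i + 1)) :=
    Submodule.Quotient.mk_eq_zero _
  rw [h1]
  constructor
  · rintro ⟨w, hw⟩
    exact ⟨extendChain _ _ _ w, fun T hT => congrFun hw ⟨T, hT⟩⟩
  · rintro ⟨w, hw⟩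
    exact ⟨fun W => w W.1, funext fun T => (gdiff_coe _ w T).trans (hw T.1 T.2)⟩

/-- The coboundary acts coordinatewise with respect to the basis of the exterior power, so
primitives may be found for each basis vector `U` and reassembled. -/
lemma mem_extCoboundaries_iff {i : ℕ} (c : K.ExtCocycles k i) :
    c ∈ K.extCoboundaries k i ↔ ∀ (U : Finset (Fin n)) (m : ℕ), m + i = U.card →
      ∃ χ : Finset (Fin n) → k, ∀ F ∈ K.faceSet, F.card = m →
        cobd χ F = K.component k (K.cocyclesIncl k i c) U F := by
  constructor
  · intro h U m hm
    obtain ⟨b, hb⟩ : (c (cardFin U)).1 ∈ LinearMap.range _ := h (cardFin U) trivial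
    refine ⟨fun F => extCoord k (cardFin U) U (K.extend _ b F), fun F hF hc => ?_⟩
    have hF' : F ∈ K.facesOfDim (((cardFin U : ℕ) : ℤ) - i - 1) :=
      K.mem_facesOfDim.mpr ⟨hF, by rw [coe_cardFin]; omega⟩
    refine (map_cobd (extCoord k (cardFin U) U).toAddMonoidHom _ F).symm.trans ?_
    rw [← K.coboundary_eq_cobd k _ (by omega) b ⟨F, hF'⟩, hb, component, extend, dif_pos hF']
    rfl
  · intro h j _
    have key : ∀ U : Finset (Fin n), ∃ χ : Finset (Fin n) → k, ∀ m : ℕ, m + i = U.card →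
        ∀ F ∈ K.faceSet, F.card = m →
          cobd χ F = K.component k (K.cocyclesIncl k i c) U F := by
      intro U
      by_cases hU : i ≤ U.card
      · obtain ⟨χ, hχ⟩ := h U (U.card - i) (by omega)
        exact ⟨χ, fun m hm => by rwa [show m = U.card - i by omega]⟩
      · exact ⟨0, fun m hm => by omega⟩
    choose χ hχ using key
    change (c j).1 ∈ LinearMap.range _
    refine ⟨fun τ => ofCoords k j fun U => χ U τ.1, funext fun σ => ?_⟩
    rw [K.coboundary_apply k _ (by omega) (fun F => ofCoords k j fun U => χ U F)]
    have hσ := K.mem_facesOfDim.mp σ.2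
    refine ext_extCoord k fun U hU => ?_
    obtain rfl : cardFin U = j := Fin.ext hU
    have hcard := hσ.2
    refine (map_cobd (extCoord k (cardFin U) U).toAddMonoidHom _ σ.1).trans ?_
    have : (fun G => (extCoord k (cardFin U) U).toAddMonoidHom
        (ofCoords k (cardFin U) fun U => χ U G)) = χ U :=
      funext fun G => extCoord_ofCoords k hU fun U => χ U G
    refine (congrArg (fun f => cobd f σ.1) this).trans ?_
    rw [hχ U σ.1.card (by omega) σ.1 hσ.1 rfl]
    rw [component, extend, dif_pos σ.2]
    rfl

variable {K k}

/-- If the Koszul class is zero, each component is a coboundary on the restriction to `U`, hence on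
the whole complex by injectivity of restriction in this range. In the other direction primitives
simply restrict. -/
lemma ker_toKoszul {c i : ℕ} (h : LinksAcyclic k K.faceSet c) (hi : n < i + 1 + c) :
    LinearMap.ker (K.toKoszul k i) = K.extCoboundaries k (i + 1) := by
  ext z
  rw [LinearMap.mem_ker, toKoszul_eq_zero_iff, mem_extCoboundaries_iff]
  constructor
  · rintro ⟨w, hw⟩ U m hm
    obtain ⟨χ, hχ⟩ := K.exists_theta_cobd_eq k hw
    rw [theta_cobd_eq_iff] at hχ
    have hU := card_add_card_compl U
    rw [Fintype.card_fin] at hU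
    exact h.resInjective K.isLowerSet_faceSet Uᶜ (by omega) _
      (fun F hF hc => K.cobd_component_eq_zero k z hm hF hc) ⟨χ U, hχ U m hm⟩
  · intro hz
    have key : ∀ U : Finset (Fin n), ∃ χ : Finset (Fin n) → k, ∀ m : ℕ, m + (i + 1) = U.card →
        ∀ F ∈ delSet K.faceSet Uᶜ, F.card = m →
          cobd χ F = K.component k (K.cocyclesIncl k (i + 1) z) U F := by
      intro U
      by_cases hU : i + 1 ≤ U.card
      · obtain ⟨χ, hχ⟩ := hz U (U.card - (i + 1)) (by omega)
        exact ⟨χ, fun m hm F hF => by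
          rw [show m = U.card - (i + 1) by omega]; exact hχ F hF.1⟩
      · exact ⟨0, fun m hm => by omega⟩
    choose χ hχ using key
    exact ⟨K.theta k χ, fun T hT => by
      rw [diff_theta, (K.theta_cobd_eq_iff k).mpr hχ T hT]⟩

/-- A squarefree cycle is a family of cocycles on the restrictions to the sets `U`; in this range
each of them extends to the whole complex, and the extensions are the coordinates of cocycles with
values in the exterior powers. -/
lemma toKoszul_surjective {c i : ℕ} (h : LinksAcyclic k K.faceSet c) (hi : n < i + 1 + c) :
    Function.Surjective (K.toKoszul k i) := by
  intro y
  obtain ⟨⟨φ, hφ⟩, rfl⟩ := Submodule.mkQ_surjective _ y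
  obtain ⟨ψ, w, hw⟩ := K.exists_eq_theta_add_diff k (i := i + 1)
    (φ := extendChain (MvPolynomial (Fin n) k) _ (i + 1) φ) fun T hT =>
      congrFun (LinearMap.mem_ker.mp hφ) ⟨T, by omega⟩
  have hcyc : ∀ T : Finset (Fin n), T.card + 1 = i + 1 →
      diff (X : Fin n → MvPolynomial (Fin n) k) (K.theta k ψ) T = 0 := by
    intro T hT
    have h1 : diff (X : Fin n → MvPolynomial (Fin n) k)
        (extendChain (MvPolynomial (Fin n) k) _ (i + 1) φ) T =
        diff X (K.theta k ψ + diff X w) T :=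
      diff_congr _ fun W hW => hw W (by omega)
    rw [map_add, diff_diff, add_zero] at h1
    rw [← h1]
    exact congrFun (LinearMap.mem_ker.mp hφ) ⟨T, by omega⟩
  rw [diff_theta_eq_zero_iff] at hcyc
  have key : ∀ U : Finset (Fin n), ∃ ψ' : Finset (Fin n) → k, ∀ m : ℕ, m + (i + 1) = U.card →
      (∀ F ∈ K.faceSet, F.card = m + 1 → cobd ψ' F = 0) ∧
      ∀ F ∈ delSet K.faceSet Uᶜ, F.card = m → ψ' F = ψ U F := by
    intro U
    by_cases hU : i + 1 ≤ U.card
    · have hUc := card_add_card_compl U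
      rw [Fintype.card_fin] at hUc
      obtain ⟨ψ', hψ'⟩ := h.resSurjective K.isLowerSet_faceSet Uᶜ
        (m := U.card - (i + 1)) (by omega) (ψ U) (hcyc U _ (by omega))
      exact ⟨ψ', fun m hm => by rwa [show m = U.card - (i + 1) by omega]⟩
    · exact ⟨0, fun m hm => by omega⟩
  choose ψ' hψ' using key
  let z : K.ExtCochains k (i + 1) := fun j τ => ofCoords k j fun U => ψ' U τ.1
  have hz : ∀ j : Fin (n + 1), z j ∈ LinearMap.ker (K.coboundary k (⋀[k]^(j : ℕ) (Fin n → k))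
      ((j : ℤ) - (i + 1 : ℕ) - 1) ((j : ℤ) - (i + 1 : ℕ) - 1 + 1)) := by
    intro j
    rw [LinearMap.mem_ker]
    funext σ
    rw [K.coboundary_apply k _ rfl (fun F => ofCoords k j fun U => ψ' U F)]
    have hσ := K.mem_facesOfDim.mp σ.2
    refine ext_extCoord k fun U hU => ?_
    obtain rfl : cardFin U = j := Fin.ext hU
    have hcard := hσ.2
    refine (map_cobd (extCoord k (cardFin U) U).toAddMonoidHom _ σ.1).trans ?_
    have : (fun G => (extCoord k (cardFin U) U).toAddMonoidHom
        (ofCoords k (cardFin U) fun U => ψ' U G)) = ψ' U :=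
      funext fun G => extCoord_ofCoords k hU fun U => ψ' U G
    refine (congrArg (fun f => cobd f σ.1) this).trans ?_
    by_cases hpos : i + 1 ≤ U.card
    · rw [(hψ' U (U.card - (i + 1)) (by omega)).1 σ.1 hσ.1 (by omega)]
      exact (map_zero _).symm
    -- For `U.card ≤ i` the cochains live in degrees below `-1`, so a coboundary can only be tested
    -- on the empty face, where it is an empty sum.
    · have h0 : σ.1 = ∅ := card_eq_zero.mp (by omega)
      rw [h0]
      exact (map_zero _).symm
  refine ⟨fun j => ⟨z j, hz j⟩, ?_⟩
  refine (Submodule.Quotient.eq _).mpr ?_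
  change K.thetaExt k (i + 1) z - φ ∈ LinearMap.range _
  -- The chain `φ` is `theta ψ + dw`, and `z` has the same image as `ψ` because extending the
  -- cocycles does not change their values on faces inside `U`.
  refine ⟨fun W => -w W.1, funext fun T => ?_⟩
  refine (gdiff_coe _ (-w) T).trans ?_
  have hT := hw T.1 T.2
  rw [extendChain_apply _ T.2] at hT
  have hθ : K.thetaExt k (i + 1) z T = K.theta k ψ T.1 := by
    refine K.theta_congr k fun F hF hFT => ?_
    have hU : (F ∪ T.1).card = F.card + (i + 1) := by rw [card_union_of_disjoint hFT, T.2]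
    have hF' : F ∈ K.facesOfDim (((cardFin (F ∪ T.1) : ℕ) : ℤ) - (i + 1 : ℕ) - 1) :=
      K.mem_facesOfDim.mpr ⟨hF, by rw [coe_cardFin]; omega⟩
    rw [component, extend, dif_pos hF']
    refine (extCoord_ofCoords k rfl fun U => ψ' U F).trans ?_
    exact (hψ' (F ∪ T.1) F.card hU.symm).2 F
      (K.mem_delSet_compl.mpr ⟨hF, subset_union_left⟩) rfl
  change diff X (-w) T.1 = K.thetaExt k (i + 1) z T - φ T
  rw [hθ, map_neg, Pi.neg_apply]
  rw [show φ T = _ from hT]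
  abel

end FaceComplex

/-! ### The module structure and the isomorphism for Tor -/

namespace FaceComplex

open MvPolynomial Koszul Finset CategoryTheory

variable {n : ℕ} (K : FaceComplex (Fin n)) (k : Type u) [Field k]

lemma mem_span_range_X_iff (p : MvPolynomial (Fin n) k) :
    p ∈ Ideal.span (Set.range (X : Fin n → MvPolynomial (Fin n) k)) ↔ constantCoeff p = 0 := by
  rw [← Set.image_univ, mem_ideal_span_X_image, constantCoeff_eq]
  constructor
  · intro h
    by_contra hne
    obtain ⟨i, -, hi⟩ := h 0 (mem_support_iff.mpr hne)
    exact hi rfl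
  · intro h m hm
    by_contra hne
    push Not at hne
    obtain rfl : m = 0 := Finsupp.ext fun i => hne i trivial
    exact mem_support_iff.mp hm h

lemma smul_homology_eq_zero {S : Type u} [CommRing S] {ι : Type} [LinearOrder ι] [Fintype ι]
    (x : ι → S) {M : Type u} [AddCommGroup M] [Module S M] {a : S}
    (ha : a ∈ Ideal.span (Set.range x)) {i : ℕ} (y : Homology x M i) : a • y = 0 := by
  obtain ⟨⟨φ, hφ⟩, rfl⟩ := Submodule.mkQ_surjective _ y
  obtain ⟨ψ, hψ⟩ := exists_diff_eq_smul (x := x) (φ := extendChain S M (i + 1) φ) (i := i + 1)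
    (fun T hT => congrFun (LinearMap.mem_ker.mp hφ) ⟨T, by omega⟩) ha
  refine (Submodule.Quotient.mk_eq_zero _).mpr ?_
  change a • φ ∈ LinearMap.range _
  refine ⟨fun W => ψ W.1, funext fun T => (gdiff_coe x ψ T).trans ?_⟩
  rw [hψ T.1 T.2, extendChain_apply _ T.2]
  rfl

/-- A polynomial differs from its constant term by an element of the ideal of the variables, and
that ideal annihilates Koszul homology. -/
lemma smul_homology (p : MvPolynomial (Fin n) k) {i : ℕ}
    (y : Homology (X : Fin n → MvPolynomial (Fin n) k) (K.FaceRing k) i) :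
    p • y = constantCoeff p • y := by
  have h : p - C (constantCoeff p) ∈
      Ideal.span (Set.range (X : Fin n → MvPolynomial (Fin n) k)) := by
    rw [mem_span_range_X_iff]; simp
  have := smul_homology_eq_zero _ h y
  rw [sub_smul, sub_eq_zero] at this
  rw [this, ← algebraMap_eq, algebraMap_smul]

variable {K k}

variable (K k) in
/-- The cohomology class of a cocycle. -/
def cohomologyMk (G : Type u) [AddCommGroup G] [Module k G] (i : ℤ) :
    LinearMap.ker (K.coboundary k G i (i + 1)) →ₗ[k] K.ReducedCohomology k G i :=
  Submodule.mkQ ((LinearMap.range (K.coboundary k G (i - 1) i)).submoduleOf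
    (LinearMap.ker (K.coboundary k G i (i + 1))))

variable (K k) in
lemma cohomologyMk_surjective (G : Type u) [AddCommGroup G] [Module k G] (i : ℤ) :
    Function.Surjective (K.cohomologyMk k G i) :=
  Submodule.mkQ_surjective _

variable (K k) in
lemma ker_cohomologyMk (G : Type u) [AddCommGroup G] [Module k G] (i : ℤ) :
    LinearMap.ker (K.cohomologyMk k G i) = (LinearMap.range (K.coboundary k G (i - 1) i)).submoduleOf
      (LinearMap.ker (K.coboundary k G i (i + 1))) :=
  Submodule.ker_mkQ _

variable (K k) in
/-- The family of cohomology classes of a family of cocycles. -/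
def extCohomologyMk (i : ℕ) : K.ExtCocycles k i →ₗ[k]
    ∀ j : Fin (n + 1), K.ReducedCohomology k (⋀[k]^(j : ℕ) (Fin n → k)) ((j : ℤ) - i - 1) :=
  LinearMap.pi fun j => K.cohomologyMk k _ _ ∘ₗ LinearMap.proj j

variable (K k) in
lemma extCohomologyMk_surjective (i : ℕ) : Function.Surjective (K.extCohomologyMk k i) := by
  intro y
  choose z hz using fun j : Fin (n + 1) => K.cohomologyMk_surjective k _ _ (y j)
  exact ⟨z, funext hz⟩

variable (K k) in
lemma ker_extCohomologyMk (i : ℕ) :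
    LinearMap.ker (K.extCohomologyMk k i) = K.extCoboundaries k i := by
  ext z
  rw [LinearMap.mem_ker, extCoboundaries, Submodule.mem_pi]
  simp only [← ker_cohomologyMk, LinearMap.mem_ker]
  exact funext_iff.trans ⟨fun h j _ => h j, fun h j => h j trivial⟩

lemma ker_extCohomologyMk_eq_ker_toKoszul {c i : ℕ} (h : LinksAcyclic k K.faceSet c)
    (hi : n < i + 1 + c) :
    LinearMap.ker (K.extCohomologyMk k (i + 1)) = LinearMap.ker (K.toKoszul k i) :=
  (K.ker_extCohomologyMk k (i + 1)).trans (ker_toKoszul (K := K) (k := k) (c := c) (i := i) h hi).symm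

/-- Two surjections with the same kernel have isomorphic targets. -/
noncomputable def equivOfKerEq {Z P Q : Type*} [AddCommGroup Z] [AddCommGroup P] [AddCommGroup Q]
    [Module k Z] [Module k P] [Module k Q] (f : Z →ₗ[k] P) (g : Z →ₗ[k] Q)
    (hf : Function.Surjective f) (hg : Function.Surjective g)
    (h : LinearMap.ker f = LinearMap.ker g) : P ≃ₗ[k] Q :=
  (f.quotKerEquivOfSurjective hf).symm.trans
    ((Submodule.quotEquivOfEq _ _ h).trans (g.quotKerEquivOfSurjective hg))

/-- The Koszul homology of the face ring as a product of cohomology spaces. -/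
noncomputable def cohomologyPiEquiv {c i : ℕ} (h : LinksAcyclic k K.faceSet c)
    (hi : n < i + 1 + c) :
    (∀ j : Fin (n + 1),
      K.ReducedCohomology k (⋀[k]^(j : ℕ) (Fin n → k)) ((j : ℤ) - (i + 1 : ℕ) - 1)) ≃ₗ[k]
      Homology (X : Fin n → MvPolynomial (Fin n) k) (K.FaceRing k) i :=
  equivOfKerEq (Z := K.ExtCocycles k (i + 1)) (K.extCohomologyMk k (i + 1)) (K.toKoszul k i)
    (K.extCohomologyMk_surjective k (i + 1))
    (toKoszul_surjective (K := K) (k := k) (c := c) (i := i) h hi)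
    (ker_extCohomologyMk_eq_ker_toKoszul (K := K) (k := k) (c := c) (i := i) h hi)

/-- The Koszul homology of the face ring in terms of the cohomology of the complex. -/
noncomputable def cohomologyEquiv {c i : ℕ} (h : LinksAcyclic k K.faceSet c)
    (hi : n < i + 1 + c) :
    (DirectSum (Fin (n + 1)) fun j =>
      K.ReducedCohomology k (⋀[k]^(j : ℕ) (Fin n → k)) ((j : ℤ) - (i + 1 : ℕ) - 1)) ≃ₗ[k]
      Homology (X : Fin n → MvPolynomial (Fin n) k) (K.FaceRing k) i :=
  (DirectSum.linearEquivFunOnFintype k _ _).trans <|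
    cohomologyPiEquiv h hi

variable (K k) in
/-- `Tor` of the face ring is Koszul homology. -/
noncomputable def torFaceRingIso (i : ℕ) : K.torFaceRing k (i + 1) ≅
    ModuleCat.of _ (Homology (X : Fin n → MvPolynomial (Fin n) k) (K.FaceRing k) i) :=
  torIso X (K.FaceRing k) (fun i => exactAt_mvPolynomial k i.succ_ne_zero) i

variable (K k) in
lemma subsingleton_torFaceRing_iff (i : ℕ) : Subsingleton (K.torFaceRing k (i + 1)) ↔
    ExactAt (X : Fin n → MvPolynomial (Fin n) k) (K.FaceRing k) (i + 1) := by
  rw [exactAt_succ_iff, (torFaceRingIso K k i).toLinearEquiv.toEquiv.subsingleton_congr]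
  exact Submodule.Quotient.subsingleton_iff.trans Submodule.submoduleOf_eq_top

/-- An `S`-module on which `R` acts through `f : R → S` is a restriction of scalars. -/
noncomputable def restrictScalarsIso {R S : Type u} [CommRing R] [CommRing S] (f : R →+* S)
    {H D : Type u} [AddCommGroup H] [Module R H] [Module S H] [AddCommGroup D] [Module S D]
    (hf : ∀ (r : R) (y : H), r • y = f r • y) (e : D ≃ₗ[S] H) :
    ModuleCat.of R H ≅ (ModuleCat.restrictScalars f).obj (ModuleCat.of S D) :=
  letI : Module R D := Module.compHom D f
  LinearEquiv.toModuleIso (X₁ := H) (X₂ := D)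
    { e.symm with map_smul' := fun r y => by rw [hf]; exact map_smul e.symm (f r) y }

/-- `Tor` of the face ring in terms of the cohomology of the complex. -/
noncomputable def torCohomologyIso {c i : ℕ} (h : LinksAcyclic k K.faceSet c)
    (hi : n < i + 1 + c) : K.torFaceRing k (i + 1) ≅
      (ModuleCat.restrictScalars (constantCoeff : MvPolynomial (Fin n) k →+* k)).obj
        (ModuleCat.of k (DirectSum (Fin (n + 1)) fun j =>
          K.ReducedCohomology k (⋀[k]^(j : ℕ) (Fin n → k)) ((j : ℤ) - (i + 1 : ℕ) - 1))) :=
  torFaceRingIso K k i ≪≫ restrictScalarsIso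
    (H := Homology (X : Fin n → MvPolynomial (Fin n) k) (K.FaceRing k) i)
    (D := DirectSum (Fin (n + 1)) fun j =>
      K.ReducedCohomology k (⋀[k]^(j : ℕ) (Fin n → k)) ((j : ℤ) - (i + 1 : ℕ) - 1))
    (constantCoeff : MvPolynomial (Fin n) k →+* k) (fun p y => smul_homology K k p y)
    (cohomologyEquiv (K := K) (k := k) (c := c) (i := i) h hi)

end FaceComplex

open RingTheory.Sequence

/-! ### Depth of a local ring -/

section Depth

variable {A : Type u} [CommRing A] [IsLocalRing A]

lemma length_le_localDepth {rs : List A} (h : IsRegular A rs)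
    (hrs : ∀ r ∈ rs, r ∈ IsLocalRing.maximalIdeal A) : (rs.length : ℕ∞) ≤ localDepth A :=
  le_iSup₂_of_le (f := fun (rs : List A) (_ : IsRegular A rs ∧
    ∀ r ∈ rs, r ∈ IsLocalRing.maximalIdeal A) => (rs.length : ℕ∞)) rs ⟨h, hrs⟩ le_rfl

/-- Passing to the quotient by a regular sequence lowers the dimension by its length, and the
quotient is non-zero. -/
lemma localDepth_le_ringKrullDim [IsNoetherianRing A] :
    (localDepth A : WithBot ℕ∞) ≤ ringKrullDim A := by
  obtain ⟨e, he⟩ := WithBot.ne_bot_iff_exists.mp (ringKrullDim_ne_bot (R := A))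
  rw [← he, WithBot.coe_le_coe]
  refine iSup₂_le fun rs h => ?_
  rw [← WithBot.coe_le_coe, he, ← ringKrullDim_add_length_eq_ringKrullDim_of_isRegular rs h.1]
  have : Nontrivial (A ⧸ Ideal.ofList rs) := Ideal.Quotient.nontrivial_iff.mpr fun h' =>
    h.1.2 (by simp [h'])
  exact le_add_of_nonneg_left ringKrullDim_nonneg_of_nontrivial

lemma exists_isRegular_of_le_localDepth {c : ℕ} (h : (c : ℕ∞) ≤ localDepth A) :
    ∃ rs : List A, IsRegular A rs ∧ (∀ r ∈ rs, r ∈ IsLocalRing.maximalIdeal A) ∧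
      c ≤ rs.length := by
  cases c with
  | zero => exact ⟨[], .nil A A, by simp, by simp⟩
  | succ c =>
    -- The supremum is not assumed to be attained or finite; a strict inequality with the
    -- predecessor already yields a sequence of the required length.
    have h' : (c : ℕ∞) < localDepth A :=
      lt_of_lt_of_le (by exact_mod_cast c.lt_succ_self) h
    obtain ⟨rs, hrs⟩ := lt_iSup_iff.mp h'
    obtain ⟨hreg, hlt⟩ := lt_iSup_iff.mp hrs
    exact ⟨rs, hreg.1, hreg.2, by exact_mod_cast hlt⟩

end Depth

/-! ### Regular sequences of monic polynomials -/

section Polynomial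

open Polynomial

variable {S : Type u} [CommRing S]

/-- Modulo `I` the polynomial `g` stays monic, so it is not a zero divisor over the quotient of `S`
by `I`. -/
lemma mem_map_C_of_monic_mul_mem {I : Ideal S} {g q : S[X]} (hg : g.Monic)
    (h : g * q ∈ I.map (C : S →+* S[X])) : q ∈ I.map (C : S →+* S[X]) := by
  have key : ∀ f : S[X], f ∈ I.map (C : S →+* S[X]) ↔ f.map (Ideal.Quotient.mk I) = 0 := by
    intro f
    simp [Ideal.mem_map_C_iff, Polynomial.ext_iff, Ideal.Quotient.eq_zero_iff_mem]
  rw [key, Polynomial.map_mul, (hg.map _).mul_right_eq_zero_iff] at h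
  exact (key q).mpr h

lemma isWeaklyRegular_append_monic {rs : List S} (h : IsWeaklyRegular S rs) {g : S[X]}
    (hg : g.Monic) : IsWeaklyRegular S[X] (rs.map C ++ [g]) := by
  rw [isWeaklyRegular_append_iff, isWeaklyRegular_singleton_iff]
  refine ⟨h.of_flat, (isSMulRegular_iff_right_eq_zero_of_smul).mpr fun y hy => ?_⟩
  obtain ⟨q, rfl⟩ := Submodule.mkQ_surjective _ y
  rw [← map_smul] at hy
  have h' := (Submodule.Quotient.mk_eq_zero _).mp hy
  refine (Submodule.Quotient.mk_eq_zero _).mpr ?_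
  rw [Ideal.smul_eq_mul, Ideal.mul_top, ← Ideal.map_ofList] at h' ⊢
  exact mem_map_C_of_monic_mul_mem hg h'

lemma isWeaklyRegular_map_ringEquiv {S T : Type*} [CommRing S] [CommRing T] (e : S ≃+* T)
    {rs : List S} (h : IsWeaklyRegular S rs) : IsWeaklyRegular T (rs.map e) :=
  (AddEquiv.isWeaklyRegular_congr (e := e.toAddEquiv) (List.forall₂_map_right_iff.mpr <|
    List.forall₂_same.mpr fun r _ x => map_mul e r x)).mp h

/-- A weakly regular sequence of the coefficient ring, extended by monic polynomials in the
different variables, is weakly regular in the polynomial ring. -/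
lemma exists_isWeaklyRegular_mvPolynomial (ι : Type) [Finite ι] :
    ∀ (S : Type u) [CommRing S] (rs : List S), IsWeaklyRegular S rs →
      ∀ g : ι → S[X], (∀ i, (g i).Monic) →
        ∃ ts : List (MvPolynomial ι S), ts.length = Nat.card ι ∧
          (∀ t ∈ ts, ∃ i, t = aeval (MvPolynomial.X i) (g i)) ∧
          IsWeaklyRegular (MvPolynomial ι S) (rs.map MvPolynomial.C ++ ts) := by
  induction ι using Finite.induction_empty_option with
  | @of_equiv α β e ih =>
    intro S _ rs h g hg
    obtain ⟨ts, hlen, hts, hreg⟩ := ih S rs h (g ∘ e) (fun i => hg _)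
    refine ⟨ts.map (MvPolynomial.renameEquiv S e), ?_, ?_, ?_⟩
    · rw [List.length_map, hlen, Nat.card_congr e]
    · intro t ht
      obtain ⟨t, ht', rfl⟩ := List.mem_map.mp ht
      obtain ⟨i, rfl⟩ := hts t ht'
      refine ⟨e i, ?_⟩
      rw [← Polynomial.aeval_algHom_apply]
      simp
    · have := isWeaklyRegular_map_ringEquiv (MvPolynomial.renameEquiv S e).toRingEquiv hreg
      simpa [Function.comp_def] using this
  | h_empty =>
    intro S _ rs h g hg
    exact ⟨[], by simp, by simp, by simpa using h.of_flat (S := MvPolynomial PEmpty S)⟩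
  | @h_option α _ ih =>
    intro S _ rs h g hg
    -- The new variable is absorbed into the coefficient ring, where its monic polynomial prolongs
    -- the given sequence; the induction hypothesis holds over every base ring.
    obtain ⟨ts, hlen, hts, hreg⟩ := ih S[X] (rs.map C ++ [g none])
      (isWeaklyRegular_append_monic h (hg none)) (fun i => (g (some i)).map C)
      (fun i => (hg _).map _)
    let e := (MvPolynomial.optionEquivRight S α).symm
    refine ⟨(MvPolynomial.C (g none) :: ts).map e, ?_, ?_, ?_⟩
    · simp [hlen]
    · intro t ht
      obtain ⟨t, ht', rfl⟩ := List.mem_map.mp ht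
      rcases List.mem_cons.mp ht' with rfl | ht'
      · refine ⟨none, e.symm.injective ?_⟩
        rw [e.symm_apply_apply, ← Polynomial.aeval_algHom_apply]
        have : aeval (MvPolynomial.C X : MvPolynomial α S[X]) (g none) =
            MvPolynomial.C (aeval X (g none)) :=
          Polynomial.aeval_algHom_apply (IsScalarTower.toAlgHom S S[X] (MvPolynomial α S[X])) _ _
        simpa [e, MvPolynomial.optionEquivRight_X_none] using this.symm
      · obtain ⟨i, rfl⟩ := hts t ht'
        refine ⟨some i, e.symm.injective ?_⟩
        rw [e.symm_apply_apply, ← Polynomial.aeval_algHom_apply]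
        simp [e, ← Polynomial.algebraMap_eq]
    · have hC : ∀ r : S, e (MvPolynomial.C (C r)) = MvPolynomial.C r := fun r =>
        e.symm.injective (by simp [e])
      have := isWeaklyRegular_map_ringEquiv e.toRingEquiv hreg
      simpa [Function.comp_def, hC] using this

end Polynomial

/-! ### Localization at maximal ideals -/

section Localization

variable {A E : Type u} [CommRing A] [CommRing E] [Algebra A E]

/-- A quotient of a ring by an ideal which vanishes at a prime has the same localization. -/
lemma exists_isLocalizedModule_of_surjective (hsurj : Function.Surjective (algebraMap A E))
    (P : Ideal A) [P.IsPrime] {t : A} (ht : t ∉ P)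
    (hker : ∀ a, algebraMap A E a = 0 → t * a = 0) :
    ∃ f : E →ₗ[A] Localization.AtPrime P, IsLocalizedModule.AtPrime P f := by
  have hle : LinearMap.ker (Algebra.linearMap A E) ≤
      LinearMap.ker (Algebra.linearMap A (Localization.AtPrime P)) := fun a ha =>
    (IsLocalization.map_eq_zero_iff P.primeCompl _ a).mpr ⟨⟨t, ht⟩, hker a ha⟩
  let f : E →ₗ[A] Localization.AtPrime P :=
    Submodule.liftQ _ (Algebra.linearMap A (Localization.AtPrime P)) hle ∘ₗ
      ((Algebra.linearMap A E).quotKerEquivOfSurjective hsurj).symm.toLinearMap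
  have hf : ∀ a, f (algebraMap A E a) = algebraMap A _ a := fun a => by
    have : ((Algebra.linearMap A E).quotKerEquivOfSurjective hsurj).symm (algebraMap A E a) =
        Submodule.Quotient.mk a := (LinearEquiv.symm_apply_eq _).mpr rfl
    rw [LinearMap.comp_apply, LinearEquiv.coe_coe, this]
    rfl
  refine ⟨f, ⟨fun s => ?_, fun y => ?_, fun {y₁ y₂} h => ?_⟩⟩
  · exact IsLocalizedModule.map_units (Algebra.linearMap A (Localization.AtPrime P)) s
  · obtain ⟨⟨a, s⟩, h⟩ := IsLocalizedModule.surj P.primeCompl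
      (Algebra.linearMap A (Localization.AtPrime P)) y
    exact ⟨(algebraMap A E a, s), h.trans (hf a).symm⟩
  · obtain ⟨a, rfl⟩ := hsurj y₁
    obtain ⟨b, rfl⟩ := hsurj y₂
    rw [hf, hf] at h
    obtain ⟨s, hs⟩ := IsLocalizedModule.exists_of_eq (S := P.primeCompl)
      (f := Algebra.linearMap A (Localization.AtPrime P)) h
    refine ⟨s, ?_⟩
    have := congrArg (algebraMap A E) hs
    simpa [Submonoid.smul_def, Algebra.smul_def] using this

/-- The kernel of the surjection is killed by `t ∉ P`, so it disappears at `P` and `E` localizes to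
the local ring of `A`. A weakly regular sequence on `E` coming from `P` therefore becomes regular in
that local ring. -/
lemma length_le_localDepth_of_surjective (hsurj : Function.Surjective (algebraMap A E))
    (P : Ideal A) [P.IsPrime] {t : A} (ht : t ∉ P)
    (hker : ∀ a, algebraMap A E a = 0 → t * a = 0) {rs : List E} (hreg : IsWeaklyRegular E rs)
    (hrs : ∀ r ∈ rs, r ∈ P.map (algebraMap A E)) :
    (rs.length : ℕ∞) ≤ localDepth (Localization.AtPrime P) := by
  obtain ⟨f, hf⟩ := exists_isLocalizedModule_of_surjective hsurj P ht hker
  have hex : ∀ r ∈ rs, ∃ a ∈ P, algebraMap A E a = r := fun r hr =>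
    (Ideal.mem_map_iff_of_surjective _ hsurj).mp (hrs r hr)
  obtain ⟨as, has, rfl⟩ : ∃ as : List A, (∀ a ∈ as, a ∈ P) ∧ as.map (algebraMap A E) = rs := by
    clear hreg hrs
    induction rs with
    | nil => exact ⟨[], by simp⟩
    | cons r rs ih =>
      obtain ⟨as, has, rfl⟩ := ih fun r hr => hex r (List.mem_cons_of_mem _ hr)
      obtain ⟨a, ha, rfl⟩ := hex r List.mem_cons_self
      exact ⟨a :: as, by simpa [ha] using has, rfl⟩
  rw [isWeaklyRegular_map_algebraMap_iff] at hreg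
  have := hreg.isRegular_of_isLocalizedModule_of_mem (Localization.AtPrime P) P f has
  rw [List.length_map, ← List.length_map (f := algebraMap A (Localization.AtPrime P))]
  refine length_le_localDepth this fun r hr => ?_
  obtain ⟨a, ha, rfl⟩ := List.mem_map.mp hr
  exact (IsLocalization.AtPrime.to_map_mem_maximal_iff _ P a).mpr (has a ha)

end Localization

namespace Koszul

variable {ι : Type*} [LinearOrder ι] [Fintype ι] {A : Type u} [CommRing A]

/-- Koszul homology can be computed after localizing at a maximal ideal generated by the
sequence. -/
lemma ExactAt.of_localization {x : ι → A} {P : Ideal A} [P.IsMaximal]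
    (hP : Ideal.span (Set.range x) = P) {i : ℕ}
    (h : ExactAt (fun l => algebraMap A (Localization.AtPrime P) (x l))
      (Localization.AtPrime P) i) : ExactAt x A i := by
  intro φ hφ
  have hmap : ∀ (χ : Finset ι → A) T, algebraMap A (Localization.AtPrime P) (diff x χ T) =
      diff (fun l => algebraMap A (Localization.AtPrime P) (x l))
        (fun W => algebraMap A (Localization.AtPrime P) (χ W)) T := fun χ T =>
    map_diff (algebraMap A (Localization.AtPrime P)).toAddMonoidHom x _ (by simp) χ T
  obtain ⟨ψ, hψ⟩ := h (fun W => algebraMap A _ (φ W)) fun T hT => by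
    rw [← hmap, hφ T hT, map_zero]
  obtain ⟨s, hs⟩ := IsLocalization.exist_integer_multiples_of_finite P.primeCompl ψ
  choose χ hχ using hs
  -- After clearing the denominator `s`, the equation in degree `i` holds up to one further element
  -- outside `P` for each set; the product over all sets serves them simultaneously.
  have hloc : ∀ T : Finset ι, ∃ t : P.primeCompl, T.card = i →
      (t : A) * diff x χ T = t * (s * φ T) := by
    intro T
    by_cases hT : T.card = i
    · have : algebraMap A (Localization.AtPrime P) (diff x χ T) = algebraMap A _ (s * φ T) := by
        rw [hmap, map_mul, ← hψ T hT]
        have : (fun W => algebraMap A (Localization.AtPrime P) (χ W)) =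
            algebraMap A (Localization.AtPrime P) s • ψ := funext fun W => by
          rw [hχ W]; simp [Algebra.smul_def]
        rw [this, map_smul]; rfl
      obtain ⟨t, ht⟩ := (IsLocalization.eq_iff_exists P.primeCompl _).mp this
      exact ⟨t, fun _ => ht⟩
    · exact ⟨1, fun h => (hT h).elim⟩
  choose t ht using hloc
  let u : P.primeCompl := (∏ T, t T) * s
  have hu : ∀ T : Finset ι, T.card = i →
      diff x (fun W => (∏ T, (t T : A)) * χ W) T = u * φ T := by
    intro T hT
    have : (fun W => (∏ T, (t T : A)) * χ W) = (∏ T, (t T : A)) • χ := rfl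
    rw [this, map_smul, Pi.smul_apply, smul_eq_mul]
    have hsplit := Finset.prod_erase_mul Finset.univ (fun T => (t T : A)) (Finset.mem_univ T)
    have huv : (u : A) = (∏ T, (t T : A)) * s := by simp [u]
    rw [huv, ← hsplit, mul_assoc, ht T hT]; ring
  -- Now `uφ` is a boundary with `u ∉ P`, and `aφ` is a boundary for `a ∈ P`; as `ru + a = 1`, so is
  -- `φ`.
  obtain ⟨r, a, ha, hr⟩ := Ideal.IsMaximal.exists_inv (I := P) inferInstance u.2
  obtain ⟨η, hη⟩ := exists_diff_eq_smul hφ (hP.symm ▸ ha)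
  refine ⟨r • (fun W => (∏ T, (t T : A)) * χ W) + η, fun T hT => ?_⟩
  rw [map_add, map_smul, Pi.add_apply, Pi.smul_apply, hu T hT, hη T hT, smul_eq_mul, smul_eq_mul,
    ← mul_assoc, ← add_mul, hr, one_mul]

end Koszul

/-! ### Krull dimension of the face ring -/

namespace FaceComplex

open MvPolynomial Koszul Finset RingTheory.Sequence

variable {n : ℕ} (K : FaceComplex (Fin n)) (k : Type u) [Field k]

lemma prod_X_mem_faceIdeal {s : Finset (Fin n)} (hs : s ∉ K.faces) :
    ∏ v ∈ s, (X v : MvPolynomial (Fin n) k) ∈ K.faceIdeal k :=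
  Ideal.subset_span ⟨s, hs, rfl⟩

/-- The squarefree monomial of a non-face is zero, so a prime ideal contains one of its variables.
Every prime thus determines a face. -/
lemma mem_faces_of_notMem {P : Ideal (K.FaceRing k)} [P.IsPrime] {F : Finset (Fin n)}
    (hF : ∀ v ∈ F, Ideal.Quotient.mk (K.faceIdeal k) (X v) ∉ P) : F ∈ K.faces := by
  by_contra h
  have h0 : ∏ v ∈ F, Ideal.Quotient.mk (K.faceIdeal k) (X v) ∈ P := by
    rw [← map_prod, Ideal.Quotient.eq_zero_iff_mem.mpr (K.prod_X_mem_faceIdeal k h)]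
    exact P.zero_mem
  obtain ⟨v, hv, hvP⟩ := (Ideal.IsPrime.prod_mem_iff (p := P)).mp h0
  exact hF v hv hvP

section Dimension

/-- Setting the variables outside a face to zero. -/
noncomputable def faceEval {F : Finset (Fin n)} (hF : F ∈ K.faces) :
    K.FaceRing k →+* MvPolynomial (Fin n) k :=
  Ideal.Quotient.lift (K.faceIdeal k)
    (aeval fun v => if v ∈ F then X v else 0 : MvPolynomial (Fin n) k →ₐ[k] _).toRingHom
    fun p hp => by
      have hle : K.faceIdeal k ≤ RingHom.ker
          (aeval fun v => if v ∈ F then X v else 0 :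
            MvPolynomial (Fin n) k →ₐ[k] MvPolynomial (Fin n) k).toRingHom := by
        refine Ideal.span_le.mpr ?_
        rintro _ ⟨s, hs, rfl⟩
        obtain ⟨v, hv, hvF⟩ := not_subset.mp fun h => hs (K.down_closed hF h)
        simp only [SetLike.mem_coe, RingHom.mem_ker, map_prod]
        exact prod_eq_zero hv (by simp [hvF])
      exact hle hp

lemma faceEval_mk_X {F : Finset (Fin n)} (hF : F ∈ K.faces) (v : Fin n) :
    K.faceEval k hF (Ideal.Quotient.mk _ (X v)) = if v ∈ F then X v else 0 := by
  simp [faceEval]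

lemma faceEval_mk {F : Finset (Fin n)} (hF : F ∈ K.faces) (p : MvPolynomial (Fin n) k) :
    K.faceEval k hF (Ideal.Quotient.mk _ p) = aeval (fun v => if v ∈ F then X v else 0) p :=
  rfl

lemma ker_faceEval_lt {F : Finset (Fin n)} {v : Fin n} (hv : v ∉ F) (hF : insert v F ∈ K.faces) :
    RingHom.ker (K.faceEval k hF) <
      RingHom.ker (K.faceEval k (K.down_closed hF (subset_insert v F))) := by
  refine lt_of_le_of_ne (fun a ha => ?_) fun h => ?_
  · obtain ⟨p, rfl⟩ := Ideal.Quotient.mk_surjective a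
    rw [RingHom.mem_ker, faceEval_mk] at ha ⊢
    have := congrArg (aeval fun w => if w ∈ F then (X w : MvPolynomial (Fin n) k) else 0) ha
    rw [map_zero, ← AlgHom.comp_apply, comp_aeval] at this
    refine Eq.trans ?_ this
    congr 2
    funext w
    by_cases hw : w ∈ F <;> by_cases hwv : w = v <;> simp [hw, hwv]
  · have : Ideal.Quotient.mk (K.faceIdeal k) (X v) ∈ RingHom.ker (K.faceEval k hF) := by
      rw [h, RingHom.mem_ker, faceEval_mk_X, if_neg hv]
    rw [RingHom.mem_ker, faceEval_mk_X, if_pos (mem_insert_self v F)] at this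
    exact X_ne_zero v this

/-- Adding the vertices of `T` to `G` one by one gives a strictly descending chain of primes, the
kernels of the evaluations on the corresponding coordinate subspaces. -/
lemma card_le_height_ker_faceEval (T : Finset (Fin n)) : ∀ {G : Finset (Fin n)}
    (_ : Disjoint G T) (_ : G ∪ T ∈ K.faces) (hG : G ∈ K.faces),
    (T.card : ℕ∞) ≤ (RingHom.ker (K.faceEval k hG)).height := by
  induction T using Finset.induction_on with
  | empty => simp
  | insert v T hv ih =>
    intro G hd h hG
    have hvG : v ∉ G := fun hv' => disjoint_left.mp hd hv' (mem_insert_self v T)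
    have h' : insert v G ∪ T ∈ K.faces := by rwa [insert_union, ← union_insert]
    have hG' : insert v G ∈ K.faces := K.down_closed h' subset_union_left
    have h1 := ih (G := insert v G) (disjoint_insert_left.mpr ⟨hv, hd.mono_right (subset_insert v T)⟩)
      h' hG'
    have := RingHom.ker_isPrime (K.faceEval k hG)
    have := RingHom.ker_isPrime (K.faceEval k hG')
    rw [card_insert_of_notMem hv, Nat.cast_add, Nat.cast_one]
    exact (add_le_add_left h1 1).trans
      (Ideal.height_add_one_le_of_lt_of_isPrime (K.ker_faceEval_lt k hvG hG'))

lemma ringKrullDim_quotient_le_card (P : Ideal (K.FaceRing k)) [P.IsPrime] {F : Finset (Fin n)}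
    (hF : ∀ v, v ∉ F → Ideal.Quotient.mk (K.faceIdeal k) (X v) ∈ P) :
    ringKrullDim (K.FaceRing k ⧸ P) ≤ F.card := by
  let f : MvPolynomial F k →ₐ[k] K.FaceRing k ⧸ P :=
    aeval fun v => Ideal.Quotient.mk P (Ideal.Quotient.mk _ (X v.1))
  let π : MvPolynomial (Fin n) k →ₐ[k] K.FaceRing k ⧸ P :=
    (Ideal.Quotient.mkₐ k P).comp (Ideal.Quotient.mkₐ k (K.faceIdeal k))
  have hπ : π = f.comp (aeval fun v => if h : v ∈ F then X ⟨v, h⟩ else 0) := by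
    refine MvPolynomial.algHom_ext fun v => ?_
    by_cases h : v ∈ F
    · simp [π, f, h]
    · simpa [π, f, h] using Ideal.Quotient.eq_zero_iff_mem.mpr (hF v h)
  have hf : Function.Surjective f := fun y => by
    obtain ⟨a, rfl⟩ := Ideal.Quotient.mk_surjective y
    obtain ⟨p, rfl⟩ := Ideal.Quotient.mk_surjective a
    exact ⟨_, (DFunLike.congr_fun hπ p).symm⟩
  refine (ringKrullDim_le_of_surjective f.toRingHom hf).trans ?_
  rw [MvPolynomial.ringKrullDim_of_isNoetherianRing, ringKrullDim_eq_zero_of_field]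
  simp

/-- All primes of a chain contain the smallest one, and the quotient by that prime is generated by
the variables of the face which it determines. -/
lemma ringKrullDim_faceRing_le : ringKrullDim (K.FaceRing k) ≤ (K.faces.sup card : ℕ) := by
  classical
  refine iSup_le fun l => ?_
  let P := l.head.asIdeal
  let F : Finset (Fin n) := univ.filter fun v => Ideal.Quotient.mk (K.faceIdeal k) (X v) ∉ P
  have hF : F ∈ K.faces := K.mem_faces_of_notMem k (P := P) fun v hv => (mem_filter.mp hv).2
  have h1 : ringKrullDim (K.FaceRing k ⧸ P) ≤ F.card :=
    K.ringKrullDim_quotient_le_card k P fun v hv => by simpa [F] using hv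
  let l' : LTSeries (PrimeSpectrum.zeroLocus (P : Set (K.FaceRing k))) :=
    { length := l.length
      toFun := fun i => ⟨l i, l.head_le i⟩
      step := fun i => l.step i }
  have h2 := Order.LTSeries.length_le_krullDim l'
  rw [← ringKrullDim_quotient] at h2
  refine (h2.trans h1).trans ?_
  exact_mod_cast le_sup (f := card) hF

end Dimension

/-! ### Koszul homology of a Cohen–Macaulay face ring -/

section Origin

/-- The ideal of the face ring generated by the variables. -/
noncomputable def originIdeal : Ideal (K.FaceRing k) :=
  Ideal.span (Set.range fun v => Ideal.Quotient.mk (K.faceIdeal k) (X v))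

lemma mk_mem_originIdeal (p : MvPolynomial (Fin n) k) :
    Ideal.Quotient.mk (K.faceIdeal k) p ∈ K.originIdeal k ↔ constantCoeff p = 0 := by
  have hle : K.faceIdeal k ≤ Ideal.span (Set.range (X : Fin n → MvPolynomial (Fin n) k)) :=
    fun p hp => by
      rw [mem_span_range_X_iff, constantCoeff_eq]
      by_contra h
      exact (mem_faceIdeal_iff K k p).mp hp 0 (mem_support_iff.mpr h) (by simpa using K.empty_mem)
  have : K.originIdeal k = (Ideal.span (Set.range (X : Fin n → MvPolynomial (Fin n) k))).map
      (Ideal.Quotient.mk (K.faceIdeal k)) := by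
    rw [originIdeal, Ideal.map_span, ← Set.range_comp]; rfl
  rw [this, Ideal.mem_quotient_iff_mem hle, mem_span_range_X_iff]

instance : (K.originIdeal k).IsMaximal := by
  have hz : ∀ a ∈ K.faceIdeal k, constantCoeff a = 0 := fun a ha =>
    (K.mk_mem_originIdeal k a).mp (by
      rw [Ideal.Quotient.eq_zero_iff_mem.mpr ha]; exact Ideal.zero_mem _)
  have : K.originIdeal k = RingHom.ker (Ideal.Quotient.lift (K.faceIdeal k) constantCoeff hz) := by
    ext a
    obtain ⟨p, rfl⟩ := Ideal.Quotient.mk_surjective a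
    rw [mk_mem_originIdeal, RingHom.mem_ker, Ideal.Quotient.lift_mk]
  rw [this]
  exact RingHom.ker_isMaximal_of_surjective _ fun a => ⟨Ideal.Quotient.mk _ (C a), by simp⟩

lemma le_height_originIdeal : ((K.faces.sup card : ℕ) : ℕ∞) ≤ (K.originIdeal k).height := by
  obtain ⟨F, hF, hc⟩ := exists_mem_eq_sup K.faces ⟨∅, K.empty_mem⟩ card
  rw [hc]
  refine (K.card_le_height_ker_faceEval k F (disjoint_empty_left F) (by simpa using hF)
    K.empty_mem).trans (Ideal.height_mono fun a ha => ?_)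
  obtain ⟨p, rfl⟩ := Ideal.Quotient.mk_surjective a
  rw [RingHom.mem_ker, faceEval_mk] at ha
  rw [mk_mem_originIdeal]
  have hz : (fun v => if v ∈ (∅ : Finset (Fin n)) then (X v : MvPolynomial (Fin n) k) else 0) =
      fun _ => 0 := by simp
  rw [hz, aeval_zero', algebraMap_eq] at ha
  exact C_injective _ _ (ha.trans (C_0).symm)

/-- If the face ring is Cohen–Macaulay, its Koszul complex is exact in high degrees. -/
lemma exactAt_of_isCohenMacaulayRing (h : IsCohenMacaulayRing (K.FaceRing k)) {i : ℕ}
    (hi : n < i + K.faces.sup card) :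
    ExactAt (X : Fin n → MvPolynomial (Fin n) k) (K.FaceRing k) i := by
  set L := Localization.AtPrime (K.originIdeal k)
  -- The Cohen–Macaulay property is used only at the origin, where the depth equals the height of
  -- the ideal of the variables.
  have hdepth : ((K.faces.sup card : ℕ) : ℕ∞) ≤ localDepth L := by
    rw [← WithBot.coe_le_coe, h.2 (K.originIdeal k),
      IsLocalization.AtPrime.ringKrullDim_eq_height (K.originIdeal k), WithBot.coe_le_coe]
    exact K.le_height_originIdeal k
  obtain ⟨rs, hreg, hmem, hlen⟩ := exists_isRegular_of_le_localDepth hdepth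
  have hL : ExactAt (fun l => algebraMap (K.FaceRing k) L (Ideal.Quotient.mk _ (X l))) L i := by
    refine exactAt_of_isWeaklyRegular (rs := rs) (fun r hr => ?_) L hreg.1 (by
      rw [Fintype.card_fin]; omega)
    have := hmem r hr
    rw [← Localization.AtPrime.map_eq_maximalIdeal] at this
    have hspan : (K.originIdeal k).map (algebraMap (K.FaceRing k) L) = Ideal.span (Set.range
        fun l => algebraMap (K.FaceRing k) L (Ideal.Quotient.mk _ (X l))) :=
      (Ideal.map_span _ _).trans (by rw [← Set.range_comp]; rfl)
    rwa [← hspan]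
  have hA := ExactAt.of_localization (P := K.originIdeal k) rfl hL
  have hdiff : ∀ (φ : Finset (Fin n) → K.FaceRing k) T,
      diff (X : Fin n → MvPolynomial (Fin n) k) φ T =
        diff (fun l => Ideal.Quotient.mk (K.faceIdeal k) (X l)) φ T := fun φ T =>
    map_diff (AddMonoidHom.id (K.FaceRing k)) (X : Fin n → MvPolynomial (Fin n) k)
      (fun l => Ideal.Quotient.mk (K.faceIdeal k) (X l)) (fun l y => rfl) φ T
  intro φ hφ
  obtain ⟨ψ, hψ⟩ := hA φ fun T hT => (hdiff φ T).symm.trans (hφ T hT)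
  exact ⟨ψ, fun T hT => (hdiff ψ T).trans (hψ T hT)⟩

end Origin

end FaceComplex

/-! ### Stars of faces and the Cohen–Macaulay property -/

namespace FaceComplex

open MvPolynomial Koszul Finset RingTheory.Sequence

variable {n : ℕ} (K : FaceComplex (Fin n)) (k : Type u) [Field k]

lemma sup_card_le : K.faces.sup card ≤ n :=
  Finset.sup_le fun s _ => (card_le_univ s).trans (Fintype.card_fin n).le

section Star

variable {K} {F : Finset (Fin n)} (hF : F ∈ K.faces)

/-- The coordinate ring of the star of a face `F`: polynomials in the vertices of `F` over the
face ring of the link. -/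
abbrev StarRing : Type u := MvPolynomial F ((K.link F hF).FaceRing k)

/-- The restriction of polynomial functions to the star of a face. -/
noncomputable def toStar : MvPolynomial (Fin n) k →ₐ[k] StarRing k hF :=
  aeval fun v => if h : v ∈ F then X ⟨v, h⟩ else C (Ideal.Quotient.mk _ (X v))

lemma toStar_X_of_mem {v : Fin n} (hv : v ∈ F) : toStar k hF (X v) = X ⟨v, hv⟩ := by
  simp [toStar, hv]

lemma toStar_X_of_notMem {v : Fin n} (hv : v ∉ F) :
    toStar k hF (X v) = C (Ideal.Quotient.mk _ (X v)) := by
  simp [toStar, hv]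

lemma mem_link_iff {s : Finset (Fin n)} :
    s ∈ (K.link F hF).faces ↔ Disjoint F s ∧ F ∪ s ∈ K.faces := by
  rw [link, mem_filter]
  exact ⟨fun h => h.2, fun h => ⟨K.down_closed h.2 subset_union_right, h⟩⟩

/-- The link is a complex on the same vertex set in which the elements of `F` are not vertices, so
their variables vanish in its face ring. -/
lemma mk_X_link_of_mem {v : Fin n} (hv : v ∈ F) :
    Ideal.Quotient.mk ((K.link F hF).faceIdeal k) (X v) = 0 := by
  have h : ({v} : Finset (Fin n)) ∉ (K.link F hF).faces := by
    rw [mem_link_iff, disjoint_singleton_right]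
    exact fun h => h.1 hv
  simpa using Ideal.Quotient.eq_zero_iff_mem.mpr ((K.link F hF).prod_X_mem_faceIdeal k h)

lemma faceIdeal_le_ker_toStar : K.faceIdeal k ≤ RingHom.ker (toStar k hF) := by
  refine Ideal.span_le.mpr ?_
  rintro _ ⟨s, hs, rfl⟩
  have h : s \ F ∉ (K.link F hF).faces := by
    rw [mem_link_iff, union_sdiff_self_eq_union]
    exact fun h => hs (K.down_closed h.2 subset_union_right)
  have h0 : ∏ v ∈ s \ F, toStar k hF (X v) = 0 := by
    have := congrArg (C : _ →+* StarRing k hF)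
      (Ideal.Quotient.eq_zero_iff_mem.mpr ((K.link F hF).prod_X_mem_faceIdeal k h))
    rw [map_prod, map_prod, map_zero] at this
    rw [← this]
    exact prod_congr rfl fun v hv => toStar_X_of_notMem k hF (mem_sdiff.mp hv).2
  rw [SetLike.mem_coe, RingHom.mem_ker, map_prod,
    ← prod_sdiff (sdiff_subset : s \ F ⊆ s), h0, mul_zero]

lemma C_mk_eq_toStar (p : MvPolynomial (Fin n) k) :
    (C (Ideal.Quotient.mk _ p) : StarRing k hF) =
      toStar k hF (aeval (fun v => if v ∈ F then 0 else X v) p) := by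
  let f : MvPolynomial (Fin n) k →ₐ[k] StarRing k hF :=
    (IsScalarTower.toAlgHom k ((K.link F hF).FaceRing k) (StarRing k hF)).comp
      (Ideal.Quotient.mkₐ k _)
  have : f = (toStar k hF).comp (aeval (fun v => if v ∈ F then 0 else X v)) := by
    refine MvPolynomial.algHom_ext fun v => ?_
    by_cases hv : v ∈ F
    · simp [f, hv, mk_X_link_of_mem]
    · simp [f, hv, toStar_X_of_notMem, algebraMap_eq]
  exact DFunLike.congr_fun this p

lemma toStar_surjective : Function.Surjective (toStar k hF) := by
  intro y
  induction y using MvPolynomial.induction_on with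
  | C d =>
    obtain ⟨p, rfl⟩ := Ideal.Quotient.mk_surjective d
    exact ⟨_, (C_mk_eq_toStar k hF p).symm⟩
  | add y z hy hz =>
    obtain ⟨p, rfl⟩ := hy
    obtain ⟨q, rfl⟩ := hz
    exact ⟨p + q, map_add _ _ _⟩
  | mul_X y v hy =>
    obtain ⟨p, rfl⟩ := hy
    exact ⟨p * X v.1, by rw [map_mul, toStar_X_of_mem k hF v.2]⟩

/-- The polynomials which vanish on the star of `F`, as an ideal quotient. -/
noncomputable def starIdeal (K : FaceComplex (Fin n)) (F : Finset (Fin n)) :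
    Ideal (MvPolynomial (Fin n) k) :=
  Submodule.comap (LinearMap.mulLeft (MvPolynomial (Fin n) k) (∏ v ∈ F, X v)) (K.faceIdeal k)

lemma mem_starIdeal {p : MvPolynomial (Fin n) k} :
    p ∈ starIdeal k K F ↔ (∏ v ∈ F, X v) * p ∈ K.faceIdeal k := Iff.rfl

/-- Modulo `starIdeal` the map to the star has a left inverse: the relations of the link become
relations there after multiplication by the monomial of `F`. Hence the kernel of `toStar` is
contained in `starIdeal`. -/
lemma prod_mul_mem_of_toStar_eq_zero {p : MvPolynomial (Fin n) k} (hp : toStar k hF p = 0) :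
    (∏ v ∈ F, X v) * p ∈ K.faceIdeal k := by
  let g : MvPolynomial (Fin n) k →ₐ[k] MvPolynomial (Fin n) k ⧸ starIdeal k K F :=
    aeval fun v => if v ∈ F then 0 else Ideal.Quotient.mk _ (X v)
  have hg : ∀ q ∈ (K.link F hF).faceIdeal k, g q = 0 := by
    suffices h : (K.link F hF).faceIdeal k ≤ RingHom.ker g from fun q hq => h hq
    refine Ideal.span_le.mpr ?_
    rintro _ ⟨s, hs, rfl⟩
    rw [SetLike.mem_coe, RingHom.mem_ker, map_prod]
    by_cases hd : Disjoint F s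
    · have h : F ∪ s ∉ K.faces := fun h => hs ((mem_link_iff hF).mpr ⟨hd, h⟩)
      have hmem : ∏ v ∈ s, X v ∈ starIdeal k K F := by
        rw [mem_starIdeal, ← prod_union hd]
        exact K.prod_X_mem_faceIdeal k h
      rw [← Ideal.Quotient.eq_zero_iff_mem, map_prod] at hmem
      rw [← hmem]
      refine prod_congr rfl fun v hv => ?_
      simp [g, disjoint_right.mp hd hv]
    · obtain ⟨v, hvF, hvs⟩ := not_disjoint_iff.mp hd
      exact prod_eq_zero hvs (by simp [g, hvF])
  let h : StarRing k hF →ₐ[k] MvPolynomial (Fin n) k ⧸ starIdeal k K F :=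
    aevalTower (Ideal.Quotient.liftₐ _ g hg) fun v => Ideal.Quotient.mk _ (X v.1)
  have hh : h.comp (toStar k hF) = Ideal.Quotient.mkₐ k (starIdeal k K F) := by
    refine MvPolynomial.algHom_ext fun v => ?_
    by_cases hv : v ∈ F
    · simp [h, toStar_X_of_mem k hF hv]
    · have hgv : g (X v) = Ideal.Quotient.mk _ (X v) := by simp [g, hv]
      rw [AlgHom.comp_apply, toStar_X_of_notMem k hF hv, ← algebraMap_eq]
      exact (aevalTower_algebraMap _ _ _).trans hgv
  rw [← mem_starIdeal, ← Ideal.Quotient.eq_zero_iff_mem]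
  have := DFunLike.congr_fun hh p
  rw [AlgHom.comp_apply, hp, map_zero] at this
  exact this.symm

/-- The depth of the face ring at a prime ideal is at least the length of a weakly regular sequence
on the face ring of the link of the face which is determined by the prime ideal, plus the number of
vertices of this face. -/
lemma le_localDepth_of_isWeaklyRegular (P : Ideal (K.FaceRing k)) [P.IsMaximal]
    (hFP : ∀ v, v ∈ F ↔ Ideal.Quotient.mk (K.faceIdeal k) (X v) ∉ P)
    {ds : List (MvPolynomial (Fin n) k)}
    (hds : ∀ a ∈ ds, a ∈ Ideal.span (Set.range (X : Fin n → MvPolynomial (Fin n) k)))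
    (hreg : IsWeaklyRegular ((K.link F hF).FaceRing k) ds) :
    ((ds.length + F.card : ℕ) : ℕ∞) ≤ localDepth (Localization.AtPrime P) := by
  let φ : K.FaceRing k →+* StarRing k hF :=
    Ideal.Quotient.lift (K.faceIdeal k) (toStar k hF).toRingHom (faceIdeal_le_ker_toStar k hF)
  have hφ : ∀ p, φ (Ideal.Quotient.mk _ p) = toStar k hF p := fun p => rfl
  let : Algebra (K.FaceRing k) (StarRing k hF) := φ.toAlgebra
  let := Ideal.Quotient.field P
  -- By the Nullstellensatz the residue field is finite over `k`, so each variable of `F` satisfies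
  -- a monic equation modulo `P`. These polynomials replace the variables themselves, which lie
  -- outside `P`.
  have hfin : Module.Finite k (K.FaceRing k ⧸ P) :=
    finite_of_finite_type_of_isJacobsonRing k (K.FaceRing k ⧸ P)
  have hint : ∀ v : F, ∃ h : Polynomial k, h.Monic ∧
      Ideal.Quotient.mk (K.faceIdeal k) (Polynomial.aeval (X v.1) h) ∈ P := by
    intro v
    obtain ⟨h, hm, h0⟩ := Algebra.IsIntegral.isIntegral (R := k)
      (Ideal.Quotient.mkₐ k P (Ideal.Quotient.mkₐ k (K.faceIdeal k) (X v.1)))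
    refine ⟨h, hm, ?_⟩
    change Polynomial.aeval _ h = 0 at h0
    rw [Polynomial.aeval_algHom_apply, Polynomial.aeval_algHom_apply] at h0
    exact Ideal.Quotient.eq_zero_iff_mem.mp h0
  choose h hm hP using hint
  obtain ⟨ts, hlen, hts, htreg⟩ := exists_isWeaklyRegular_mvPolynomial F ((K.link F hF).FaceRing k)
    (ds.map (algebraMap _ _)) ((isWeaklyRegular_map_algebraMap_iff _ _ ds).mpr hreg)
    (fun v => (h v).map (algebraMap k _)) (fun v => (hm v).map _)
  have hlength : ((ds.map (algebraMap (MvPolynomial (Fin n) k) ((K.link F hF).FaceRing k))).map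
      (C : _ →+* StarRing k hF) ++ ts).length = ds.length + F.card := by
    simp [hlen]
  rw [← hlength]
  refine length_le_localDepth_of_surjective (A := K.FaceRing k) (E := StarRing k hF) (fun y => ?_)
    -- The monomial of `F` is invertible at `P` by the choice of `F` and annihilates the kernel of
    -- the map to the star.
    P (t := Ideal.Quotient.mk _ (∏ v ∈ F, X v)) ?_ (fun a ha => ?_) htreg fun r hr => ?_
  · obtain ⟨p, rfl⟩ := toStar_surjective k hF y
    exact ⟨Ideal.Quotient.mk _ p, rfl⟩
  · rw [map_prod, Ideal.IsPrime.prod_mem_iff]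
    rintro ⟨v, hv, hvP⟩
    exact (hFP v).mp hv hvP
  · obtain ⟨p, rfl⟩ := Ideal.Quotient.mk_surjective a
    rw [← map_mul, Ideal.Quotient.eq_zero_iff_mem]
    exact prod_mul_mem_of_toStar_eq_zero k hF ha
  · rcases List.mem_append.mp hr with hr | hr
    · rw [List.map_map] at hr
      obtain ⟨p, hp, rfl⟩ := List.mem_map.mp hr
      have hle : Ideal.span (Set.range (X : Fin n → MvPolynomial (Fin n) k)) ≤
          (P.map φ).comap ((C : _ →+* StarRing k hF).comp (Ideal.Quotient.mk _)) := by
        refine Ideal.span_le.mpr ?_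
        rintro _ ⟨v, rfl⟩
        rw [SetLike.mem_coe, Ideal.mem_comap, RingHom.comp_apply]
        by_cases hv : v ∈ F
        · rw [mk_X_link_of_mem k hF hv, map_zero]
          exact Ideal.zero_mem _
        · rw [← toStar_X_of_notMem k hF hv, ← hφ]
          exact Ideal.mem_map_of_mem _ (not_not.mp fun h => hv ((hFP v).mpr h))
      exact hle (hds p hp)
    · obtain ⟨v, rfl⟩ := hts r hr
      rw [Polynomial.aeval_map_algebraMap, ← toStar_X_of_mem k hF v.2,
        Polynomial.aeval_algHom_apply, ← hφ]
      exact Ideal.mem_map_of_mem _ (hP v)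

end Star

variable {K k} in
/-- If all links, including the whole complex, have no cohomology below the top degree, then the
face ring is Cohen–Macaulay. -/
lemma isCohenMacaulayRing_of_acyclic
    (h : ∀ G m, m + G.card < K.faces.sup card → Acyclic k (linkSet K.faceSet G) m) :
    IsCohenMacaulayRing (K.FaceRing k) := by
  classical
  refine ⟨inferInstance, fun P _ => le_antisymm localDepth_le_ringKrullDim ?_⟩
  let F : Finset (Fin n) := univ.filter fun v => Ideal.Quotient.mk (K.faceIdeal k) (X v) ∉ P
  have hFP : ∀ v, v ∈ F ↔ Ideal.Quotient.mk (K.faceIdeal k) (X v) ∉ P := by simp [F]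
  have hF : F ∈ K.faces := K.mem_faces_of_notMem k fun v hv => (hFP v).mp hv
  have hc : F.card ≤ K.faces.sup card := le_sup (f := card) hF
  have hn := K.sup_card_le
  -- A link in the link of `F` is the link of a larger face, or empty if the sets meet; the
  -- criterion therefore applies to the link of `F` with its own bound.
  have hlink : LinksAcyclic k (K.link F hF).faceSet (K.faces.sup card - F.card) := by
    intro G m _ hm
    rw [faceSet_link]
    by_cases hd : Disjoint G F
    · rw [linkSet_linkSet F G hd]
      exact h _ _ (by rw [card_union_of_disjoint hd]; omega)
    · have : linkSet (linkSet K.faceSet F) G = ∅ := by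
        refine Set.eq_empty_of_forall_notMem fun s hs => hd ?_
        exact (disjoint_union_left.mp hs.2.1).2
      rw [this]
      exact acyclic_empty (A := k) m
  have hacyc : ∀ m < K.faces.sup card - F.card, Acyclic k (K.link F hF).faceSet m := by
    intro m hm
    rw [faceSet_link]
    exact h F m (by omega)
  obtain ⟨ds, hlen, hds, hreg⟩ := exists_isWeaklyRegular
    (x := (X : Fin n → MvPolynomial (Fin n) k)) (r := K.faces.sup card - F.card)
    (by rw [Fintype.card_fin]; omega) ((K.link F hF).FaceRing k)
    (fun i hi => exactAt_of_linksAcyclic _ k hlink hacyc (by rwa [Fintype.card_fin] at hi))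
  have hdepth := le_localDepth_of_isWeaklyRegular k hF P hFP hds hreg
  rw [hlen, Nat.sub_add_cancel hc] at hdepth
  rw [IsLocalization.AtPrime.ringKrullDim_eq_height P]
  refine Ideal.height_le_ringKrullDim_of_isPrime.trans ((K.ringKrullDim_faceRing_le k).trans ?_)
  exact_mod_cast hdepth

end FaceComplex

/-! ### The equivalences and the theorem -/

namespace FaceComplex

open MvPolynomial Koszul Finset

variable {n : ℕ} (K : FaceComplex (Fin n)) (k : Type u) [Field k]

lemma subsingleton_reducedHomology_lt_dim_iff :
    (∀ i : ℤ, i < K.dim → Subsingleton (K.ReducedHomology k k i)) ↔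
      ∀ m < K.faces.sup card, Acyclic k K.faceSet m := by
  constructor
  · intro h m hm
    exact (subsingleton_reducedHomology_iff K k rfl).mp (h _ (by rw [dim]; omega))
  · intro h i hi
    by_cases hlt : i < -1
    · exact subsingleton_reducedHomology_of_lt K k hlt
    · rw [dim] at hi
      exact (subsingleton_reducedHomology_iff K k (m := (i + 1).toNat) (by omega)).mpr
        (h _ (by omega))

lemma subsingleton_torFaceRing_gt_iff :
    (∀ i : ℕ, (n : ℤ) - K.dim - 1 < i → Subsingleton (K.torFaceRing k i)) ↔
      ∀ i : ℕ, n < i + K.faces.sup card →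
        ExactAt (X : Fin n → MvPolynomial (Fin n) k) (K.FaceRing k) i := by
  have hn := K.sup_card_le
  refine forall_congr' fun i => ?_
  have hiff : (n : ℤ) - K.dim - 1 < i ↔ n < i + K.faces.sup card := by rw [dim]; omega
  rw [hiff]
  refine forall_congr' fun hi => ?_
  -- Faces have at most `n` elements, so the range in question contains only positive degrees, where
  -- Tor is described by `Homology`.
  obtain ⟨j, rfl⟩ : ∃ j, i = j + 1 := ⟨i - 1, by omega⟩
  exact K.subsingleton_torFaceRing_iff k j

variable {K k}

lemma exactAt_iff_acyclic (h : LinksAcyclic k K.faceSet (K.faces.sup card)) :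
    (∀ i : ℕ, n < i + K.faces.sup card →
      ExactAt (X : Fin n → MvPolynomial (Fin n) k) (K.FaceRing k) i) ↔
      ∀ m < K.faces.sup card, Acyclic k K.faceSet m := by
  have hn := K.sup_card_le
  exact ⟨fun h' m hm => acyclic_of_exactAt K k (i := n - m) (by omega) (h' _ (by omega)),
    fun h' i hi => exactAt_of_linksAcyclic K k h h' hi⟩

lemma exactAt_iff_isCohenMacaulayRing (h : LinksAcyclic k K.faceSet (K.faces.sup card)) :
    (∀ i : ℕ, n < i + K.faces.sup card →
      ExactAt (X : Fin n → MvPolynomial (Fin n) k) (K.FaceRing k) i) ↔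
      IsCohenMacaulayRing (K.FaceRing k) := by
  refine ⟨fun h' => isCohenMacaulayRing_of_acyclic fun G m hm => ?_,
    fun h' i hi => K.exactAt_of_isCohenMacaulayRing k h' hi⟩
  -- The hypothesis on links covers all non-empty faces; the empty face, whose link is the whole
  -- complex, is the contribution of Koszul exactness.
  rcases G.eq_empty_or_nonempty with rfl | hG
  · have : linkSet K.faceSet ∅ = K.faceSet := by ext F; simp [linkSet]
    rw [this]
    exact (exactAt_iff_acyclic h).mp h' m (by simpa using hm)
  · exact h G m hG hm

end FaceComplex

theorem mainTheorem2 {k : Type u} [Field k] {n : ℕ} (K : FaceComplex (Fin n))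
    (hvert : ∀ v : Fin n, {v} ∈ K.faces) (d : ℤ) (hdim : K.dim = d) (hpure : K.IsPure)
    (hlink : ∀ (σ : Finset (Fin n)) (hσ : σ ∈ K.faces), σ.Nonempty →
      ∀ i : ℤ, i < (K.link σ hσ).dim → Subsingleton ((K.link σ hσ).ReducedHomology k k i)) :
    (∀ i : ℕ, (n : ℤ) - d - 1 < i →
      Nonempty (K.torFaceRing k i ≅
        (ModuleCat.restrictScalars
          (MvPolynomial.constantCoeff : MvPolynomial (Fin n) k →+* k)).obj
          (ModuleCat.of k (DirectSum (Fin (n + 1)) fun j =>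
            K.ReducedCohomology k (⋀[k]^(j : ℕ) (Fin n → k)) ((j : ℤ) - i - 1))))) ∧
    ((∀ i : ℤ, i < d → Subsingleton (K.ReducedHomology k k i)) ↔
      ∀ i : ℕ, (n : ℤ) - d - 1 < i → Subsingleton (K.torFaceRing k i)) ∧
    ((∀ i : ℕ, (n : ℤ) - d - 1 < i → Subsingleton (K.torFaceRing k i)) ↔
      IsCohenMacaulayRing (K.FaceRing k)) := by
  subst hdim
  have h : Koszul.LinksAcyclic k K.faceSet (K.faces.sup Finset.card) :=
    K.linksAcyclic_of_reducedHomology k hpure hlink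
  have hn := K.sup_card_le
  rw [K.subsingleton_torFaceRing_gt_iff k, K.subsingleton_reducedHomology_lt_dim_iff k]
  refine ⟨fun i hi => ?_, (FaceComplex.exactAt_iff_acyclic h).symm,
    FaceComplex.exactAt_iff_isCohenMacaulayRing h⟩
  rw [FaceComplex.dim] at hi
  obtain ⟨j, rfl⟩ : ∃ j, i = j + 1 := ⟨i - 1, by omega⟩
  exact ⟨FaceComplex.torCohomologyIso h (by omega)⟩
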